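/- **Setting.** Let $\mathbb T=\mathbb R/\mathbb Z$. For $\omega\in\{0,1,2,3\}$ let $f_\omega:\mathbb T\to\mathbb T$, $f_\omega(x)=\frac x2+\frac\omega4$ for $x\in[0,\frac12]$ and $f_\omega(x)=\frac{1-x}2+\frac\omega4$ for $x\in[\frac12,1]$, and $h_\omega(x,y)=\sin2\pi y-\sin2\pi x-\frac{\omega}{3.6}$. Fix $\beta>2$ and $c_{\rm hub},\lambda\in(0,1)$, and let $m,w,\delta,\alpha>0$ be functions of $N\in\mathbb N$ with, as $N\to\infty$, $$m\asymp N^{\frac1{\beta-1}},\quad w=o\big(N^{\frac{\lambda}{\beta-1}}\big),\quad \Delta:=c_{\rm hub}m,\quad \delta\asymp\Delta^{\lambda},\quad \alpha=o\Big(\min\big\{N^{\lambda\frac{\beta-2}{\beta-1}},N^{\frac{1-\lambda}{2\beta-2}}\big\}\Big).$$ Let $G$ be the Chung–Lu random (simple) graph on $\{1,\dots,N\}$ in which the pairs $i\neq j$ are linked independently with probability $\min\{1,w_iw_j/\sum_kw_k\}$, where $$w_i=\tfrac{\beta-2}{\beta-1}\,w\,N^{\frac1{\beta-1}}\Big[N\Big(\tfrac{w(\beta-2)}{m(\beta-1)}\Big)^{\beta-1}+i-1\Big]^{-\frac1{\beta-1}}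 .$$ Write $\mathcal N_i$ for the set of neighbours of $i$, $k_i=\#\mathcal N_i$, $\Delta_0=\max_ik_i$, $\mathcal H=\{i:k_i>\Delta\}$ (hubs), $M=\#\mathcal H$, $\mathcal L=\{j:k_j<\delta\}$ (low degree nodes), $\nu_i=\#(\mathcal N_i\cap\mathcal L)/k_i$, $\nu=\min_{i\in\mathcal H}\nu_i$ (with $\nu=1$ if $\mathcal H=\emptyset$), and $\alpha_i=\alpha\nu_ik_i/\Delta_0$. Given $G$, let $\mathrm{Prob}$ be the law of $(\boldsymbol\omega,x)$, where $\boldsymbol\omega=(\boldsymbol\omega_i^t)_{t\ge0,\,1\le i\le N}$ is iid uniform on $\{0,1,2,3\}$ and $x$ is independent of $\boldsymbol\omega$ and uniform on $\mathbb T^N$. Let $x^0=x$ and $$x_i^{t+1}=f_{\boldsymbol\omega_i^t}(x_i^t)+\frac{\alpha}{\Delta_0}\sum_{j\in\mathcal N_i}h_{\boldsymbol\omega_i^t}(x_i^t,x_j^t)\mod1 .$$ For $i\in\mathcal H$ define the fluctuation $$\xi_i^t(\boldsymbol\omega,x)=\frac{\alpha_i}{\nu_ik_i}\sum_{j\in\mathcal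 N_i\cap\mathcal L}\sin2\pi x_j^t+\frac{\alpha}{\Delta_0}\sum_{j\in\mathcal N_i\setminus\mathcal L}\Big[\sin2\pi x_j^t-\sin2\pi x_i^t-\frac{\boldsymbol\omega_i^t}{3.6}\Big].$$ **Theorem C.** There are a constant $C>0$ and an $N_0$ (depending on $\beta,c_{\rm hub},\lambda$ and the functions $m,w,\delta,\alpha$), and for each $N$ a set of good graphs, such that for $N\ge N_0$ the graph $G$ is good with probability at least $1-CN^{-1/5}$, and the following holds for every good $G$ with $N\ge N_0$ nodes (in (ii): with $N\ge N_1(\kappa)$ nodes). Every hub $i$ follows the mean-field reduced map at coupling $\alpha_i$ up to the fluctuation: for all $(\boldsymbol\omega,x)$ and all $t\ge0$, $$x_i^{t+1}=f_{\alpha_i,\boldsymbol\omega_i^t}(x_i^t)+\xi_i^t(\boldsymbol\omega,x)\mod 1,\qquad f_{a,\omega}(z)=f_\omega(z)+a\int_{\mathbb T}h_\omega(z,y)\,dy\mod1,$$ and $1-\nu\le C\big(N^{-\lambda\frac{\beta-2}{\beta-1}}w^{\beta-2}+N^{-\frac1{\beta-1}}\log N\big)$. Moreover: (i) For every $\varepsilon\ge\max\big\{\tfrac{17}2\alpha(1-\nu),\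 34\pi\alpha^2\delta/\Delta,\ C\alpha\sqrt{\log(M+1)/\Delta}\big\}$, $$\mathrm{Prob}\Big\{\liminf_{T\to\infty}\frac1T\sum_{t=0}^{T-1}\mathbf 1_{\max_{i\in\mathcal H}|\xi_i^t|\le\varepsilon}\ \ge\ 1-\exp\Big(-\frac{\nu\Delta\varepsilon^2}{19\alpha^2}\Big)\Big\}=1 .$$ (ii) Let $0<\kappa<\min\{\frac12,\,1-\lambda,\,\lambda\frac{\beta-2}{\beta-1}\}$ be such that, as $N\to\infty$, $N^{-\lambda\frac{\beta-2}{\beta-1}}w^{\beta-2}=o(\Delta^{-\kappa})$ and $\alpha w/\Delta=o(\Delta^{-\kappa})$ (both are automatic if $w$ is bounded). Then there is $N_1(\kappa)$ such that for all good $G$ with $N\ge N_1(\kappa)$ nodes, all $t_0\in\mathbb N$ and all $T\in\mathbb N$ with $T\le\lceil\exp(\Delta^{1-2\kappa})\rceil$, $$\mathrm{Prob}\Big\{\max_{i\in\mathcal H}\ \max_{t_0\le t<t_0+T}|\xi_i^t|\le3\alpha\Delta^{-\kappa}\Big\}\ \ge\ 1-\exp(-\Delta^{1-2\kappa}).$$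 (iii) For every hub $i$, every $t\in\mathbb N$ and every $s\in\mathbb R$, $$\mathrm{Prob}\{\xi_i^t\le s\}\in\big[F_i(s-s_1)-s_2,\ F_i(s+s_1)+s_2\big],$$ where $F_i$ is the distribution function of the normal law with mean $0$ and variance $\alpha_i^2/(2\nu_ik_i)$, and $$s_1=C\alpha\Big((1+\alpha)N^{-\frac{1-\lambda}{\beta-1}}+N^{-\lambda\frac{\beta-2}{\beta-1}}w^{\beta-2}\Big),\qquad s_2=CN^{-\frac1{2\beta-2}} .$$ -/

import Mathlib

open MeasureTheory ProbabilityTheory Filter Asymptotics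

noncomputable section

namespace HubDynamics

/-! ### Node dynamics and coupling on the circle `𝕋 = ℝ / ℤ` -/

/-- The contraction `f_ω` of the circle, `ω ∈ {0,1,2,3}`: on the fundamental domain `[0,1)` it is
`y/2 + ω/4` for `y ≤ 1/2` and `(1-y)/2 + ω/4` for `y ≥ 1/2`, taken mod 1. -/
def nodeMap (ω : Fin 4) : UnitAddCircle → UnitAddCircle :=
  AddCircle.liftIco 1 0 fun y : ℝ =>
    (((if y ≤ 1 / 2 then y / 2 + (ω.val : ℝ) / 4 else (1 - y) / 2 + (ω.val : ℝ) / 4 : ℝ)) :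
      UnitAddCircle)

/-- `x ↦ sin 2πx` on the circle. -/
def sinC : UnitAddCircle → ℝ :=
  AddCircle.liftIco 1 0 fun y : ℝ => Real.sin (2 * Real.pi * y)

/-- The coupling function `h_ω(x,y) = sin 2πy - sin 2πx - ω/3.6`. -/
def coupling (ω : Fin 4) (x y : UnitAddCircle) : ℝ :=
  sinC y - sinC x - (ω.val : ℝ) / 3.6

/-- The mean-field reduced map `f_{a,ω}(z) = f_ω(z) + a ∫ h_ω(z,x) dx mod 1`. -/
def reducedMap (a : ℝ) (ω : Fin 4) (z : UnitAddCircle) : UnitAddCircle :=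
  nodeMap ω z + ((a * ∫ x : UnitAddCircle, coupling ω z x : ℝ) : UnitAddCircle)

/-! ### Graph quantities -/

section Graph

variable {N : ℕ}

/-- The neighbours of node `i`. -/
def nbrs (G : SimpleGraph (Fin N)) (i : Fin N) : Finset (Fin N) :=
  open scoped Classical in Finset.univ.filter fun j => G.Adj i j

/-- The degree `k_i`. -/
def deg (G : SimpleGraph (Fin N)) (i : Fin N) : ℕ := (nbrs G i).card

/-- The largest degree `Δ₀`. -/
def topDeg (G : SimpleGraph (Fin N)) : ℕ := Finset.univ.sup fun i => deg G i

/-- The hubs: nodes of degree above `Δ`. -/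
def hubs (G : SimpleGraph (Fin N)) (Δ : ℝ) : Finset (Fin N) :=
  open scoped Classical in Finset.univ.filter fun i => Δ < (deg G i : ℝ)

/-- The low degree neighbours of `i`: those of degree below `δ`. -/
def lowNbrs (G : SimpleGraph (Fin N)) (δ : ℝ) (i : Fin N) : Finset (Fin N) :=
  open scoped Classical in (nbrs G i).filter fun j => (deg G j : ℝ) < δ

/-- The neighbours of `i` that are not of low degree. -/
def highNbrs (G : SimpleGraph (Fin N)) (δ : ℝ) (i : Fin N) : Finset (Fin N) :=
  open scoped Classical in (nbrs G i).filter fun j => δ ≤ (deg G j : ℝ)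

/-- The star-like index `ν_i` at node `i`: the proportion of low degree nodes among its
neighbours. -/
def nodeIndex (G : SimpleGraph (Fin N)) (δ : ℝ) (i : Fin N) : ℝ :=
  ((lowNbrs G δ i).card : ℝ) / (deg G i : ℝ)

/-- The star-like index `ν` of the network: the minimum of `ν_i` over all hubs
(`1` if there is no hub). -/
def starIndex (G : SimpleGraph (Fin N)) (Δ δ : ℝ) : ℝ :=
  open scoped Classical in
  if h : (hubs G Δ).Nonempty then (hubs G Δ).inf' h (nodeIndex G δ) else 1

/-- The effective coupling strength `α_i = α ν_i k_i / Δ₀`. -/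
def effCoupling (G : SimpleGraph (Fin N)) (δ α : ℝ) (i : Fin N) : ℝ :=
  α * nodeIndex G δ i * (deg G i : ℝ) / (topDeg G : ℝ)

end Graph

/-! ### The network random dynamical system -/

section Dynamics

variable {N : ℕ}

/-- Noise realizations `ω = (ω_i^t)`, indexed by time `t` and node `i`. -/
abbrev Noise (N : ℕ) : Type := ℕ × Fin N → Fin 4

/-- The network trajectory `x^t` started from `x` under the noise `ω`:
`x_i^{t+1} = f_{ω_i^t}(x_i^t) + (α/Δ₀) ∑_j A_{ij} h_{ω_i^t}(x_i^t, x_j^t) mod 1`. -/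
def traj (G : SimpleGraph (Fin N)) (α : ℝ) (ω : Noise N) (x : Fin N → UnitAddCircle) :
    ℕ → Fin N → UnitAddCircle
  | 0 => x
  | t + 1 => fun i =>
      nodeMap (ω (t, i)) (traj G α ω x t i) +
        ((α / (topDeg G : ℝ) *
          ∑ j ∈ nbrs G i, coupling (ω (t, i)) (traj G α ω x t i) (traj G α ω x t j) : ℝ) :
            UnitAddCircle)

/-- The mean-field fluctuation `ξ_i^t(ω,x)`. -/
def fluct (G : SimpleGraph (Fin N)) (δ α : ℝ) (ω : Noise N) (x : Fin N → UnitAddCircle)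
    (i : Fin N) (t : ℕ) : ℝ :=
  effCoupling G δ α i / (nodeIndex G δ i * (deg G i : ℝ)) *
      ∑ j ∈ lowNbrs G δ i, sinC (traj G α ω x t j) +
    α / (topDeg G : ℝ) *
      ∑ j ∈ highNbrs G δ i,
        (sinC (traj G α ω x t j) - sinC (traj G α ω x t i) - ((ω (t, i)).val : ℝ) / 3.6)

/-- `Prob`: the noise is iid uniform on `{0,1,2,3}` over all times and nodes, and independently
the initial condition is uniform on `𝕋^N`. -/
def dynProb (N : ℕ) : Measure (Noise N × (Fin N → UnitAddCircle)) :=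
  (Measure.infinitePi fun _ : ℕ × Fin N => (PMF.uniformOfFintype (Fin 4)).toMeasure).prod
    (Measure.pi fun _ : Fin N => (volume : Measure UnitAddCircle))

end Dynamics

/-! ### The Chung–Lu power-law random graph -/

section ChungLu

/-- The expected degree sequence with `N` nodes, exponent `β`, mean expected degree `w` and maximum
expected degree `m`; the node with index `i : Fin N` is node number `i + 1`. -/
def expDeg (β w m : ℝ) (N : ℕ) (i : Fin N) : ℝ :=
  (β - 2) / (β - 1) * w * (N : ℝ) ^ (1 / (β - 1)) *
    ((N : ℝ) * (w * (β - 2) / (m * (β - 1))) ^ (β - 1) + (i.val : ℝ)) ^ (-(1 / (β - 1)))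

/-- The unordered pairs of distinct nodes. -/
abbrev NodePair (N : ℕ) : Type := {e : Fin N × Fin N // e.1 < e.2}

/-- Independent edge indicators; nodes `i ≠ j` are linked with probability
`p_{ij} = w_i w_j / ∑_k w_k` (read as `1` should this number exceed `1`). -/
def chungLu (β w m : ℝ) (N : ℕ) : Measure (NodePair N → Bool) :=
  Measure.pi fun e : NodePair N =>
    bernoulliMeasure true false
      (Set.projIcc (0 : ℝ) 1 zero_le_one
        (expDeg β w m N e.1.1 * expDeg β w m N e.1.2 / ∑ k : Fin N, expDeg β w m N k))

/-- The graph with the given edge indicators. -/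
def graphOf {N : ℕ} (c : NodePair N → Bool) : SimpleGraph (Fin N) where
  Adj i j := (∃ h : i < j, c ⟨(i, j), h⟩ = true) ∨ (∃ h : j < i, c ⟨(j, i), h⟩ = true)
  symm := ⟨fun _ _ h => h.symm⟩
  loopless := ⟨fun i h => by rcases h with ⟨h, -⟩ | ⟨h, -⟩ <;> exact lt_irrefl i h⟩

end ChungLu

end HubDynamics

end

/-!
Modulo one, `f_ω(x) = f_0(x) + ω / 4`. Hence, given the state at time `t`, the coordinates of the
state at time `t + 1` are independent, each being turned by an independent uniform quarter turn, and
the coupling displaces the low degree neighbours of a hub by at most a multiple of `α δ / Δ`. As the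
four quarter turns of `sin` sum to zero, the signal of a hub is, up to a small bias, a sum of many
independent bounded centred variables, and Hoeffding's inequality makes a large fluctuation
improbable at every step, whatever the previous state.

For the time average, the exponential moment of the number of large fluctuations before time `T` is
multiplied at each step by at most a fixed factor, so Markov's inequality and Borel–Cantelli bound
their frequency. On a time window the union bound suffices, with the bias estimated to second order:
the term of first order, the mean of `k cos 2π f_k(z)` over the noise symbols `k`, changes sign when
`z` makes a half turn, and the previous step has turned `z` at random. For the normal approximation,
the quarter turns of `s = sin` are `s, c, -s, -c` with `s² + c² = 1`, so the characteristic function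
of each summand is `(cos (ts) + cos (tc)) / 2`. It agrees with the Gaussian one to fourth order,
whatever `s` is, and smoothing with a Gaussian kernel turns this into a comparison of distribution
functions.

For the Chung–Lu graph, Chernoff's bound shows that few neighbours of a hub fail to be of low
degree: either their expected degree is large, and the power law limits their total weight, or their
degree is far above its expectation.
-/

noncomputable section

namespace HubDynamics

open Real

/-! ### Trigonometry on the circle -/

/-- `x ↦ cos 2πx` on the circle. -/
def cosC : UnitAddCircle → ℝ :=
  Function.Periodic.lift (f := fun y : ℝ => cos (2 * π * y)) (c := 1) fun y => by
    simp only [mul_add, mul_one, cos_add_two_pi]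

lemma cosC_coe (y : ℝ) : cosC (y : UnitAddCircle) = cos (2 * π * y) := rfl

lemma sinC_coe (y : ℝ) : sinC (y : UnitAddCircle) = sin (2 * π * y) := by
  rw [← AddCircle.coe_fract, sinC, AddCircle.liftIco_zero_coe_apply
    ⟨Int.fract_nonneg y, Int.fract_lt_one y⟩]
  calc sin (2 * π * Int.fract y) = sin (2 * π * y - ⌊y⌋ * (2 * π)) := by
        rw [Int.fract]; ring_nf
    _ = sin (2 * π * y) := sin_sub_int_mul_two_pi _ _

lemma abs_sinC_le_one (z : UnitAddCircle) : |sinC z| ≤ 1 := by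
  obtain ⟨y, rfl⟩ := QuotientAddGroup.mk_surjective z
  exact sinC_coe y ▸ abs_sin_le_one _

lemma abs_cosC_le_one (z : UnitAddCircle) : |cosC z| ≤ 1 := by
  obtain ⟨y, rfl⟩ := QuotientAddGroup.mk_surjective z
  exact cosC_coe y ▸ abs_cos_le_one _

lemma sinC_sq_add_cosC_sq (z : UnitAddCircle) : sinC z ^ 2 + cosC z ^ 2 = 1 := by
  obtain ⟨y, rfl⟩ := QuotientAddGroup.mk_surjective z
  rw [sinC_coe, cosC_coe, sin_sq_add_cos_sq]

lemma sinC_add_coe (z : UnitAddCircle) (e : ℝ) :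
    sinC (z + e) = sinC z * cos (2 * π * e) + cosC z * sin (2 * π * e) := by
  obtain ⟨y, rfl⟩ := QuotientAddGroup.mk_surjective z
  rw [← AddCircle.coe_add, sinC_coe, sinC_coe, cosC_coe, mul_add, sin_add]

lemma cosC_add_coe (z : UnitAddCircle) (e : ℝ) :
    cosC (z + e) = cosC z * cos (2 * π * e) - sinC z * sin (2 * π * e) := by
  obtain ⟨y, rfl⟩ := QuotientAddGroup.mk_surjective z
  rw [← AddCircle.coe_add, sinC_coe, cosC_coe, cosC_coe, mul_add, cos_add]

lemma continuous_sinC : Continuous sinC :=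
  AddCircle.liftIco_zero_continuous (by simp) (by fun_prop)

lemma continuous_cosC : Continuous cosC :=
  continuous_coinduced_dom.mpr (by fun_prop : Continuous fun y : ℝ => cos (2 * π * y))

lemma abs_sinC_add_coe_sub_le (z : UnitAddCircle) (e : ℝ) :
    |sinC (z + e) - sinC z| ≤ 2 * π * |e| := by
  obtain ⟨y, rfl⟩ := QuotientAddGroup.mk_surjective z
  rw [← AddCircle.coe_add, sinC_coe, sinC_coe]
  calc |sin (2 * π * (y + e)) - sin (2 * π * y)| ≤ |2 * π * (y + e) - 2 * π * y| :=
        abs_sin_sub_sin_le _ _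
    _ = 2 * π * |e| := by rw [← mul_sub, add_sub_cancel_left, abs_mul, abs_of_pos two_pi_pos]

lemma abs_sin_sub_self_le (s : ℝ) : |sin s - s| ≤ s ^ 2 / 2 := by
  rw [abs_sub_comm, ← sq_abs]
  have hs := abs_nonneg s
  rcases le_total |s| 3 with h | h
  · nlinarith [abs_sub_sin_le s, mul_le_mul_of_nonneg_left h (sq_nonneg |s|)]
  · nlinarith [abs_sub s (sin s), abs_sin_le_one s]

lemma abs_cos_sub_one_le (s : ℝ) : |cos s - 1| ≤ s ^ 2 / 2 :=
  abs_le.2 ⟨by linarith [one_sub_sq_div_two_le_cos (x := s)],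
    by linarith [cos_le_one s, sq_nonneg s]⟩

lemma abs_sinC_add_coe_sub_sub_le (z : UnitAddCircle) (e : ℝ) :
    |sinC (z + e) - sinC z - 2 * π * e * cosC z| ≤ 4 * π ^ 2 * e ^ 2 := by
  set s := 2 * π * e with hs
  calc |sinC (z + e) - sinC z - s * cosC z| =
      |sinC z * (cos s - 1) + cosC z * (sin s - s)| := by rw [sinC_add_coe, ← hs]; ring_nf
    _ ≤ |sinC z * (cos s - 1)| + |cosC z * (sin s - s)| := abs_add_le _ _
    _ ≤ 1 * (s ^ 2 / 2) + 1 * (s ^ 2 / 2) := by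
        rw [abs_mul, abs_mul]
        exact add_le_add
          (mul_le_mul (abs_sinC_le_one z) (abs_cos_sub_one_le s) (abs_nonneg _) zero_le_one)
          (mul_le_mul (abs_cosC_le_one z) (abs_sin_sub_self_le s) (abs_nonneg _) zero_le_one)
    _ = 4 * π ^ 2 * e ^ 2 := by rw [hs]; ring

/-- The rotation number `k / 4`: the noise symbol `k` turns the image of a node map by it. -/
def quarter (k : Fin 4) : UnitAddCircle := ((k.val / 4 : ℝ) : UnitAddCircle)

lemma sinC_add_quarter (z : UnitAddCircle) (k : Fin 4) :
    sinC (z + quarter k) = ![sinC z, cosC z, -sinC z, -cosC z] k := by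
  have h1 : 2 * π * 4⁻¹ = π / 2 := by ring
  have h2 : 2 * π * (2 / 4) = π := by ring
  have h3 : 2 * π * (3 / 4) = π / 2 + π := by ring
  rw [quarter, sinC_add_coe]
  fin_cases k <;> simp [h1, h2, h3]

lemma cosC_add_quarter (z : UnitAddCircle) (k : Fin 4) :
    cosC (z + quarter k) = ![cosC z, -sinC z, -cosC z, sinC z] k := by
  have h1 : 2 * π * 4⁻¹ = π / 2 := by ring
  have h2 : 2 * π * (2 / 4) = π := by ring
  have h3 : 2 * π * (3 / 4) = π / 2 + π := by ring
  rw [quarter, cosC_add_coe]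
  fin_cases k <;> simp [h1, h2, h3]

lemma sum_sinC_add_quarter (z : UnitAddCircle) : ∑ k, sinC (z + quarter k) = 0 := by
  simp [sinC_add_quarter, Fin.sum_univ_four]

/-! ### The node maps -/

lemma nodeMap_zero (z : UnitAddCircle) : nodeMap 0 z = ((‖z‖ / 2 : ℝ) : UnitAddCircle) := by
  obtain ⟨y, rfl⟩ := QuotientAddGroup.mk_surjective z
  rw [UnitAddCircle.norm_eq, abs_sub_round_eq_min, ← AddCircle.coe_fract, nodeMap,
    AddCircle.liftIco_zero_coe_apply ⟨Int.fract_nonneg y, Int.fract_lt_one y⟩]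
  simp only [Fin.val_zero, Nat.cast_zero, zero_div, add_zero]
  split_ifs with h
  · rw [min_eq_left (by linarith)]
  · rw [min_eq_right (by linarith)]

lemma nodeMap_eq (k : Fin 4) (z : UnitAddCircle) : nodeMap k z = nodeMap 0 z + quarter k := by
  obtain ⟨y, rfl⟩ := QuotientAddGroup.mk_surjective z
  have hy : Int.fract y ∈ Set.Ico (0 : ℝ) 1 := ⟨Int.fract_nonneg y, Int.fract_lt_one y⟩
  rw [← AddCircle.coe_fract, nodeMap, nodeMap, AddCircle.liftIco_zero_coe_apply hy,
    AddCircle.liftIco_zero_coe_apply hy, quarter, ← AddCircle.coe_add]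
  split_ifs <;> simp

lemma continuous_nodeMap (k : Fin 4) : Continuous (nodeMap k) := by
  have h : nodeMap k = fun z => ((‖z‖ / 2 : ℝ) : UnitAddCircle) + quarter k :=
    funext fun z => by rw [nodeMap_eq, nodeMap_zero]
  rw [h]
  exact ((AddCircle.continuous_mk' (1 : ℝ)).comp (by fun_prop)).add continuous_const

lemma norm_add_half (z : UnitAddCircle) :
    ‖z + ((1 / 2 : ℝ) : UnitAddCircle)‖ = 1 / 2 - ‖z‖ := by
  obtain ⟨y, rfl⟩ := QuotientAddGroup.mk_surjective z
  rw [← AddCircle.coe_add, UnitAddCircle.norm_eq, UnitAddCircle.norm_eq, abs_sub_round_eq_min,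
    abs_sub_round_eq_min]
  have h0 := Int.fract_nonneg y
  have h1 := Int.fract_lt_one y
  by_cases h : Int.fract y < 1 / 2
  · have hfract : Int.fract (y + 1 / 2) = Int.fract y + 1 / 2 :=
      Int.fract_eq_iff.2 ⟨by linarith, by linarith, ⌊y⌋, by rw [Int.fract]; ring⟩
    rw [hfract, min_eq_right (by linarith), min_eq_left (by linarith)]
    ring
  · have hfract : Int.fract (y + 1 / 2) = Int.fract y - 1 / 2 :=
      Int.fract_eq_iff.2 ⟨by linarith, by linarith, ⌊y⌋ + 1, by rw [Int.fract]; push_cast; ring⟩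
    rw [hfract, min_eq_left (by linarith), min_eq_right (by linarith)]
    ring

/-- The mean drift `sin 2πg - cos 2πg`, where `g = f_0(z)`: twice the mean over the noise symbols
`k` of `k cos 2π f_k(z)`, which is how the term `ω / 3.6` of the coupling enters on average. -/
def drift (z : UnitAddCircle) : ℝ := sinC (nodeMap 0 z) - cosC (nodeMap 0 z)

lemma drift_eq (z : UnitAddCircle) : drift z = sin (π * ‖z‖) - cos (π * ‖z‖) := by
  rw [drift, nodeMap_zero, sinC_coe, cosC_coe, show 2 * π * (‖z‖ / 2) = π * ‖z‖ by ring]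

lemma continuous_drift : Continuous drift :=
  (continuous_sinC.comp (continuous_nodeMap 0)).sub (continuous_cosC.comp (continuous_nodeMap 0))

lemma abs_drift_le (z : UnitAddCircle) : |drift z| ≤ 2 :=
  calc |drift z| ≤ |sinC (nodeMap 0 z)| + |cosC (nodeMap 0 z)| := abs_sub _ _
    _ ≤ 2 := by linarith [abs_sinC_le_one (nodeMap 0 z), abs_cosC_le_one (nodeMap 0 z)]

lemma drift_add_half (z : UnitAddCircle) :
    drift (z + ((1 / 2 : ℝ) : UnitAddCircle)) = -drift z := by
  rw [drift_eq, drift_eq, norm_add_half, mul_sub, mul_one_div, sin_pi_div_two_sub,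
    cos_pi_div_two_sub, neg_sub]

lemma sum_drift_add_quarter (z : UnitAddCircle) : ∑ k, drift (z + quarter k) = 0 := by
  have h2 : z + quarter 2 = (z + quarter 0) + ((1 / 2 : ℝ) : UnitAddCircle) := by
    rw [add_assoc, quarter, quarter, ← AddCircle.coe_add]
    norm_num
  have h3 : z + quarter 3 = (z + quarter 1) + ((1 / 2 : ℝ) : UnitAddCircle) := by
    rw [add_assoc, quarter, quarter, ← AddCircle.coe_add]
    norm_num
  rw [Fin.sum_univ_four, h2, h3, drift_add_half, drift_add_half]
  ring

lemma abs_drift_add_coe_sub_le (z : UnitAddCircle) (e : ℝ) :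
    |drift (z + e) - drift z| ≤ 2 * π * |e| := by
  have hnorm : |‖z + e‖ - ‖z‖| ≤ |e| := by
    refine (abs_norm_sub_norm_le _ _).trans ?_
    rw [add_sub_cancel_left]
    exact (QuotientAddGroup.norm_mk_le_norm).trans_eq (Real.norm_eq_abs e)
  have harg : |π * ‖z + e‖ - π * ‖z‖| ≤ π * |e| := by
    rw [← mul_sub, abs_mul, abs_of_pos pi_pos]
    gcongr
  rw [drift_eq, drift_eq, sub_sub_sub_comm]
  calc _ ≤ |sin (π * ‖z + e‖) - sin (π * ‖z‖)| + |cos (π * ‖z + e‖) - cos (π * ‖z‖)| :=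
        abs_sub _ _
    _ ≤ π * |e| + π * |e| := add_le_add ((abs_sin_sub_sin_le _ _).trans harg)
        ((abs_cos_sub_cos_le _ _).trans harg)
    _ = 2 * π * |e| := by ring

/-! ### The reduced map -/

instance : IsProbabilityMeasure (volume : Measure UnitAddCircle) := ⟨UnitAddCircle.measure_univ⟩

lemma integral_sinC : ∫ x : UnitAddCircle, sinC x = 0 := by
  have h : ∫ x : UnitAddCircle, -sinC x = ∫ x : UnitAddCircle, sinC x := by
    rw [← integral_add_right_eq_self sinC (quarter 2)]
    simp [sinC_add_quarter]
  rw [integral_neg] at h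
  linarith

lemma integral_coupling (k : Fin 4) (z : UnitAddCircle) :
    ∫ x : UnitAddCircle, coupling k z x = -sinC z - (k.val : ℝ) / 3.6 := by
  have hsinC : Integrable sinC (volume : Measure UnitAddCircle) :=
    continuous_sinC.integrable_of_hasCompactSupport (HasCompactSupport.of_compactSpace _)
  simp only [coupling, sub_sub]
  rw [integral_sub hsinC (integrable_const _), integral_sinC, integral_const]
  simp
  ring

lemma abs_coupling_le (k : Fin 4) (x y : UnitAddCircle) : |coupling k x y| ≤ 17 / 6 := by
  have hk : (k.val : ℝ) ≤ 3 := by exact_mod_cast Nat.lt_succ_iff.1 k.isLt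
  rw [coupling, abs_le, show (k.val : ℝ) / 3.6 = 5 / 18 * k.val by ring]
  constructor <;> linarith [abs_le.1 (abs_sinC_le_one x), abs_le.1 (abs_sinC_le_one y),
    Nat.cast_nonneg (α := ℝ) k.val]

/-! ### The fluctuation at a hub -/

section Graph

variable {N : ℕ} (G : SimpleGraph (Fin N))

lemma sum_nbrs_eq_sum_lowNbrs_add_sum_highNbrs (δ : ℝ) (i : Fin N) (F : Fin N → ℝ) :
    ∑ j ∈ nbrs G i, F j = ∑ j ∈ lowNbrs G δ i, F j + ∑ j ∈ highNbrs G δ i, F j := by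
  classical
  rw [lowNbrs, highNbrs, ← Finset.sum_filter_add_sum_filter_not (nbrs G i)
    (fun j => (deg G j : ℝ) < δ)]
  simp only [not_lt]

lemma card_lowNbrs_add_card_highNbrs (δ : ℝ) (i : Fin N) :
    ((lowNbrs G δ i).card : ℝ) + (highNbrs G δ i).card = deg G i := by
  simpa [deg, eq_comm] using sum_nbrs_eq_sum_lowNbrs_add_sum_highNbrs G δ i fun _ => 1

lemma card_lowNbrs_le_deg (δ : ℝ) (i : Fin N) : (lowNbrs G δ i).card ≤ deg G i :=
  Finset.card_le_card (Finset.filter_subset _ _)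

lemma deg_le_topDeg (i : Fin N) : deg G i ≤ topDeg G :=
  Finset.le_sup (f := deg G) (Finset.mem_univ i)

lemma card_lowNbrs_le_topDeg (δ : ℝ) (i : Fin N) : ((lowNbrs G δ i).card : ℝ) ≤ topDeg G := by
  exact_mod_cast (card_lowNbrs_le_deg G δ i).trans (deg_le_topDeg G i)

variable {G} in
lemma mem_hubs {Δ : ℝ} {i : Fin N} : i ∈ hubs G Δ ↔ Δ < deg G i := by simp [hubs]

variable {G} in
lemma lt_topDeg_of_mem_hubs {Δ : ℝ} {i : Fin N} (hi : i ∈ hubs G Δ) : Δ < topDeg G :=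
  (mem_hubs.1 hi).trans_le (by exact_mod_cast deg_le_topDeg G i)

variable {G} in
lemma deg_lt_of_mem_lowNbrs {δ : ℝ} {i j : Fin N} (hj : j ∈ lowNbrs G δ i) : (deg G j : ℝ) < δ := by
  classical exact (Finset.mem_filter.1 hj).2

lemma nodeIndex_mul_deg (δ : ℝ) (i : Fin N) :
    nodeIndex G δ i * deg G i = (lowNbrs G δ i).card := by
  refine div_mul_cancel_of_imp fun h => ?_
  exact_mod_cast Nat.le_zero.1 ((card_lowNbrs_le_deg G δ i).trans_eq (by exact_mod_cast h))

lemma nodeIndex_nonneg (δ : ℝ) (i : Fin N) : 0 ≤ nodeIndex G δ i := by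
  rw [nodeIndex]
  positivity

lemma nodeIndex_le_one (δ : ℝ) (i : Fin N) : nodeIndex G δ i ≤ 1 :=
  div_le_one_of_le₀ (by exact_mod_cast card_lowNbrs_le_deg G δ i) (by positivity)

lemma starIndex_nonneg (Δ δ : ℝ) : 0 ≤ starIndex G Δ δ := by
  rw [starIndex]
  split_ifs with h
  · exact Finset.le_inf' _ _ fun i _ => nodeIndex_nonneg G δ i
  · exact zero_le_one

lemma starIndex_le_one (Δ δ : ℝ) : starIndex G Δ δ ≤ 1 := by
  rw [starIndex]
  split_ifs with h
  · obtain ⟨i, hi⟩ := h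
    exact (Finset.inf'_le _ hi).trans (nodeIndex_le_one G δ i)
  · exact le_rfl

variable {G}

lemma starIndex_le_nodeIndex {Δ : ℝ} (δ : ℝ) {i : Fin N} (hi : i ∈ hubs G Δ) :
    starIndex G Δ δ ≤ nodeIndex G δ i := by
  rw [starIndex, dif_pos ⟨i, hi⟩]
  exact Finset.inf'_le _ hi

lemma starIndex_mul_le_card_lowNbrs {Δ : ℝ} (hΔ : 0 ≤ Δ) (δ : ℝ) {i : Fin N} (hi : i ∈ hubs G Δ) :
    starIndex G Δ δ * Δ ≤ (lowNbrs G δ i).card := by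
  rw [← nodeIndex_mul_deg]
  exact mul_le_mul (starIndex_le_nodeIndex δ hi) (mem_hubs.1 hi).le hΔ (nodeIndex_nonneg G δ i)

lemma card_highNbrs_le {Δ : ℝ} (δ : ℝ) {i : Fin N} (hi : i ∈ hubs G Δ) :
    ((highNbrs G δ i).card : ℝ) ≤ (1 - starIndex G Δ δ) * topDeg G := by
  have hdeg : (deg G i : ℝ) ≤ topDeg G := by exact_mod_cast deg_le_topDeg G i
  calc ((highNbrs G δ i).card : ℝ) = (1 - nodeIndex G δ i) * deg G i := by
        linarith [card_lowNbrs_add_card_highNbrs G δ i, nodeIndex_mul_deg G δ i]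
    _ ≤ (1 - starIndex G Δ δ) * topDeg G :=
        mul_le_mul (by linarith [starIndex_le_nodeIndex δ hi]) hdeg (by positivity)
          (by linarith [starIndex_le_one G Δ δ])

variable (G)

lemma effCoupling_eq (δ α : ℝ) (i : Fin N) :
    effCoupling G δ α i = α / topDeg G * (lowNbrs G δ i).card := by
  rw [effCoupling, mul_assoc, nodeIndex_mul_deg, mul_div_right_comm]

/-- The summed signal `∑ sin 2πy_j` of the low degree neighbours `j` of node `i` in the state `y`:
up to the factor `α / Δ₀`, the main part of the fluctuation. -/
def lowSum (δ : ℝ) (i : Fin N) (y : Fin N → UnitAddCircle) : ℝ :=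
  ∑ j ∈ lowNbrs G δ i, sinC (y j)

lemma continuous_lowSum (δ : ℝ) (i : Fin N) : Continuous (lowSum G δ i) :=
  continuous_finsetSum _ fun j _ => continuous_sinC.comp (continuous_apply j)

lemma fluct_eq (δ α : ℝ) (ω : Noise N) (x : Fin N → UnitAddCircle) (i : Fin N) (t : ℕ) :
    fluct G δ α ω x i t = α / topDeg G * (lowSum G δ i (traj G α ω x t) +
        ∑ j ∈ highNbrs G δ i, coupling (ω (t, i)) (traj G α ω x t i) (traj G α ω x t j)) := by
  rw [fluct, effCoupling_eq, nodeIndex_mul_deg, mul_add, lowSum]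
  congr 1
  by_cases h : lowNbrs G δ i = ∅
  · simp [h]
  · rw [mul_div_cancel_right₀ _ (by simpa using h)]

theorem traj_succ_eq_reducedMap (δ α : ℝ) (ω : Noise N) (x : Fin N → UnitAddCircle) (i : Fin N)
    (t : ℕ) :
    traj G α ω x (t + 1) i =
      reducedMap (effCoupling G δ α i) (ω (t, i)) (traj G α ω x t i) +
        ((fluct G δ α ω x i t : ℝ) : UnitAddCircle) := by
  have hlow : ∑ j ∈ lowNbrs G δ i, coupling (ω (t, i)) (traj G α ω x t i) (traj G α ω x t j) =
      lowSum G δ i (traj G α ω x t) + (lowNbrs G δ i).card *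
        (-sinC (traj G α ω x t i) - ((ω (t, i)).val : ℝ) / 3.6) := by
    simp only [coupling, lowSum, Finset.sum_sub_distrib, Finset.sum_const, nsmul_eq_mul]
    ring
  change nodeMap (ω (t, i)) (traj G α ω x t i) + _ = _
  rw [reducedMap, integral_coupling, add_assoc, ← AddCircle.coe_add, fluct_eq, effCoupling_eq,
    sum_nbrs_eq_sum_lowNbrs_add_sum_highNbrs G δ, hlow]
  ring_nf

variable {G}

lemma abs_fluct_sub_lowSum_le {Δ α : ℝ} (hα : 0 ≤ α) (hΔ : 0 ≤ Δ) (δ : ℝ) (ω : Noise N)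
    (x : Fin N → UnitAddCircle) {i : Fin N} (hi : i ∈ hubs G Δ) (t : ℕ) :
    |fluct G δ α ω x i t - α / topDeg G * lowSum G δ i (traj G α ω x t)| ≤
      17 / 6 * α * (1 - starIndex G Δ δ) := by
  have htop : (0 : ℝ) < topDeg G := hΔ.trans_lt (lt_topDeg_of_mem_hubs hi)
  have hhigh : |∑ j ∈ highNbrs G δ i,
      coupling (ω (t, i)) (traj G α ω x t i) (traj G α ω x t j)| ≤
      (highNbrs G δ i).card * (17 / 6 : ℝ) := by
    refine (Finset.abs_sum_le_sum_abs _ _).trans ?_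
    rw [← nsmul_eq_mul]
    exact Finset.sum_le_card_nsmul _ _ _ fun j _ => abs_coupling_le _ _ _
  rw [fluct_eq, mul_add, add_sub_cancel_left, abs_mul, abs_of_nonneg (by positivity)]
  calc _ ≤ α / topDeg G * ((1 - starIndex G Δ δ) * topDeg G * (17 / 6 : ℝ)) := by
        gcongr
        exact hhigh.trans (by gcongr; exact card_highNbrs_le δ hi)
    _ = 17 / 6 * α * (1 - starIndex G Δ δ) := by field_simp

end Graph

/-! ### Resampling one row of the noise -/

section Resampling

section Array

variable {ι κ X : Type*} [DecidableEq ι]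

/-- The array `ω` with row `t` replaced by `η`. -/
def resample (t : ι) (ω : ι × κ → X) (η : κ → X) : ι × κ → X :=
  fun p => if p.1 = t then η p.2 else ω p

lemma resample_self (t : ι) (ω : ι × κ → X) (η : κ → X) (i : κ) :
    resample t ω η (t, i) = η i :=
  if_pos rfl

lemma resample_of_ne {s t : ι} (h : s ≠ t) (ω : ι × κ → X) (η : κ → X) (i : κ) :
    resample t ω η (s, i) = ω (s, i) :=
  if_neg h

lemma resample_preimage_pi (t : ι) (s : Finset (ι × κ)) (A : ι × κ → Set X) :
    (fun q : (ι × κ → X) × (κ → X) => resample t q.1 q.2) ⁻¹' Set.pi s A =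
      Set.pi (s.filter fun p => p.1 ≠ t) A ×ˢ
        Set.pi (s.preimage (Prod.mk t) (Prod.mk_right_injective t).injOn) fun i => A (t, i) := by
  ext ⟨ω, η⟩
  simp only [Set.mem_preimage, Set.mem_pi, Finset.mem_coe, Set.mem_prod, Finset.mem_filter,
    Finset.mem_preimage]
  constructor
  · intro h
    refine ⟨fun p hp => ?_, fun i hi => ?_⟩
    · simpa only [resample_of_ne hp.2] using h p hp.1
    · simpa only [resample_self] using h _ hi
  · rintro ⟨hω, hη⟩ ⟨r, i⟩ hp
    by_cases hr : r = t
    · subst hr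
      simpa only [resample_self] using hη i hp
    · simpa only [resample_of_ne hr] using hω _ ⟨hp, hr⟩

variable [MeasurableSpace X]

lemma measurable_resample (t : ι) :
    Measurable fun q : (ι × κ → X) × (κ → X) => resample t q.1 q.2 := by
  refine measurable_pi_lambda _ fun p => ?_
  unfold resample
  split_ifs <;> fun_prop

lemma measurePreserving_resample [Fintype κ] (μ : Measure X) [IsProbabilityMeasure μ] (t : ι) :
    MeasurePreserving (fun q : (ι × κ → X) × (κ → X) => resample t q.1 q.2)
      ((Measure.infinitePi fun _ => μ).prod (Measure.pi fun _ => μ))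
      (Measure.infinitePi fun _ => μ) := by
  classical
  refine ⟨measurable_resample t, Measure.eq_infinitePi _ fun s A hA => ?_⟩
  have hrow : (s.filter fun p => p.1 = t) = s.filter fun p => p ∈ Set.range (Prod.mk t) :=
    Finset.filter_congr fun p _ => ⟨fun h => ⟨p.2, h ▸ rfl⟩, fun ⟨_, h⟩ => h ▸ rfl⟩
  rw [Measure.map_apply (measurable_resample t) (.pi s.countable_toSet fun p _ => hA p),
    resample_preimage_pi, Measure.prod_prod, ← Measure.infinitePi_eq_pi,
    Measure.infinitePi_pi _ fun p _ => hA p, Measure.infinitePi_pi _ fun i _ => hA (t, i),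
    Finset.prod_preimage' (g := fun p => μ (A p)), mul_comm,
    ← Finset.prod_filter_mul_prod_filter_not s (fun p => p.1 = t), hrow]

end Array

variable {N : ℕ}

/-- The law of the noise at all nodes at one time. -/
def rowLaw (N : ℕ) : Measure (Fin N → Fin 4) :=
  Measure.pi fun _ : Fin N => (PMF.uniformOfFintype (Fin 4)).toMeasure

instance : IsProbabilityMeasure (rowLaw N) := by unfold rowLaw; infer_instance

instance : IsProbabilityMeasure (dynProb N) := by unfold dynProb; infer_instance

lemma lintegral_dynProb_resample (t : ℕ) {F : Noise N × (Fin N → UnitAddCircle) → ENNReal}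
    (hF : Measurable F) :
    ∫⁻ p, F p ∂(dynProb N) =
      ∫⁻ p, ∫⁻ η, F (resample t p.1 η, p.2) ∂(rowLaw N) ∂(dynProb N) := by
  have hF' : Measurable fun q : (Noise N × (Fin N → UnitAddCircle)) × (Fin N → Fin 4) =>
      F (resample t q.1.1 q.2, q.1.2) :=
    hF.comp (((measurable_resample t).comp (by fun_prop :
      Measurable fun q : (Noise N × (Fin N → UnitAddCircle)) × (Fin N → Fin 4) =>
        (q.1.1, q.2))).prodMk (by fun_prop))
  unfold dynProb
  rw [lintegral_prod_symm _ hF.aemeasurable,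
    lintegral_prod_symm _ hF'.lintegral_prod_right'.aemeasurable]
  refine lintegral_congr fun x => ?_
  have hx : Measurable fun ω : Noise N => F (ω, x) := hF.comp (by fun_prop)
  rw [← (measurePreserving_resample _ t).lintegral_comp hx]
  exact lintegral_prod _ (hx.comp (measurable_resample t)).aemeasurable

lemma lintegral_dynProb_shift {F : Noise N × (Fin N → UnitAddCircle) → ENNReal}
    (hF : Measurable F) :
    ∫⁻ p, F p ∂(dynProb N) =
      ∫⁻ p, ∫⁻ η, F (p.1, fun j => p.2 j + quarter (η j)) ∂(rowLaw N) ∂(dynProb N) := by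
  have hF' : Measurable fun q : (Noise N × (Fin N → UnitAddCircle)) × (Fin N → Fin 4) =>
      F (q.1.1, fun j => q.1.2 j + quarter (q.2 j)) :=
    hF.comp <| measurable_fst.fst.prodMk <| measurable_pi_lambda _ fun j =>
      ((measurable_pi_apply j).comp measurable_fst.snd).add
        ((Measurable.of_discrete (f := quarter)).comp ((measurable_pi_apply j).comp measurable_snd))
  have hshift (η : Fin N → Fin 4) :
      ∫⁻ p, F (p.1, fun j => p.2 j + quarter (η j)) ∂(dynProb N) = ∫⁻ p, F p ∂(dynProb N) := by
    have hη : Measurable fun p : Noise N × (Fin N → UnitAddCircle) =>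
        F (p.1, fun j => p.2 j + quarter (η j)) :=
      hF'.comp (measurable_id.prodMk measurable_const)
    unfold dynProb
    rw [lintegral_prod _ hF.aemeasurable, lintegral_prod _ hη.aemeasurable]
    exact lintegral_congr fun ω => lintegral_add_right_eq_self
      (fun x : Fin N → UnitAddCircle => F (ω, x)) fun j => quarter (η j)
  rw [lintegral_lintegral_swap hF'.aemeasurable]
  simp only [hshift, lintegral_const, measure_univ, mul_one]

lemma measureReal_le_of_lintegral {Ω Ω' : Type*} [MeasurableSpace Ω] [MeasurableSpace Ω']
    {P : Measure Ω} [IsProbabilityMeasure P] {Q : Measure Ω'} [IsFiniteMeasure Q] {E : Set Ω}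
    {g : Ω → Set Ω'} {B : ℝ} (hE : P E = ∫⁻ p, Q (g p) ∂P) (hB : ∀ p, Q.real (g p) ≤ B) :
    P.real E ≤ B := by
  obtain ⟨p₀⟩ := P.nonempty_of_neZero
  refine ENNReal.toReal_le_of_le_ofReal (measureReal_nonneg.trans (hB p₀)) ?_
  calc P E ≤ ∫⁻ _, ENNReal.ofReal B ∂P := hE ▸ lintegral_mono fun p =>
        (ENNReal.le_ofReal_iff_toReal_le (measure_ne_top _ _)
          (measureReal_nonneg.trans (hB p₀))).2 (hB p)
    _ = ENNReal.ofReal B := by rw [lintegral_const, measure_univ, mul_one]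

lemma dynProb_le_of_resample (t : ℕ) {E : Set (Noise N × (Fin N → UnitAddCircle))}
    (hE : MeasurableSet E) {B : ℝ}
    (hB : ∀ p : Noise N × (Fin N → UnitAddCircle),
      (rowLaw N).real {η | (resample t p.1 η, p.2) ∈ E} ≤ B) :
    (dynProb N).real E ≤ B := by
  refine measureReal_le_of_lintegral ?_ hB
  rw [← lintegral_indicator_one hE, lintegral_dynProb_resample t (by fun_prop (disch := exact hE))]
  refine lintegral_congr fun p => ?_
  rw [← lintegral_indicator_one .of_discrete]
  rfl

lemma dynProb_le_of_shift {E : Set (Noise N × (Fin N → UnitAddCircle))}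
    (hE : MeasurableSet E) {B : ℝ}
    (hB : ∀ p : Noise N × (Fin N → UnitAddCircle),
      (rowLaw N).real {η | (p.1, fun j => p.2 j + quarter (η j)) ∈ E} ≤ B) :
    (dynProb N).real E ≤ B := by
  refine measureReal_le_of_lintegral ?_ hB
  rw [← lintegral_indicator_one hE, lintegral_dynProb_shift (by fun_prop (disch := exact hE))]
  refine lintegral_congr fun p => ?_
  rw [← lintegral_indicator_one .of_discrete]
  rfl

end Resampling

/-! ### One step of the dynamics -/

section Step

variable {N : ℕ} (G : SimpleGraph (Fin N)) (α : ℝ)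

/-- The displacement of node `i` by the coupling when its noise symbol is `k`. -/
def push (y : Fin N → UnitAddCircle) (i : Fin N) (k : Fin 4) : ℝ :=
  α / (topDeg G : ℝ) * ∑ j ∈ nbrs G i, coupling k (y i) (y j)

/-- The network map with noise `η`, written so that the noise enters as a rotation of each
coordinate by a quarter turn and a small displacement. -/
def step (η : Fin N → Fin 4) (y : Fin N → UnitAddCircle) : Fin N → UnitAddCircle :=
  fun i => nodeMap 0 (y i) + quarter (η i) + (push G α y i (η i) : UnitAddCircle)

lemma traj_succ (ω : Noise N) (x : Fin N → UnitAddCircle) (t : ℕ) :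
    traj G α ω x (t + 1) = step G α (fun i => ω (t, i)) (traj G α ω x t) := by
  funext i
  rw [step, ← nodeMap_eq]
  rfl

lemma traj_resample (ω : Noise N) (x : Fin N → UnitAddCircle) (η : Fin N → Fin 4) {s t : ℕ}
    (h : t ≤ s) : traj G α (resample s ω η) x t = traj G α ω x t := by
  induction t with
  | zero => rfl
  | succ t ih => simp only [traj_succ, ih (by omega), resample_of_ne (show t ≠ s by omega)]

lemma traj_resample_succ (ω : Noise N) (x : Fin N → UnitAddCircle) (η : Fin N → Fin 4) (t : ℕ) :
    traj G α (resample t ω η) x (t + 1) = step G α η (traj G α ω x t) := by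
  simp only [traj_succ, traj_resample G α ω x η le_rfl, resample_self]

lemma push_eq (y : Fin N → UnitAddCircle) (i : Fin N) (k : Fin 4) :
    push G α y i k = push G α y i 0 - α / topDeg G * deg G i / 3.6 * k.val := by
  simp only [push, coupling, Finset.sum_sub_distrib, Finset.sum_const, nsmul_eq_mul, deg,
    Fin.val_zero, Nat.cast_zero, zero_div, sub_zero]
  ring

variable {α} in
lemma abs_push_le (hα : 0 ≤ α) (y : Fin N → UnitAddCircle) (i : Fin N) (k : Fin 4) :
    |push G α y i k| ≤ 17 / 6 * (α / topDeg G * deg G i) := by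
  have hsum : |∑ j ∈ nbrs G i, coupling k (y i) (y j)| ≤ deg G i * (17 / 6 : ℝ) := by
    refine (Finset.abs_sum_le_sum_abs _ _).trans ?_
    rw [← nsmul_eq_mul]
    exact Finset.sum_le_card_nsmul _ _ _ fun j _ => abs_coupling_le _ _ _
  rw [push, abs_mul, abs_of_nonneg (by positivity)]
  calc _ ≤ α / topDeg G * (deg G i * (17 / 6 : ℝ)) := by gcongr
    _ = 17 / 6 * (α / topDeg G * deg G i) := by ring

lemma measurable_step (η : Fin N → Fin 4) : Measurable (step G α η) := by
  refine measurable_pi_lambda _ fun i => Continuous.measurable ?_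
  have hpush : Continuous fun y : Fin N → UnitAddCircle => push G α y i (η i) := by
    have := continuous_sinC
    unfold push coupling
    fun_prop
  exact (((continuous_nodeMap 0).comp (continuous_apply i)).add continuous_const).add
    ((AddCircle.continuous_mk' (1 : ℝ)).comp hpush)

lemma measurable_traj (t : ℕ) :
    Measurable fun p : Noise N × (Fin N → UnitAddCircle) => traj G α p.1 p.2 t := by
  induction t with
  | zero => exact measurable_snd
  | succ t ih =>
    have hstep : Measurable fun q : (Fin N → UnitAddCircle) × (Fin N → Fin 4) =>
        step G α q.2 q.1 := measurable_from_prod_countable_left fun η => measurable_step G α η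
    have hrow : Measurable fun p : Noise N × (Fin N → UnitAddCircle) => fun i => p.1 (t, i) :=
      by fun_prop
    simp only [traj_succ]
    exact Measurable.comp (f := fun p : Noise N × (Fin N → UnitAddCircle) =>
      (traj G α p.1 p.2 t, fun i => p.1 (t, i))) hstep (ih.prodMk hrow)

lemma dynProb_step_le (t : ℕ) {E : Set ((Fin N → UnitAddCircle) × (Fin N → UnitAddCircle))}
    (hE : MeasurableSet E) {B : ℝ}
    (hB : ∀ y, (rowLaw N).real {η | (y, step G α η y) ∈ E} ≤ B) :
    (dynProb N).real {p | (traj G α p.1 p.2 t, traj G α p.1 p.2 (t + 1)) ∈ E} ≤ B := by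
  refine dynProb_le_of_resample t (measurableSet_preimage
    ((measurable_traj G α t).prodMk (measurable_traj G α (t + 1))) hE) fun ⟨ω, x⟩ => ?_
  simpa only [Set.mem_preimage, traj_resample_succ, traj_resample G α ω x _ le_rfl]
    using hB (traj G α ω x t)

variable {α} in
/-- The displacements `e` absorb the coupling, so that the bound also covers time `0`, where the
uniform initial state has the same law as its rotations by quarter turns. -/
lemma dynProb_traj_le (hα : 0 ≤ α) (t : ℕ) {E : Set (Fin N → UnitAddCircle)}
    (hE : MeasurableSet E) {B : ℝ}
    (hB : ∀ (z : Fin N → UnitAddCircle) (e : Fin N → Fin 4 → ℝ),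
      (∀ j k, |e j k| ≤ 17 / 6 * (α / topDeg G * deg G j)) →
      (rowLaw N).real {η | (fun j => z j + quarter (η j) + (e j (η j) : UnitAddCircle)) ∈ E} ≤ B) :
    (dynProb N).real {p | traj G α p.1 p.2 t ∈ E} ≤ B := by
  cases t with
  | zero =>
    refine dynProb_le_of_shift (measurableSet_preimage (measurable_traj G α 0) hE) fun ⟨ω, x⟩ => ?_
    simpa [traj] using hB x (fun _ _ => 0) fun _ _ => by rw [abs_zero]; positivity
  | succ t =>
    exact dynProb_step_le G α t (measurableSet_preimage measurable_snd hE) fun y =>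
      hB _ _ fun j k => abs_push_le G hα y j k

end Step

/-! ### Hoeffding's inequality -/

section Hoeffding

section Independent

variable {Ω ι : Type*} [MeasurableSpace Ω] {μ : Measure Ω} [IsProbabilityMeasure μ]
  {X : ι → Ω → ℝ} {J : Finset ι} {c : ℝ}

lemma measureReal_sum_sub_integral_ge_le (hind : iIndepFun X μ) (hXm : ∀ i, AEMeasurable (X i) μ)
    (hc : 0 ≤ c) (hX : ∀ i ∈ J, ∀ ω, |X i ω| ≤ c) {s : ℝ} (hs : 0 ≤ s) :
    μ.real {ω | s ≤ ∑ i ∈ J, (X i ω - μ[X i])} ≤ exp (-s ^ 2 / (2 * (J.card * c ^ 2))) := by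
  have hcentred : iIndepFun (fun i ω => X i ω - μ[X i]) μ :=
    hind.comp (fun i x => x - ∫ ω, X i ω ∂μ) fun _ => by fun_prop
  have hsub (i : ι) (hi : i ∈ J) :
      HasSubgaussianMGF (fun ω => X i ω - μ[X i]) ((‖c - -c‖₊ / 2) ^ 2) μ :=
    hasSubgaussianMGF_of_mem_Icc (hXm i) (Eventually.of_forall fun ω => abs_le.1 (hX i hi ω))
  have hparam : ((∑ _i ∈ J, (‖c - -c‖₊ / 2) ^ 2 : NNReal) : ℝ) = J.card * c ^ 2 := by
    push_cast
    rw [Finset.sum_const, nsmul_eq_mul, norm_eq_abs, abs_of_nonneg (by linarith)]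
    ring
  rw [← hparam]
  exact HasSubgaussianMGF.measure_sum_ge_le_of_iIndepFun hcentred hsub hs

lemma measureReal_abs_sum_sub_integral_ge_le (hind : iIndepFun X μ)
    (hXm : ∀ i, AEMeasurable (X i) μ) (hc : 0 ≤ c) (hX : ∀ i ∈ J, ∀ ω, |X i ω| ≤ c) {s : ℝ}
    (hs : 0 ≤ s) :
    μ.real {ω | s ≤ |∑ i ∈ J, (X i ω - μ[X i])|} ≤
      2 * exp (-s ^ 2 / (2 * (J.card * c ^ 2))) := by
  have hupper := measureReal_sum_sub_integral_ge_le hind hXm hc hX hs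
  have hlower := measureReal_sum_sub_integral_ge_le (hind.comp (fun _ x => -x) fun _ => by fun_prop)
    (fun i => (hXm i).neg) hc (fun i hi ω => (abs_neg (X i ω)).trans_le (hX i hi ω)) hs
  simp only [Function.comp_apply, integral_neg, sub_neg_eq_add, neg_add_eq_sub,
    ← neg_sub (X _ _), Finset.sum_neg_distrib] at hlower
  simp only [le_abs, Set.ofPred_or]
  exact (measureReal_union_le _ _).trans (by linarith)

lemma measureReal_abs_sum_sub_ge_le (hind : iIndepFun X μ) (hXm : ∀ i, AEMeasurable (X i) μ)
    (hc : 0 < c) (hX : ∀ i ∈ J, ∀ ω, |X i ω| ≤ c) (m : ι → ℝ) {r D : ℝ} (hr : 0 ≤ r)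
    (hD : J.card ≤ D) (hm : ∀ i ∈ J, |μ[X i] - m i| ≤ r) {s : ℝ} (hs : 0 < s) :
    μ.real {ω | s + D * r ≤ |∑ i ∈ J, (X i ω - m i)|} ≤
      2 * exp (-s ^ 2 / (2 * (D * c ^ 2))) := by
  have hsplit (ω : Ω) : |∑ i ∈ J, (X i ω - m i)| ≤ |∑ i ∈ J, (X i ω - μ[X i])| + D * r := by
    have hmean : |∑ i ∈ J, (μ[X i] - m i)| ≤ D * r := by
      refine (Finset.abs_sum_le_sum_abs _ _).trans ((Finset.sum_le_card_nsmul _ _ _ hm).trans ?_)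
      rw [nsmul_eq_mul]
      gcongr
    calc _ = |∑ i ∈ J, (X i ω - μ[X i]) + ∑ i ∈ J, (μ[X i] - m i)| := by
          simp only [← Finset.sum_add_distrib, sub_add_sub_cancel]
      _ ≤ _ := (abs_add_le _ _).trans (by gcongr)
  have hmono : μ.real {ω | s + D * r ≤ |∑ i ∈ J, (X i ω - m i)|} ≤
      μ.real {ω | s ≤ |∑ i ∈ J, (X i ω - μ[X i])|} :=
    measureReal_mono fun ω hω => le_of_add_le_add_right (le_trans hω (hsplit ω))
  rcases J.eq_empty_or_nonempty with rfl | hJ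
  · have hempty : {ω : Ω | s ≤ |∑ i ∈ (∅ : Finset ι), (X i ω - μ[X i])|} = ∅ := by
      simpa [Set.eq_empty_iff_forall_notMem] using fun _ => hs
    rw [hempty, measureReal_empty] at hmono
    exact hmono.trans (by positivity)
  · have : (0 : ℝ) < J.card := by exact_mod_cast hJ.card_pos
    refine hmono.trans ((measureReal_abs_sum_sub_integral_ge_le hind hXm hc.le hX hs.le).trans ?_)
    rw [neg_div, neg_div]
    gcongr

end Independent

variable {N : ℕ}

lemma integral_uniform_fin_four {E : Type*} [NormedAddCommGroup E] [NormedSpace ℝ E]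
    [CompleteSpace E] (f : Fin 4 → E) :
    ∫ k, f k ∂(PMF.uniformOfFintype (Fin 4)).toMeasure = (1 / 4 : ℝ) • ∑ k, f k := by
  rw [PMF.integral_eq_sum, Finset.smul_sum]
  exact Finset.sum_congr rfl fun k _ => by simp

lemma integral_rowLaw_eval {E : Type*} [NormedAddCommGroup E] [NormedSpace ℝ E]
    [CompleteSpace E] (f : Fin 4 → E) (j : Fin N) :
    ∫ η, f (η j) ∂(rowLaw N) = (1 / 4 : ℝ) • ∑ k, f k := by
  rw [← integral_uniform_fin_four, rowLaw]
  exact integral_comp_eval (μ := fun _ : Fin N => (PMF.uniformOfFintype (Fin 4)).toMeasure)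
    .of_discrete

lemma iIndepFun_rowLaw (X : Fin N → Fin 4 → ℝ) : iIndepFun (fun j η => X j (η j)) (rowLaw N) :=
  iIndepFun_pi (μ := fun _ : Fin N => (PMF.uniformOfFintype (Fin 4)).toMeasure) (X := X)
    fun _ => .of_discrete

lemma rowLaw_abs_sum_sub_ge_le (J : Finset (Fin N)) (X : Fin N → Fin 4 → ℝ) (m : Fin N → ℝ)
    {c r D : ℝ} (hc : 0 < c) (hr : 0 ≤ r) (hX : ∀ j ∈ J, ∀ k, |X j k| ≤ c) (hD : J.card ≤ D)
    (hm : ∀ j ∈ J, |1 / 4 * ∑ k, X j k - m j| ≤ r) {s : ℝ} (hs : 0 < s) :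
    (rowLaw N).real {η | s + D * r ≤ |∑ j ∈ J, (X j (η j) - m j)|} ≤
      2 * exp (-s ^ 2 / (2 * (D * c ^ 2))) := by
  refine measureReal_abs_sum_sub_ge_le (iIndepFun_rowLaw X) (fun _ => .of_discrete) hc
    (fun j hj η => hX j hj (η j)) m hr hD (fun j hj => ?_) hs
  rw [integral_rowLaw_eval (X j), smul_eq_mul]
  exact hm j hj

end Hoeffding

/-! ### Frequency of visits to a conditionally rare set -/

lemma lintegral_exp_mul_indicator_le {Ω : Type*} [MeasurableSpace Ω] {Q : Measure Ω}
    [IsProbabilityMeasure Q] {A : Set Ω} (hAm : MeasurableSet A) {p θ : ℝ} (hθ0 : 0 ≤ θ)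
    (hθ1 : θ ≤ 1) (hA : Q.real A ≤ p) :
    ∫⁻ η, ENNReal.ofReal (exp (θ * A.indicator 1 η)) ∂Q ≤
      ENNReal.ofReal (exp (p * (θ + θ ^ 2))) := by
  have hexp : 0 ≤ exp θ - 1 := sub_nonneg.2 (one_le_exp hθ0)
  have hquad : exp θ - 1 ≤ θ + θ ^ 2 := by
    linarith [(abs_le.1 (abs_exp_sub_one_sub_id_le (x := θ) (by rwa [abs_of_nonneg hθ0]))).2]
  have hsplit (η : Ω) : ENNReal.ofReal (exp (θ * A.indicator 1 η)) =
      1 + A.indicator (fun _ => ENNReal.ofReal (exp θ - 1)) η := by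
    by_cases h : η ∈ A
    · rw [Set.indicator_of_mem h, Set.indicator_of_mem h, Pi.one_apply, mul_one,
        ← ENNReal.ofReal_one, ← ENNReal.ofReal_add zero_le_one hexp, add_sub_cancel]
    · simp [Set.indicator_of_notMem h]
  calc _ = 1 + ENNReal.ofReal (exp θ - 1) * Q A := by
        simp only [hsplit]
        rw [lintegral_add_left measurable_const, lintegral_indicator_const hAm, lintegral_const,
          measure_univ, mul_one]
    _ = ENNReal.ofReal (1 + (exp θ - 1) * Q.real A) := by
        rw [ENNReal.ofReal_add zero_le_one (mul_nonneg hexp measureReal_nonneg),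
          ENNReal.ofReal_mul hexp, ENNReal.ofReal_one, ofReal_measureReal]
    _ ≤ _ := by
        refine ENNReal.ofReal_le_ofReal ?_
        calc _ ≤ (θ + θ ^ 2) * p + 1 := by rw [add_comm]; gcongr
          _ ≤ _ := by rw [mul_comm]; exact add_one_le_exp _

section Frequency

variable {N : ℕ} (G : SimpleGraph (Fin N)) (α : ℝ)

/-- The number of visits of the trajectory to `B` before time `T`. -/
def visits (B : Set (Fin N → UnitAddCircle)) (T : ℕ)
    (q : Noise N × (Fin N → UnitAddCircle)) : ℝ :=
  ∑ t ∈ Finset.range T, B.indicator 1 (traj G α q.1 q.2 t)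

lemma measurable_visits {B : Set (Fin N → UnitAddCircle)} (hB : MeasurableSet B) (T : ℕ) :
    Measurable (visits G α B T) :=
  Finset.measurable_fun_sum _ fun t _ =>
    (measurable_one.indicator hB).comp (measurable_traj G α t)

lemma visits_one_le (B : Set (Fin N → UnitAddCircle)) (q : Noise N × (Fin N → UnitAddCircle)) :
    visits G α B 1 q ≤ 1 := by
  rw [visits, Finset.sum_range_one]
  exact Set.indicator_le' (fun _ _ => le_rfl) (fun _ _ => zero_le_one) _

lemma visits_resample (B : Set (Fin N → UnitAddCircle)) (T : ℕ)
    (q : Noise N × (Fin N → UnitAddCircle)) (η : Fin N → Fin 4) :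
    visits G α B (T + 2) (resample T q.1 η, q.2) =
      visits G α B (T + 1) q + {η | step G α η (traj G α q.1 q.2 T) ∈ B}.indicator 1 η := by
  rw [visits, Finset.sum_range_succ, visits, traj_resample_succ]
  congr 1
  exact Finset.sum_congr rfl fun t ht => by
    rw [traj_resample G α q.1 q.2 η (Finset.mem_range_succ_iff.1 ht)]

variable {B : Set (Fin N → UnitAddCircle)} {p : ℝ}

/-- Markov property: averaging over the noise at time `T` multiplies the bound on the exponential
moment of the number of visits by `exp (p (θ + θ²))`. -/
lemma lintegral_exp_visits_le (hB : MeasurableSet B) {θ : ℝ} (hθ0 : 0 ≤ θ) (hθ1 : θ ≤ 1)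
    (hp : ∀ y, (rowLaw N).real {η | step G α η y ∈ B} ≤ p) (T : ℕ) :
    ∫⁻ q, ENNReal.ofReal (exp (θ * visits G α B (T + 1) q)) ∂(dynProb N) ≤
      ENNReal.ofReal (exp (θ + T * (p * (θ + θ ^ 2)))) := by
  induction T with
  | zero =>
    calc _ ≤ ∫⁻ _, ENNReal.ofReal (exp θ) ∂(dynProb N) := lintegral_mono fun q =>
          ENNReal.ofReal_le_ofReal (exp_le_exp.2
            (mul_le_of_le_one_right hθ0 (visits_one_le G α B q)))
      _ = _ := by simp
  | succ T ih =>
    have hsplit (q : Noise N × (Fin N → UnitAddCircle)) (η : Fin N → Fin 4) :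
        ENNReal.ofReal (exp (θ * visits G α B (T + 1 + 1) (resample T q.1 η, q.2))) =
          ENNReal.ofReal (exp (θ * visits G α B (T + 1) q)) * ENNReal.ofReal
            (exp (θ * {η | step G α η (traj G α q.1 q.2 T) ∈ B}.indicator 1 η)) := by
      rw [visits_resample, mul_add, exp_add, ENNReal.ofReal_mul (exp_pos _).le]
    rw [lintegral_dynProb_resample T
      (((measurable_visits G α hB _).const_mul θ).exp.ennreal_ofReal)]
    calc _ ≤ ∫⁻ q, ENNReal.ofReal (exp (θ * visits G α B (T + 1) q)) *
          ENNReal.ofReal (exp (p * (θ + θ ^ 2))) ∂(dynProb N) := by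
          refine lintegral_mono fun q => ?_
          simp only [hsplit, lintegral_const_mul _ Measurable.of_discrete]
          gcongr
          exact lintegral_exp_mul_indicator_le .of_discrete hθ0 hθ1 (hp _)
      _ ≤ ENNReal.ofReal (exp (θ + T * (p * (θ + θ ^ 2)))) *
          ENNReal.ofReal (exp (p * (θ + θ ^ 2))) := by
          rw [lintegral_mul_const' _ _ ENNReal.ofReal_ne_top]
          gcongr
      _ = ENNReal.ofReal (exp (θ + (T + 1 : ℕ) * (p * (θ + θ ^ 2)))) := by
          rw [← ENNReal.ofReal_mul (exp_pos _).le, ← exp_add]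
          push_cast
          ring_nf

lemma dynProb_lt_visits_le (hB : MeasurableSet B) {ρ : ℝ} (hp1 : p ≤ 1) (hρ0 : 0 ≤ ρ) (hρ1 : ρ ≤ 1)
    (hp : ∀ y, (rowLaw N).real {η | step G α η y ∈ B} ≤ p) (T : ℕ) :
    dynProb N {q | (p + ρ) * (T + 1 : ℕ) < visits G α B (T + 1) q} ≤
      ENNReal.ofReal (exp 1 * exp (-ρ ^ 2 / 4) ^ T) := by
  have hp0 : 0 ≤ p := measureReal_nonneg.trans (hp fun _ => 0)
  have hexponent : ρ / 2 + T * (p * (ρ / 2 + (ρ / 2) ^ 2)) - ρ / 2 * ((p + ρ) * (T + 1 : ℕ)) ≤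
      1 + T * (-ρ ^ 2 / 4) := by
    have hT : (T : ℝ) * (p * (ρ / 2) ^ 2) ≤ T * (1 * (ρ / 2) ^ 2) := by gcongr
    have hpρ : 0 ≤ ρ / 2 * (p + ρ) := by positivity
    push_cast
    linarith
  set K := exp (ρ / 2 * ((p + ρ) * (T + 1 : ℕ)))
  calc _ ≤ dynProb N {q | ENNReal.ofReal K ≤
        ENNReal.ofReal (exp (ρ / 2 * visits G α B (T + 1) q))} :=
        measure_mono fun q hq => ENNReal.ofReal_le_ofReal (exp_le_exp.2
          (mul_le_mul_of_nonneg_left (le_of_lt hq) (by linarith)))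
    _ ≤ (∫⁻ q, ENNReal.ofReal (exp (ρ / 2 * visits G α B (T + 1) q)) ∂(dynProb N)) /
        ENNReal.ofReal K :=
        meas_ge_le_lintegral_div
          ((measurable_visits G α hB _).const_mul _).exp.ennreal_ofReal.aemeasurable
          (ENNReal.ofReal_pos.2 (exp_pos _)).ne' ENNReal.ofReal_ne_top
    _ ≤ ENNReal.ofReal (exp (ρ / 2 + T * (p * (ρ / 2 + (ρ / 2) ^ 2)))) / ENNReal.ofReal K := by
        gcongr
        exact lintegral_exp_visits_le G α hB (by linarith) (by linarith) hp T
    _ ≤ ENNReal.ofReal (exp 1 * exp (-ρ ^ 2 / 4) ^ T) := by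
        rw [← ENNReal.ofReal_div_of_pos (exp_pos _), ← exp_sub, ← exp_nat_mul, ← exp_add]
        exact ENNReal.ofReal_le_ofReal (exp_le_exp.2 hexponent)

lemma ae_eventually_visits_le (hB : MeasurableSet B) {ρ : ℝ} (hp1 : p ≤ 1) (hρ0 : 0 < ρ)
    (hρ1 : ρ ≤ 1) (hp : ∀ y, (rowLaw N).real {η | step G α η y ∈ B} ≤ p) :
    ∀ᵐ q ∂(dynProb N), ∀ᶠ T : ℕ in atTop, visits G α B T q ≤ (p + ρ) * T := by
  have hratio : exp (-ρ ^ 2 / 4) < 1 := exp_lt_one_iff.2 (by linarith [pow_pos hρ0 2])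
  have hsum : ∑' T : ℕ, dynProb N {q | (p + ρ) * (T + 1 : ℕ) < visits G α B (T + 1) q} ≠ ⊤ :=
    ne_top_of_le_ne_top
      (((summable_geometric_of_lt_one (exp_pos _).le hratio).mul_left _).tsum_ofReal_ne_top)
      (ENNReal.tsum_le_tsum (dynProb_lt_visits_le G α hB hp1 hρ0.le hρ1 hp))
  filter_upwards [ae_eventually_notMem hsum] with q hq
  rw [← map_add_atTop_eq_nat 1, eventually_map]
  exact hq.mono fun T hT => not_lt.1 hT

end Frequency

/-! ### Time averages of the fluctuation -/

lemma le_liminf_average {a b : ℕ → ℝ} {P : ℝ} (ha : ∀ t, a t ≤ 1) (hab : ∀ t, 1 - b t ≤ a t)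
    (hb : ∀ n : ℕ, ∀ᶠ T : ℕ in atTop, ∑ t ∈ Finset.range T, b t ≤ (P + 1 / ((n : ℝ) + 1)) * T) :
    1 - P ≤ liminf (fun T : ℕ => (1 / (T : ℝ)) * ∑ t ∈ Finset.range T, a t) atTop := by
  have hle (T : ℕ) : (1 / (T : ℝ)) * ∑ t ∈ Finset.range T, a t ≤ 1 := by
    rw [one_div_mul_eq_div]
    refine div_le_one_of_le₀ ((Finset.sum_le_card_nsmul _ _ 1 fun t _ => ha t).trans_eq ?_)
      T.cast_nonneg
    simp
  refine le_of_forall_pos_le_add fun ρ hρ => sub_le_iff_le_add.1 ?_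
  obtain ⟨n, hn⟩ := exists_nat_one_div_lt hρ
  refine le_liminf_of_le (isBoundedUnder_of ⟨1, hle⟩).isCoboundedUnder_ge ?_
  filter_upwards [hb n, eventually_gt_atTop 0] with T hT hT0
  have hT' : (0 : ℝ) < T := by exact_mod_cast hT0
  rw [one_div_mul_eq_div, le_div_iff₀ hT']
  calc (1 - P - ρ) * T ≤ T - (P + 1 / ((n : ℝ) + 1)) * T := by
        linarith [mul_le_mul_of_nonneg_right hn.le hT'.le]
    _ ≤ T - ∑ t ∈ Finset.range T, b t := by linarith
    _ = ∑ t ∈ Finset.range T, (1 - b t) := by simp [Finset.sum_sub_distrib]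
    _ ≤ _ := Finset.sum_le_sum fun t _ => hab t

section TimeAverage

variable {N : ℕ} {G : SimpleGraph (Fin N)} {α δ Δ ε : ℝ}

/-- The quarter turns of `sin` average to zero, so only the displacement contributes to the mean. -/
lemma abs_mean_sinC_add_quarter_le (z : UnitAddCircle) {e : Fin 4 → ℝ} {b : ℝ}
    (he : ∀ k, |e k| ≤ b) :
    |1 / 4 * ∑ k, sinC (z + quarter k + (e k : UnitAddCircle))| ≤ 2 * π * b := by
  have hcentre : ∑ k, sinC (z + quarter k + (e k : UnitAddCircle)) =
      ∑ k, (sinC (z + quarter k + (e k : UnitAddCircle)) - sinC (z + quarter k)) := by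
    rw [Finset.sum_sub_distrib, sum_sinC_add_quarter, sub_zero]
  rw [hcentre, abs_mul, abs_of_pos (by norm_num : (0 : ℝ) < 1 / 4)]
  calc _ ≤ 1 / 4 * ∑ _k : Fin 4, 2 * π * b := by
        gcongr 1 / 4 * ?_
        exact (Finset.abs_sum_le_sum_abs _ _).trans (Finset.sum_le_sum fun k _ =>
          (abs_sinC_add_coe_sub_le _ _).trans (by gcongr; exact he k))
    _ = 2 * π * b := by simp

lemma rowLaw_le_abs_lowSum_le (hα : 0 ≤ α) (hδ : 0 ≤ δ) (hG : 0 < topDeg G) (i : Fin N)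
    (z : Fin N → UnitAddCircle) (e : Fin N → Fin 4 → ℝ)
    (he : ∀ j k, |e j k| ≤ 17 / 6 * (α / topDeg G * deg G j)) {s : ℝ} (hs : 0 < s) :
    (rowLaw N).real {η | s + 17 / 3 * π * α * δ ≤
      |lowSum G δ i fun j => z j + quarter (η j) + (e j (η j) : UnitAddCircle)|} ≤
      2 * exp (-s ^ 2 / (2 * topDeg G)) := by
  have : (0 : ℝ) < topDeg G := by exact_mod_cast hG
  have hdev := rowLaw_abs_sum_sub_ge_le (lowNbrs G δ i)
    (fun j k => sinC (z j + quarter k + (e j k : UnitAddCircle))) (fun _ => 0) (c := 1)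
    (r := 2 * π * (17 / 6 * (α / topDeg G * δ))) one_pos (by positivity)
    (fun j _ k => abs_sinC_le_one _) (card_lowNbrs_le_topDeg G δ i) (fun j hj => ?_) hs
  · have hbias : (topDeg G : ℝ) * (2 * π * (17 / 6 * (α / topDeg G * δ))) =
        17 / 3 * π * α * δ := by
      field_simp
      ring
    simpa only [hbias, sub_zero, one_pow, mul_one, lowSum] using hdev
  · rw [sub_zero]
    exact abs_mean_sinC_add_quarter_le _ fun k =>
      (he j k).trans (by gcongr; exact (deg_lt_of_mem_lowNbrs hj).le)

/-- The states in which the summed signal of the low degree neighbours of some hub is at least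
`r Δ₀`, i.e. the main part of its fluctuation is at least `α r`. -/
def deviantStates (G : SimpleGraph (Fin N)) (Δ δ r : ℝ) : Set (Fin N → UnitAddCircle) :=
  {y | ∃ i ∈ hubs G Δ, r * topDeg G ≤ |lowSum G δ i y|}

lemma deviantStates_eq (r : ℝ) :
    deviantStates G Δ δ r = ⋃ i ∈ hubs G Δ, {y | r * topDeg G ≤ |lowSum G δ i y|} := by
  ext y
  simp [deviantStates]

lemma measurableSet_deviantStates (r : ℝ) : MeasurableSet (deviantStates G Δ δ r) := by
  rw [deviantStates_eq]
  exact Finset.measurableSet_biUnion _ fun i _ =>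
    measurableSet_le measurable_const (continuous_lowSum G δ i).abs.measurable

lemma abs_fluct_le_of_notMem_deviantStates (hα : 0 ≤ α) (hΔ : 0 ≤ Δ) {r : ℝ} {ω : Noise N}
    {x : Fin N → UnitAddCircle} {t : ℕ} (h : traj G α ω x t ∉ deviantStates G Δ δ r) {i : Fin N}
    (hi : i ∈ hubs G Δ) :
    |fluct G δ α ω x i t| ≤ α * r + 17 / 6 * α * (1 - starIndex G Δ δ) := by
  have hD : (0 : ℝ) < topDeg G := hΔ.trans_lt (lt_topDeg_of_mem_hubs hi)
  have hlow : |lowSum G δ i (traj G α ω x t)| ≤ r * topDeg G :=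
    (not_le.1 fun hr => h ⟨i, hi, hr⟩).le
  have hmain : |α / topDeg G * lowSum G δ i (traj G α ω x t)| ≤ α * r := by
    rw [abs_mul, abs_of_nonneg (by positivity)]
    calc _ ≤ α / topDeg G * (r * topDeg G) := by gcongr
      _ = α * r := by field_simp
  linarith [abs_sub_abs_le_abs_sub (fluct G δ α ω x i t)
    (α / topDeg G * lowSum G δ i (traj G α ω x t)), abs_fluct_sub_lowSum_le hα hΔ δ ω x hi t]

lemma rowLaw_step_mem_deviantStates_le (hα : 0 ≤ α) (hδ : 0 ≤ δ) (hΔ : 0 < Δ) {r : ℝ} (hr : 0 < r)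
    (hbias : 17 / 3 * π * α * δ ≤ r * Δ / 3) (y : Fin N → UnitAddCircle) :
    (rowLaw N).real {η | step G α η y ∈ deviantStates G Δ δ (4 / 3 * r)} ≤
      (hubs G Δ).card * (2 * exp (-(Δ * r ^ 2 / 2))) := by
  simp only [deviantStates_eq, Set.mem_iUnion, exists_prop]
  have hunion : {η | ∃ i ∈ hubs G Δ,
      step G α η y ∈ {y | 4 / 3 * r * topDeg G ≤ |lowSum G δ i y|}} =
      ⋃ i ∈ hubs G Δ, {η | 4 / 3 * r * topDeg G ≤ |lowSum G δ i (step G α η y)|} := by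
    ext η
    simp
  rw [hunion, ← nsmul_eq_mul]
  refine (measureReal_biUnion_finset_le _ _).trans (Finset.sum_le_card_nsmul _ _ _ fun i hi => ?_)
  have hΔD : Δ < topDeg G := lt_topDeg_of_mem_hubs hi
  have hD : (0 : ℝ) < topDeg G := hΔ.trans hΔD
  calc _ ≤ (rowLaw N).real {η | r * topDeg G + 17 / 3 * π * α * δ ≤
        |lowSum G δ i (step G α η y)|} := measureReal_mono fun η hη => by
        refine le_trans ?_ (Set.mem_ofPred.1 hη)
        linarith [mul_le_mul_of_nonneg_left hΔD.le hr.le]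
    _ ≤ 2 * exp (-(r * topDeg G) ^ 2 / (2 * topDeg G)) :=
        rowLaw_le_abs_lowSum_le hα hδ (by exact_mod_cast hD) i _ _
          (fun j k => abs_push_le G hα y j k) (by positivity)
    _ = 2 * exp (-(topDeg G * r ^ 2 / 2)) := by
        congr 2
        field_simp
    _ ≤ 2 * exp (-(Δ * r ^ 2 / 2)) := by gcongr

lemma natCast_mul_exp_le {n : ℕ} {x : ℝ} (hx : 36 * log (n + 1) ≤ x) :
    n * (2 * exp (-(x / 8))) ≤ exp (-(x / 19)) := by
  have hlog : 0 ≤ log ((n : ℝ) + 1) := log_nonneg (by linarith [n.cast_nonneg (α := ℝ)])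
  have hsq : 2 * (n : ℝ) ≤ exp (2 * log (n + 1)) := by
    rw [mul_comm 2 (log _), exp_mul, exp_log (by positivity), rpow_two]
    linarith [sq_nonneg (n : ℝ)]
  calc n * (2 * exp (-(x / 8))) = 2 * n * exp (-(x / 8)) := by ring
    _ ≤ exp (2 * log (n + 1)) * exp (-(x / 8)) := by gcongr
    _ = exp (2 * log (n + 1) + -(x / 8)) := (exp_add _ _).symm
    _ ≤ exp (-(x / 19)) := exp_le_exp.2 (by linarith)

lemma mul_log_le_of_sqrt_le {C L : ℝ} (hα : 0 < α) (hΔ : 0 < Δ) (hC : 6 ≤ C) (hL : 0 ≤ L)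
    (h : C * α * √(L / Δ) ≤ ε) : 36 * L ≤ Δ * ε ^ 2 / α ^ 2 := by
  have hsq : (6 * α * √(L / Δ)) ^ 2 ≤ ε ^ 2 := by
    gcongr
    exact le_trans (by gcongr) h
  rw [mul_pow, sq_sqrt (by positivity)] at hsq
  rw [le_div_iff₀ (by positivity)]
  calc 36 * L * α ^ 2 = Δ * ((6 * α) ^ 2 * (L / Δ)) := by field_simp; ring
    _ ≤ Δ * ε ^ 2 := by gcongr

theorem ae_le_liminf_frequency {C : ℝ} (hα : 0 < α) (hδ : 0 < δ) (hΔ : 0 < Δ) (hC : 6 ≤ C)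
    (hstar : 17 / 2 * α * (1 - starIndex G Δ δ) ≤ ε) (hbias : 34 * π * α ^ 2 * δ / Δ ≤ ε)
    (hlog : C * α * √(log ((hubs G Δ).card + 1) / Δ) ≤ ε) :
    ∀ᵐ p ∂(dynProb N), 1 - exp (-(starIndex G Δ δ * Δ * ε ^ 2 / (19 * α ^ 2))) ≤
      liminf (fun T : ℕ => (1 / (T : ℝ)) * ∑ t ∈ Finset.range T,
        Set.indicator {s : ℕ | ∀ i ∈ hubs G Δ, |fluct G δ α p.1 p.2 i s| ≤ ε}
          (fun _ => (1 : ℝ)) t) atTop := by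
  have hε : 0 < ε := lt_of_lt_of_le (by positivity) hbias
  set P := exp (-(starIndex G Δ δ * Δ * ε ^ 2 / (19 * α ^ 2)))
  set B := deviantStates G Δ δ (4 / 3 * (ε / (2 * α)))
  have hP1 : P ≤ 1 := by
    have := starIndex_nonneg G Δ δ
    exact exp_le_one_iff.2 (neg_nonpos.2 (by positivity))
  have hP : (hubs G Δ).card * (2 * exp (-(Δ * ε ^ 2 / α ^ 2 / 8))) ≤ P := by
    refine (natCast_mul_exp_le (mul_log_le_of_sqrt_le hα hΔ hC
      (log_nonneg (by linarith [(hubs G Δ).card.cast_nonneg (α := ℝ)])) hlog)).trans ?_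
    refine exp_le_exp.2 (neg_le_neg ?_)
    calc _ = starIndex G Δ δ * (Δ * ε ^ 2 / α ^ 2 / 19) := by field_simp
      _ ≤ Δ * ε ^ 2 / α ^ 2 / 19 := mul_le_of_le_one_left (by positivity) (starIndex_le_one G Δ δ)
  have hstep (y) : (rowLaw N).real {η | step G α η y ∈ B} ≤ P := by
    refine (rowLaw_step_mem_deviantStates_le hα.le hδ.le hΔ (by positivity) ?_ y).trans
      ((le_of_eq ?_).trans hP)
    · rw [div_le_iff₀ hΔ] at hbias
      rw [show ε / (2 * α) * Δ / 3 = ε * Δ / (6 * α) by field_simp; norm_num,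
        le_div_iff₀ (by positivity)]
      linarith
    · congr 3
      field_simp
      norm_num
  have hvisits : ∀ᵐ q ∂(dynProb N), ∀ n : ℕ, ∀ᶠ T : ℕ in atTop,
      visits G α B T q ≤ (P + 1 / ((n : ℝ) + 1)) * T := ae_all_iff.2 fun n =>
    ae_eventually_visits_le G α (measurableSet_deviantStates _) hP1 (by positivity)
      (div_le_one_of_le₀ (by linarith [n.cast_nonneg (α := ℝ)]) (by positivity)) hstep
  filter_upwards [hvisits] with q hq
  refine le_liminf_average (fun t => Set.indicator_le' (fun _ _ => le_rfl)
    (fun _ _ => zero_le_one) t) (fun t => ?_) hq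
  by_cases hb : traj G α q.1 q.2 t ∈ B
  · rw [Set.indicator_of_mem hb, Pi.one_apply, sub_self]
    exact Set.indicator_nonneg (fun _ _ => zero_le_one) _
  · have hgood : t ∈ {s : ℕ | ∀ i ∈ hubs G Δ, |fluct G δ α q.1 q.2 i s| ≤ ε} := fun i hi => by
      have hr : α * (4 / 3 * (ε / (2 * α))) = 2 / 3 * ε := by field_simp; norm_num
      linarith [abs_fluct_le_of_notMem_deviantStates hα.le hΔ.le hb hi]
    rw [Set.indicator_of_notMem hb, Set.indicator_of_mem hgood, sub_zero]

end TimeAverage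

/-! ### Gaussian smoothing of distribution functions -/

section GaussianSmoothing

lemma hasSubgaussianMGF_id_gaussianReal (v : NNReal) :
    HasSubgaussianMGF id v (gaussianReal 0 v) where
  integrable_exp_mul := integrable_exp_mul_gaussianReal
  mgf_le t := by simp [mgf_id_gaussianReal]

lemma gaussianReal_real_Ici_le (v : NNReal) {a : ℝ} (ha : 0 ≤ a) :
    (gaussianReal 0 v).real (Set.Ici a) ≤ exp (-a ^ 2 / (2 * v)) :=
  (hasSubgaussianMGF_id_gaussianReal v).measure_ge_le ha

lemma gaussianReal_real_Iic_neg_le (v : NNReal) {a : ℝ} (ha : 0 ≤ a) :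
    (gaussianReal 0 v).real (Set.Iic (-a)) ≤ exp (-a ^ 2 / (2 * v)) := by
  refine le_trans (le_of_eq ?_) ((hasSubgaussianMGF_id_gaussianReal v).neg.measure_ge_le ha)
  congr 1
  ext x
  simp [le_neg]

variable (μ ν : Measure ℝ) [IsProbabilityMeasure μ] [IsProbabilityMeasure ν]

lemma conv_gaussianReal_real_Iic_le (v : NNReal) {a : ℝ} (ha : 0 ≤ a) (u : ℝ) :
    (μ ∗ gaussianReal 0 v).real (Set.Iic u) ≤
      μ.real (Set.Iic (u + a)) + exp (-a ^ 2 / (2 * v)) := by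
  rw [Measure.conv, map_measureReal_apply measurable_add measurableSet_Iic]
  calc _ ≤ (μ.prod (gaussianReal 0 v)).real
        (Set.Iic (u + a) ×ˢ Set.univ ∪ Set.univ ×ˢ Set.Iic (-a)) := by
        refine measureReal_mono fun p (hp : p.1 + p.2 ≤ u) => or_iff_not_imp_right.2 fun h => ?_
        have : -a < p.2 := not_le.1 fun h2 => h ⟨trivial, h2⟩
        exact ⟨Set.mem_Iic.2 (by linarith), trivial⟩
    _ ≤ μ.real (Set.Iic (u + a)) + (gaussianReal 0 v).real (Set.Iic (-a)) := by
        simpa [measureReal_prod_prod] using measureReal_union_le (μ := μ.prod (gaussianReal 0 v))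
          (Set.Iic (u + a) ×ˢ Set.univ) (Set.univ ×ˢ Set.Iic (-a))
    _ ≤ _ := by
        gcongr
        exact gaussianReal_real_Iic_neg_le v ha

lemma real_Iic_sub_le_conv_gaussianReal (v : NNReal) {a : ℝ} (ha : 0 ≤ a) (u : ℝ) :
    μ.real (Set.Iic (u - a)) ≤
      (μ ∗ gaussianReal 0 v).real (Set.Iic u) + exp (-a ^ 2 / (2 * v)) := by
  rw [Measure.conv, map_measureReal_apply measurable_add measurableSet_Iic]
  calc _ = (μ.prod (gaussianReal 0 v)).real (Set.Iic (u - a) ×ˢ Set.univ) := by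
        simp [measureReal_prod_prod]
    _ ≤ (μ.prod (gaussianReal 0 v)).real
        ((fun p : ℝ × ℝ => p.1 + p.2) ⁻¹' Set.Iic u ∪ Set.univ ×ˢ Set.Ici a) := by
        refine measureReal_mono fun p hp => or_iff_not_imp_right.2 fun h => ?_
        have h1 : p.1 ≤ u - a := hp.1
        have h2 : p.2 < a := not_le.1 fun h2 => h ⟨trivial, h2⟩
        change p.1 + p.2 ≤ u
        linarith
    _ ≤ _ := (measureReal_union_le _ _).trans (by
        gcongr
        simpa [measureReal_prod_prod] using gaussianReal_real_Ici_le v ha)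

lemma integral_cos_mul_gaussianReal (v : NNReal) (x : ℝ) :
    ∫ t, cos (x * t) ∂(gaussianReal 0 v) = exp (-(v / 2) * x ^ 2) := by
  have hre := congrArg Complex.re (charFun_gaussianReal (μ := 0) (v := v) x)
  have hexp : Integrable (fun t : ℝ => Complex.exp ((x * t : ℝ) * Complex.I)) (gaussianReal 0 v) :=
    Integrable.of_bound (by fun_prop) 1 (Eventually.of_forall fun t => by
      rw [Complex.norm_exp_ofReal_mul_I])
  have hswap := integral_re hexp
  simp only [RCLike.re_to_complex, Complex.exp_ofReal_mul_I_re] at hswap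
  rw [hswap]
  convert hre using 2
  · simp [charFun_apply_real]
  · rw [← Complex.ofReal_re (exp _)]
    push_cast
    congr 2
    ring

/-- Gaussian densities are, up to normalisation, Fourier transforms of Gaussian densities. -/
lemma gaussianPDFReal_eq_integral_cos {v : NNReal} (hv : v ≠ 0) (x : ℝ) :
    gaussianPDFReal 0 v x = 1 / (2 * π) * ∫ t : ℝ, cos (t * x) * exp (-((v : ℝ) / 2) * t ^ 2) := by
  have : (0 : ℝ) < v := by positivity
  have h := integral_cos_mul_gaussianReal v⁻¹ x
  rw [integral_gaussianReal_eq_integral_smul (inv_ne_zero hv)] at h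
  have hpdf (t : ℝ) : gaussianPDFReal 0 v⁻¹ t • cos (x * t) =
      (√(2 * π * (v : ℝ)⁻¹))⁻¹ * (cos (t * x) * exp (-((v : ℝ) / 2) * t ^ 2)) := by
    rw [gaussianPDFReal, smul_eq_mul, mul_comm x, NNReal.coe_inv, sub_zero,
      show -t ^ 2 / (2 * (v : ℝ)⁻¹) = -((v : ℝ) / 2) * t ^ 2 by field_simp]
    ring
  simp only [hpdf, integral_const_mul] at h
  rw [inv_mul_eq_iff_eq_mul₀ (by positivity)] at h
  rw [h, gaussianPDFReal, sub_zero, ← mul_assoc, NNReal.coe_inv]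
  congr 1
  · rw [sqrt_mul (by positivity), sqrt_mul (by positivity) (v : ℝ)⁻¹, sqrt_inv]
    field_simp
    rw [sq_sqrt (by positivity)]
  · congr 1
    field_simp

lemma gaussianReal_real_Iic_zero {v : NNReal} (hv : v ≠ 0) :
    (gaussianReal 0 v).real (Set.Iic 0) = 1 / 2 := by
  have := nullSingletonClass_gaussianReal (μ := 0) hv
  have hneg : (gaussianReal 0 v).real (Set.Iic 0) = (gaussianReal 0 v).real (Set.Ioi 0) := by
    have hmap : (gaussianReal 0 v).map (fun x => -x) = gaussianReal 0 v := by
      rw [gaussianReal_map_neg, neg_zero]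
    rw [measureReal_congr Ioi_ae_eq_Ici, ← hmap,
      map_measureReal_apply measurable_neg measurableSet_Iic]
    simp [hmap]
  have hcompl := probReal_compl_eq_one_sub (μ := gaussianReal 0 v) (measurableSet_Iic (a := 0))
  rw [Set.compl_Iic, ← hneg] at hcompl
  linarith

lemma integral_cos_mul (t u : ℝ) : ∫ x in (0 : ℝ)..u, cos (t * x) = u * sinc (t * u) := by
  rcases eq_or_ne t 0 with rfl | ht
  · simp
  rcases eq_or_ne u 0 with rfl | hu
  · simp
  rw [intervalIntegral.integral_comp_mul_left _ ht, integral_cos,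
    sinc_of_ne_zero (mul_ne_zero ht hu), mul_zero, sin_zero, sub_zero, smul_eq_mul]
  field_simp

lemma mul_sinc_mul {t : ℝ} (ht : t ≠ 0) (c : ℝ) : c * sinc (t * c) = sin (t * c) / t := by
  rcases eq_or_ne c 0 with rfl | hc
  · simp
  · rw [sinc_of_ne_zero (mul_ne_zero ht hc)]
    field_simp

lemma gaussianReal_real_Iic {v : NNReal} (hv : v ≠ 0) (u : ℝ) :
    (gaussianReal 0 v).real (Set.Iic u) =
      1 / 2 + 1 / (2 * π) * ∫ t : ℝ, u * sinc (t * u) * exp (-((v : ℝ) / 2) * t ^ 2) := by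
  have happly (s : Set ℝ) : (gaussianReal 0 v).real s = ∫ x in s, gaussianPDFReal 0 v x := by
    rw [Measure.real, gaussianReal_apply_eq_integral 0 hv, ENNReal.toReal_ofReal
      (integral_nonneg fun x => gaussianPDFReal_nonneg 0 v x)]
  have hpdf := integrable_gaussianPDFReal 0 v
  have hIic : (gaussianReal 0 v).real (Set.Iic u) - 1 / 2 =
      ∫ x in (0 : ℝ)..u, gaussianPDFReal 0 v x := by
    rw [← gaussianReal_real_Iic_zero hv, happly, happly]
    exact intervalIntegral.integral_Iic_sub_Iic hpdf.integrableOn hpdf.integrableOn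
  have hfubini : Integrable (fun p : ℝ × ℝ => cos (p.2 * p.1) * exp (-((v : ℝ) / 2) * p.2 ^ 2))
      ((volume.restrict (Set.uIoc 0 u)).prod volume) := by
    have : IsFiniteMeasure (volume.restrict (Set.uIoc 0 u)) :=
      inferInstanceAs (IsFiniteMeasure (volume.restrict (Set.Ioc _ _)))
    refine ((integrable_const (1 : ℝ)).mul_prod (integrable_exp_neg_mul_sq
      (b := (v : ℝ) / 2) (by positivity))).mono' (by fun_prop) (Eventually.of_forall fun p => ?_)
    rw [norm_mul, norm_eq_abs, norm_eq_abs, abs_exp]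
    gcongr
    exact abs_cos_le_one _
  rw [← sub_eq_iff_eq_add', hIic]
  simp only [gaussianPDFReal_eq_integral_cos hv]
  rw [intervalIntegral.integral_const_mul, intervalIntegral_integral_swap hfubini]
  simp only [intervalIntegral.integral_mul_const, integral_cos_mul]

lemma integral_sin_mul_sub (t u : ℝ) :
    ∫ x, sin (t * (u - x)) ∂μ =
      -(Complex.exp ((-(t * u) : ℝ) * Complex.I) * charFun μ t).im := by
  have hexp : Integrable (fun x : ℝ => Complex.exp ((-(t * u) : ℝ) * Complex.I) *
      Complex.exp (t * x * Complex.I)) μ :=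
    Integrable.of_bound (by fun_prop) 1 (Eventually.of_forall fun x => by
      rw [norm_mul, Complex.norm_exp_ofReal_mul_I, ← Complex.ofReal_mul,
        Complex.norm_exp_ofReal_mul_I, one_mul])
  have him := integral_im hexp
  simp only [RCLike.im_to_complex] at him
  rw [charFun_apply_real, ← integral_const_mul, ← him, ← integral_neg]
  refine integral_congr_ae (Eventually.of_forall fun x => ?_)
  simp only
  rw [← Complex.ofReal_mul, ← Complex.exp_add, ← add_mul, ← Complex.ofReal_add,
    Complex.exp_ofReal_mul_I_im, ← sin_neg]
  congr 1
  ring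

section Inversion

variable {μ ν} {v : NNReal}

lemma integrable_sub_mul_sinc_mul_exp (hμ : Integrable id μ) (hv : v ≠ 0) (u : ℝ) :
    Integrable (fun p : ℝ × ℝ => (u - p.1) * sinc (p.2 * (u - p.1)) *
      exp (-((v : ℝ) / 2) * p.2 ^ 2)) (μ.prod volume) := by
  have := continuous_sinc
  refine (((integrable_const u).sub hμ).norm.mul_prod (integrable_exp_neg_mul_sq
    (b := (v : ℝ) / 2) (by positivity))).mono' (by fun_prop) (Eventually.of_forall fun p => ?_)
  rw [norm_mul, norm_mul, norm_eq_abs (exp _), abs_exp]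
  gcongr
  exact mul_le_of_le_one_right (norm_nonneg _) (abs_sinc_le_one _)

lemma conv_gaussianReal_real_Iic (hμ : Integrable id μ) (hv : v ≠ 0) (u : ℝ) :
    (μ ∗ gaussianReal 0 v).real (Set.Iic u) = 1 / 2 + 1 / (2 * π) *
      ∫ t : ℝ, ∫ x, (u - x) * sinc (t * (u - x)) * exp (-((v : ℝ) / 2) * t ^ 2) ∂μ := by
  have hfubini := integrable_sub_mul_sinc_mul_exp hμ hv u
  have hslice : (μ ∗ gaussianReal 0 v).real (Set.Iic u) =
      ∫ x, (gaussianReal 0 v).real (Set.Iic (u - x)) ∂μ := by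
    rw [Measure.conv, map_measureReal_apply measurable_add measurableSet_Iic,
      Measure.real, Measure.prod_apply (measurable_add measurableSet_Iic), ← integral_toReal
      (measurable_measure_prodMk_left (measurable_add measurableSet_Iic)).aemeasurable
      (Eventually.of_forall fun _ => measure_lt_top _ _)]
    simp [Measure.real, Set.preimage, le_sub_iff_add_le', Set.Iic]
  rw [hslice]
  simp only [gaussianReal_real_Iic hv]
  rw [integral_add (integrable_const _) (hfubini.integral_prod_left.const_mul _),
    integral_const_mul, integral_integral_swap hfubini]
  simp

/-- Esseen's smoothing argument, with a Gaussian kernel: the distribution functions of two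
smoothed laws differ by at most an integral of the difference of the characteristic functions. -/
theorem abs_conv_gaussianReal_real_Iic_sub_le (hμ : Integrable id μ) (hν : Integrable id ν)
    (hv : v ≠ 0) {F : ℝ → ℝ} (hF : Integrable F)
    (hle : ∀ t ≠ 0, ‖charFun μ t - charFun ν t‖ / |t| * exp (-((v : ℝ) / 2) * t ^ 2) ≤ F t)
    (u : ℝ) :
    |(μ ∗ gaussianReal 0 v).real (Set.Iic u) - (ν ∗ gaussianReal 0 v).real (Set.Iic u)| ≤
      1 / (2 * π) * ∫ t, F t := by
  rw [conv_gaussianReal_real_Iic hμ hv, conv_gaussianReal_real_Iic hν hv, add_sub_add_left_eq_sub,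
    ← mul_sub, ← integral_sub (integrable_sub_mul_sinc_mul_exp hμ hv u).integral_prod_right
      (integrable_sub_mul_sinc_mul_exp hν hv u).integral_prod_right,
    abs_mul, abs_of_pos (by positivity : 0 < 1 / (2 * π)), ← norm_eq_abs]
  gcongr 1 / (2 * π) * ?_
  refine norm_integral_le_of_norm_le hF ?_
  filter_upwards [compl_mem_ae_iff.2 (measure_singleton (0 : ℝ))] with t ht
  refine le_trans ?_ (hle t ht)
  simp only [mul_sinc_mul ht, integral_mul_const, integral_div, integral_sin_mul_sub]
  rw [← sub_mul, ← sub_div, neg_sub_neg, ← Complex.sub_im, ← mul_sub, norm_mul, norm_div,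
    norm_eq_abs (exp _), abs_exp, norm_eq_abs t]
  gcongr
  refine (Complex.abs_im_le_norm _).trans_eq ?_
  rw [norm_mul, Complex.norm_exp_ofReal_mul_I, one_mul, norm_sub_rev]

end Inversion

variable {μ ν} in
lemma real_Iic_le_of_abs_conv_gaussianReal_sub_le {v : NNReal} {a ε : ℝ} (ha : 0 ≤ a)
    (h : ∀ u, |(μ ∗ gaussianReal 0 v).real (Set.Iic u) -
      (ν ∗ gaussianReal 0 v).real (Set.Iic u)| ≤ ε) (u : ℝ) :
    μ.real (Set.Iic u) ≤ ν.real (Set.Iic (u + 2 * a)) + (ε + 2 * exp (-a ^ 2 / (2 * v))) := by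
  have hμ := real_Iic_sub_le_conv_gaussianReal μ v ha (u + a)
  have hν := conv_gaussianReal_real_Iic_le ν v ha (u + a)
  rw [add_sub_cancel_right] at hμ
  rw [add_assoc, ← two_mul] at hν
  linarith [(abs_le.1 (h (u + a))).2]

lemma integrable_abs_pow_three_mul_exp {b : ℝ} (hb : 0 < b) :
    Integrable fun t : ℝ => |t| ^ 3 * exp (-b * t ^ 2) := by
  refine (integrable_rpow_mul_exp_neg_mul_sq hb (s := 3) (by norm_num)).norm.congr
    (Eventually.of_forall fun t => ?_)
  simp only [norm_mul, norm_eq_abs, abs_exp]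
  rw [← abs_pow, ← rpow_natCast t 3, Nat.cast_ofNat]

lemma integral_abs_pow_three_mul_exp {b : ℝ} (hb : 0 < b) :
    ∫ t : ℝ, |t| ^ 3 * exp (-b * t ^ 2) = 1 / b ^ 2 := by
  have habs := integral_comp_abs (f := fun t : ℝ => t ^ 3 * exp (-b * t ^ 2))
  have hGamma := integral_rpow_mul_exp_neg_mul_rpow (p := 2) (q := 3) (b := b)
    (by norm_num) (by norm_num) hb
  norm_num at hGamma
  simp only [sq_abs, neg_mul] at habs ⊢
  rw [habs, hGamma]
  field_simp

end GaussianSmoothing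

/-! ### Normal approximation for sums of quarter turns -/

lemma abs_prod_sub_pow_le {ι : Type*} (J : Finset ι) (a : ι → ℝ) {b M ε : ℝ}
    (hM : 0 ≤ M) (hb : |b| ≤ M) (ha : ∀ j ∈ J, |a j| ≤ M) (hab : ∀ j ∈ J, |a j - b| ≤ ε) :
    |∏ j ∈ J, a j - b ^ J.card| * M ≤ J.card * ε * M ^ J.card := by
  classical
  induction J using Finset.induction_on with
  | empty => simp
  | insert i J hi ih =>
    have hJ := ih (fun j hj => ha j (Finset.mem_insert_of_mem hj))
      (fun j hj => hab j (Finset.mem_insert_of_mem hj))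
    have hai := ha i (Finset.mem_insert_self i J)
    have habi := hab i (Finset.mem_insert_self i J)
    have : 0 ≤ ε := (abs_nonneg _).trans habi
    rw [Finset.prod_insert hi, Finset.card_insert_of_notMem hi,
      show a i * ∏ j ∈ J, a j - b ^ (J.card + 1) =
        a i * (∏ j ∈ J, a j - b ^ J.card) + (a i - b) * b ^ J.card by ring]
    calc _ ≤ (|a i| * |∏ j ∈ J, a j - b ^ J.card| + |a i - b| * |b| ^ J.card) * M := by
          gcongr
          refine (abs_add_le _ _).trans_eq ?_
          rw [abs_mul, abs_mul, abs_pow]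
      _ = |a i| * (|∏ j ∈ J, a j - b ^ J.card| * M) + |a i - b| * |b| ^ J.card * M := by ring
      _ ≤ M * (J.card * ε * M ^ J.card) + ε * M ^ J.card * M := by gcongr
      _ = _ := by push_cast; ring

/-- The characteristic function of `sin 2π(z + k/4)` for uniform `k`. -/
def quarterChar (z : UnitAddCircle) (t : ℝ) : ℝ :=
  (cos (t * sinC z) + cos (t * cosC z)) / 2

lemma abs_cos_mul_sub_le {a t : ℝ} (ha : |a| ≤ 1) (ht : |t| ≤ 1) :
    |cos (t * a) - (1 - (t * a) ^ 2 / 2)| ≤ 5 / 96 * t ^ 4 := by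
  have hta : |t * a| ≤ |t| := by
    rw [abs_mul]
    exact mul_le_of_le_one_right (abs_nonneg t) ha
  calc _ ≤ |t * a| ^ 4 * (5 / 96) := cos_bound (hta.trans ht)
    _ ≤ |t| ^ 4 * (5 / 96) := by gcongr
    _ = 5 / 96 * t ^ 4 := by rw [(by decide : Even 4).pow_abs t, mul_comm]

lemma abs_quarterChar_sub_le (z : UnitAddCircle) {t : ℝ} (ht : |t| ≤ 1) :
    |quarterChar z t - (1 - t ^ 2 / 4)| ≤ 5 / 96 * t ^ 4 := by
  have hsplit : quarterChar z t - (1 - t ^ 2 / 4) =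
      ((cos (t * sinC z) - (1 - (t * sinC z) ^ 2 / 2)) +
        (cos (t * cosC z) - (1 - (t * cosC z) ^ 2 / 2))) / 2 := by
    rw [quarterChar]
    linear_combination (-t ^ 2 / 4) * sinC_sq_add_cosC_sq z
  rw [hsplit, abs_div, abs_two]
  linarith [abs_add_le (cos (t * sinC z) - (1 - (t * sinC z) ^ 2 / 2))
    (cos (t * cosC z) - (1 - (t * cosC z) ^ 2 / 2)),
    abs_cos_mul_sub_le (abs_sinC_le_one z) ht, abs_cos_mul_sub_le (abs_cosC_le_one z) ht]

section QuarterSum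

variable {N : ℕ} (J : Finset (Fin N)) (z : Fin N → UnitAddCircle)

lemma abs_prod_quarterChar_sub_le {t : ℝ} (ht : |t| ≤ 1) :
    |∏ j ∈ J, quarterChar (z j) t - exp (-(J.card / 4) * t ^ 2)| ≤
      J.card / 4 * t ^ 4 * exp (-(J.card / 8) * t ^ 2) := by
  have ht2 : t ^ 2 ≤ 1 := (sq_le_one_iff_abs_le_one t).2 ht
  have ht4 : t ^ 4 ≤ t ^ 2 := by nlinarith [sq_nonneg t]
  have hM : 1 - t ^ 2 / 8 ≤ exp (-t ^ 2 / 8) := by linarith [add_one_le_exp (-t ^ 2 / 8)]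
  have hexp : |exp (-t ^ 2 / 4) - 1 - -t ^ 2 / 4| ≤ t ^ 4 / 16 :=
    (abs_exp_sub_one_sub_id_le (abs_le.2 ⟨by linarith, by linarith [sq_nonneg t]⟩)).trans_eq
      (by ring)
  have hchar (j) := abs_le.1 (abs_quarterChar_sub_le (z j) ht)
  have hmain := abs_prod_sub_pow_le J (fun j => quarterChar (z j) t)
    (b := exp (-t ^ 2 / 4)) (M := exp (-t ^ 2 / 8)) (ε := 1 / 8 * t ^ 4) (exp_pos _).le
    (by rw [abs_exp, exp_le_exp]; linarith [sq_nonneg t])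
    (fun j _ => abs_le.2
      ⟨by linarith [(hchar j).1, sq_nonneg t], by linarith [(hchar j).2, sq_nonneg t]⟩)
    (fun j _ => abs_le.2 ⟨by linarith [(hchar j).1, (abs_le.1 hexp).2, sq_nonneg (t ^ 2)],
      by linarith [(hchar j).2, (abs_le.1 hexp).1, sq_nonneg (t ^ 2)]⟩)
  rw [← exp_nat_mul, ← exp_nat_mul,
    show (J.card : ℝ) * (-t ^ 2 / 4) = -(J.card / 4) * t ^ 2 by ring,
    show (J.card : ℝ) * (-t ^ 2 / 8) = -(J.card / 8) * t ^ 2 by ring] at hmain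
  linarith [mul_le_mul_of_nonneg_left (by linarith : 1 / 2 ≤ exp (-t ^ 2 / 8))
    (abs_nonneg (∏ j ∈ J, quarterChar (z j) t - exp (-(J.card / 4) * t ^ 2)))]

/-- The sum of `sin 2π(z_j + η_j/4)` over `J`. -/
def quarterSum (η : Fin N → Fin 4) : ℝ :=
  ∑ j ∈ J, sinC (z j + quarter (η j))

instance : IsProbabilityMeasure ((rowLaw N).map (quarterSum J z)) :=
  Measure.isProbabilityMeasure_map Measurable.of_discrete.aemeasurable

lemma charFun_map_quarterSum (t : ℝ) :
    charFun ((rowLaw N).map (quarterSum J z)) t = (∏ j ∈ J, quarterChar (z j) t : ℝ) := by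
  have hquarter (j : Fin N) :
      charFun ((rowLaw N).map fun η => sinC (z j + quarter (η j))) t = quarterChar (z j) t := by
    rw [charFun_apply_real, integral_map Measurable.of_discrete.aemeasurable (by fun_prop),
      integral_rowLaw_eval (fun k => Complex.exp (t * sinC (z j + quarter k) * Complex.I)) j]
    simp only [sinC_add_quarter, Fin.sum_univ_four, Matrix.cons_val]
    rw [quarterChar, Complex.real_smul]
    push_cast
    rw [Complex.cos, Complex.cos]
    ring_nf
  have hprod := congrFun (iIndepFun.charFun_map_fun_finsetSum_eq_prod (s := J)
    (fun _ _ => Measurable.of_discrete.aemeasurable)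
    ((iIndepFun_rowLaw fun j k => sinC (z j + quarter k)).restrict J)) t
  rw [Finset.prod_apply] at hprod
  unfold quarterSum
  simp only [hprod, hquarter, Complex.ofReal_prod]

variable {J}

lemma norm_charFun_map_quarterSum_sub_le (hJ : J.Nonempty) (k : NNReal) {t : ℝ} (ht : t ≠ 0) :
    ‖charFun ((rowLaw N).map (quarterSum J z)) t - charFun (gaussianReal 0 (J.card / 2)) t‖ / |t| *
      exp (-((k : ℝ) / 2) * t ^ 2) ≤
      (J.card : ℝ) / 4 * (|t| ^ 3 * exp (-((J.card : ℝ) / 8) * t ^ 2)) +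
        2 * exp (-(k : ℝ) / 4) * (|t| ^ 3 * exp (-((k : ℝ) / 4) * t ^ 2)) := by
  have : 0 < |t| := abs_pos.2 ht
  rcases le_total |t| 1 with ht1 | ht1
  · have hchar : ‖charFun ((rowLaw N).map (quarterSum J z)) t -
        charFun (gaussianReal 0 (J.card / 2)) t‖ ≤
        J.card / 4 * t ^ 4 * exp (-(J.card / 8) * t ^ 2) := by
      refine le_trans (le_of_eq ?_) (abs_prod_quarterChar_sub_le J z ht1)
      rw [charFun_map_quarterSum, charFun_gaussianReal, ← norm_eq_abs, ← Complex.norm_real]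
      push_cast
      ring_nf
    calc _ ≤ J.card / 4 * t ^ 4 * exp (-(J.card / 8) * t ^ 2) / |t| * 1 := by
          gcongr
          exact exp_le_one_iff.2 (mul_nonpos_of_nonpos_of_nonneg (neg_nonpos.2 (by positivity))
            (sq_nonneg t))
      _ = J.card / 4 * (|t| ^ 3 * exp (-(J.card / 8) * t ^ 2)) := by
          rw [← (by decide : Even 4).pow_abs t]
          field_simp
      _ ≤ _ := le_add_of_nonneg_right (by positivity)
  · have hchar : ‖charFun ((rowLaw N).map (quarterSum J z)) t -
        charFun (gaussianReal 0 (J.card / 2)) t‖ ≤ 2 := by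
      linarith [norm_sub_le (charFun ((rowLaw N).map (quarterSum J z)) t)
        (charFun (gaussianReal 0 (J.card / 2)) t),
        norm_charFun_le_one (μ := (rowLaw N).map (quarterSum J z)) t,
        norm_charFun_le_one (μ := gaussianReal 0 (J.card / 2)) t]
    have hexp : exp (-((k : ℝ) / 2) * t ^ 2) ≤
        exp (-(k : ℝ) / 4) * exp (-((k : ℝ) / 4) * t ^ 2) := by
      rw [← exp_add, exp_le_exp]
      linarith [mul_le_mul_of_nonneg_left ((one_le_sq_iff_one_le_abs t).2 ht1) k.coe_nonneg]
    calc _ ≤ 2 / 1 * (exp (-(k : ℝ) / 4) * exp (-((k : ℝ) / 4) * t ^ 2)) := by gcongr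
      _ = 2 * exp (-(k : ℝ) / 4) * (1 ^ 3 * exp (-((k : ℝ) / 4) * t ^ 2)) := by ring
      _ ≤ 2 * exp (-(k : ℝ) / 4) * (|t| ^ 3 * exp (-((k : ℝ) / 4) * t ^ 2)) := by gcongr
      _ ≤ _ := le_add_of_nonneg_left (by positivity)

lemma abs_quarterSum_conv_gaussianReal_sub_le (hJ : J.Nonempty) {k : NNReal} (hk : 1 ≤ k)
    (u : ℝ) :
    |((rowLaw N).map (quarterSum J z) ∗ gaussianReal 0 k).real (Set.Iic u) -
      (gaussianReal 0 (J.card / 2) ∗ gaussianReal 0 k).real (Set.Iic u)| ≤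
      16 / J.card + 32 * exp (-(k : ℝ) / 4) := by
  have hk1 : (1 : ℝ) ≤ k := by exact_mod_cast hk
  have : (0 : ℝ) < J.card := by exact_mod_cast hJ.card_pos
  have hJint := integrable_abs_pow_three_mul_exp (b := (J.card : ℝ) / 8) (by positivity)
  have hkint := integrable_abs_pow_three_mul_exp (b := (k : ℝ) / 4) (by positivity)
  have hlaw : Integrable id ((rowLaw N).map (quarterSum J z)) :=
    (integrable_map_measure (by fun_prop) Measurable.of_discrete.aemeasurable).2 .of_finite
  refine (abs_conv_gaussianReal_real_Iic_sub_le hlaw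
    ((memLp_id_gaussianReal 1).integrable (by simp)) (zero_lt_one.trans_le hk).ne'
    ((hJint.const_mul _).add (hkint.const_mul _))
    (fun t ht => norm_charFun_map_quarterSum_sub_le z hJ k ht) u).trans ?_
  have hπ : 1 / (2 * π) ≤ 1 := (div_le_one (by positivity)).2 (by linarith [pi_gt_three])
  have hk16 : 1 / ((k : ℝ) / 4) ^ 2 ≤ 16 := by
    rw [div_pow, one_div_div, div_le_iff₀ (by positivity)]
    linarith [one_le_pow₀ hk1 (n := 2)]
  refine (mul_le_of_le_one_left
    (integral_nonneg fun t => add_nonneg (by positivity) (by positivity)) hπ).trans ?_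
  simp only [Pi.add_apply]
  rw [integral_add (hJint.const_mul _) (hkint.const_mul _), integral_const_mul,
    integral_const_mul, integral_abs_pow_three_mul_exp (by positivity),
    integral_abs_pow_three_mul_exp (by positivity)]
  calc _ ≤ (J.card : ℝ) / 4 * (1 / ((J.card : ℝ) / 8) ^ 2) + 2 * exp (-(k : ℝ) / 4) * 16 := by
        gcongr
    _ = 16 / J.card + 32 * exp (-(k : ℝ) / 4) := by
        field_simp
        ring

/-- Gaussian tails turn the normal approximation of the smoothed law into one of the law itself, at
the price of a shift by `h`. -/
lemma rowLaw_quarterSum_le (hJ : J.Nonempty) {h : ℝ} (hh : 1 ≤ h) (v : ℝ) :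
    (rowLaw N).real {η | quarterSum J z η ≤ v} ≤
        (gaussianReal 0 (J.card / 2)).real (Set.Iic (v + h)) +
          (16 / J.card + 34 * exp (-h / 8)) ∧
      (gaussianReal 0 (J.card / 2)).real (Set.Iic (v - h)) ≤
        (rowLaw N).real {η | quarterSum J z η ≤ v} + (16 / J.card + 34 * exp (-h / 8)) := by
  lift h to NNReal using by linarith
  have hsmooth (u : ℝ) := (abs_quarterSum_conv_gaussianReal_sub_le z hJ hh u).trans
    (add_le_add_right (mul_le_mul_of_nonneg_left (exp_le_exp.2 (by linarith :
      -(h : ℝ) / 4 ≤ -h / 8)) (by norm_num)) _)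
  have hlaw : ((rowLaw N).map (quarterSum J z)).real (Set.Iic v) =
      (rowLaw N).real {η | quarterSum J z η ≤ v} :=
    map_measureReal_apply .of_discrete measurableSet_Iic
  have htail : -((h : ℝ) / 2) ^ 2 / (2 * h) = -h / 8 := by field_simp; norm_num
  have hupper := real_Iic_le_of_abs_conv_gaussianReal_sub_le (a := (h : ℝ) / 2) (by positivity)
    hsmooth v
  have hlower := real_Iic_le_of_abs_conv_gaussianReal_sub_le (a := (h : ℝ) / 2) (by positivity)
    (fun u => (abs_sub_comm _ _).trans_le (hsmooth u)) (v - h)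
  rw [mul_div_cancel₀ _ two_ne_zero, htail, hlaw] at hupper
  rw [mul_div_cancel₀ _ two_ne_zero, sub_add_cancel, htail, hlaw] at hlower
  constructor <;> linarith

end QuarterSum

/-! ### The law of the fluctuation at a fixed time -/

lemma gaussianReal_sq_mul_real_Iic {σ : ℝ} (hσ : 0 < σ) (v : NNReal) (u : ℝ) :
    (gaussianReal 0 (σ ^ 2 * v).toNNReal).real (Set.Iic u) =
      (gaussianReal 0 v).real (Set.Iic (u / σ)) := by
  have hv : (σ ^ 2 * v : ℝ).toNNReal = NNReal.mk (σ ^ 2) (sq_nonneg _) * v := by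
    ext
    rw [Real.coe_toNNReal _ (by positivity)]
    rfl
  have hpre : (fun x => σ * x) ⁻¹' Set.Iic u = Set.Iic (u / σ) := by
    ext x
    simp only [Set.mem_preimage, Set.mem_Iic, le_div_iff₀ hσ, mul_comm]
  have hmap := gaussianReal_map_const_mul (μ := 0) (v := v) σ
  rw [mul_zero] at hmap
  rw [hv, ← hmap, map_measureReal_apply (by fun_prop) measurableSet_Iic, hpre]

section NormalApproximation

variable {N : ℕ} {G : SimpleGraph (Fin N)} {α δ : ℝ}

lemma abs_lowSum_sub_quarterSum_le (hα : 0 ≤ α) (hδ : 0 ≤ δ) (hG : 0 < topDeg G) (i : Fin N)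
    (z : Fin N → UnitAddCircle) (e : Fin N → Fin 4 → ℝ)
    (he : ∀ j k, |e j k| ≤ 17 / 6 * (α / topDeg G * deg G j)) (η : Fin N → Fin 4) :
    |lowSum G δ i (fun j => z j + quarter (η j) + (e j (η j) : UnitAddCircle)) -
      quarterSum (lowNbrs G δ i) z η| ≤ 17 / 3 * π * α * δ := by
  have : (0 : ℝ) < topDeg G := by exact_mod_cast hG
  rw [lowSum, quarterSum, ← Finset.sum_sub_distrib]
  calc _ ≤ (lowNbrs G δ i).card • (2 * π * (17 / 6 * (α / topDeg G * δ))) := by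
        refine (Finset.abs_sum_le_sum_abs _ _).trans (Finset.sum_le_card_nsmul _ _ _ fun j hj => ?_)
        refine (abs_sinC_add_coe_sub_le _ _).trans ?_
        gcongr
        exact (he j (η j)).trans (by gcongr; exact (deg_lt_of_mem_lowNbrs hj).le)
    _ ≤ topDeg G * (2 * π * (17 / 6 * (α / topDeg G * δ))) := by
        rw [nsmul_eq_mul]
        gcongr
        exact_mod_cast card_lowNbrs_le_topDeg G δ i
    _ = 17 / 3 * π * α * δ := by
        field_simp
        ring

lemma topDeg_pos_of_lowNbrs_nonempty {i : Fin N} (hJ : (lowNbrs G δ i).Nonempty) :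
    0 < topDeg G := by
  exact_mod_cast (Nat.cast_pos.2 hJ.card_pos).trans_le (card_lowNbrs_le_topDeg G δ i)

lemma dynProb_lowSum_le (hα : 0 ≤ α) (hδ : 0 ≤ δ) {i : Fin N} (hJ : (lowNbrs G δ i).Nonempty)
    {h : ℝ} (hh : 1 ≤ h) (t : ℕ) (u : ℝ) :
    (dynProb N).real {p | lowSum G δ i (traj G α p.1 p.2 t) ≤ u} ≤
      (gaussianReal 0 ((lowNbrs G δ i).card / 2)).real
        (Set.Iic (u + (17 / 3 * π * α * δ + h))) +
        (16 / (lowNbrs G δ i).card + 34 * exp (-h / 8)) := by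
  refine dynProb_traj_le G hα t (measurableSet_le (continuous_lowSum G δ i).measurable
    measurable_const) fun z e he => ?_
  rw [← add_assoc u]
  refine le_trans ?_ (rowLaw_quarterSum_le z hJ hh (u + 17 / 3 * π * α * δ)).1
  refine measureReal_mono fun η hη => ?_
  change quarterSum (lowNbrs G δ i) z η ≤ u + 17 / 3 * π * α * δ
  have hle : lowSum G δ i (fun j => z j + quarter (η j) + (e j (η j) : UnitAddCircle)) ≤ u := hη
  linarith [hle, (abs_le.1 (abs_lowSum_sub_quarterSum_le hα hδ
    (topDeg_pos_of_lowNbrs_nonempty hJ) i z e he η)).1]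

lemma le_dynProb_lowSum_le (hα : 0 ≤ α) (hδ : 0 ≤ δ) {i : Fin N} (hJ : (lowNbrs G δ i).Nonempty)
    {h : ℝ} (hh : 1 ≤ h) (t : ℕ) (u : ℝ) :
    (gaussianReal 0 ((lowNbrs G δ i).card / 2)).real (Set.Iic (u - (17 / 3 * π * α * δ + h))) -
        (16 / (lowNbrs G δ i).card + 34 * exp (-h / 8)) ≤
      (dynProb N).real {p | lowSum G δ i (traj G α p.1 p.2 t) ≤ u} := by
  have hmeas : MeasurableSet {y | lowSum G δ i y ≤ u} :=
    measurableSet_le (continuous_lowSum G δ i).measurable measurable_const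
  have hcompl : (dynProb N).real {p | traj G α p.1 p.2 t ∈ {y | lowSum G δ i y ≤ u}ᶜ} ≤
      1 - ((gaussianReal 0 ((lowNbrs G δ i).card / 2)).real
        (Set.Iic (u - (17 / 3 * π * α * δ + h))) -
          (16 / (lowNbrs G δ i).card + 34 * exp (-h / 8))) := by
    refine dynProb_traj_le G hα t hmeas.compl fun z e he => ?_
    have hq := (rowLaw_quarterSum_le z hJ hh (u - 17 / 3 * π * α * δ)).2
    rw [sub_sub] at hq
    have hsub : {η : Fin N → Fin 4 | (fun j => z j + quarter (η j) + (e j (η j) : UnitAddCircle)) ∈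
        {y | lowSum G δ i y ≤ u}ᶜ} ⊆
        {η | quarterSum (lowNbrs G δ i) z η ≤ u - 17 / 3 * π * α * δ}ᶜ := by
      refine fun η hη hle => hη ?_
      change lowSum G δ i _ ≤ u
      linarith [Set.mem_ofPred.1 hle, (abs_le.1 (abs_lowSum_sub_quarterSum_le hα hδ
        (topDeg_pos_of_lowNbrs_nonempty hJ) i z e he η)).2]
    refine (measureReal_mono hsub).trans ?_
    rw [probReal_compl_eq_one_sub .of_discrete]
    linarith
  have := probReal_compl_eq_one_sub (μ := dynProb N) (measurable_traj G α t hmeas)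
  change (dynProb N).real {p | traj G α p.1 p.2 t ∈ {y | lowSum G δ i y ≤ u}ᶜ} =
    1 - (dynProb N).real {p | lowSum G δ i (traj G α p.1 p.2 t) ≤ u} at this
  linarith

theorem dynProb_fluct_le_mem_Icc {Δ h s₁ : ℝ} (hα : 0 < α) (hδ : 0 ≤ δ) (hΔ : 0 < Δ) (hh : 1 ≤ h)
    {i : Fin N} (hi : i ∈ hubs G Δ) (hJ : (lowNbrs G δ i).Nonempty)
    (hs₁ : α * h / Δ + 17 / 3 * π * α ^ 2 * δ / Δ + 17 / 6 * α * (1 - starIndex G Δ δ) ≤ s₁)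
    (t : ℕ) (s : ℝ) :
    (dynProb N).real {p | fluct G δ α p.1 p.2 i t ≤ s} ∈ Set.Icc
      ((gaussianReal 0 (effCoupling G δ α i ^ 2 /
        (2 * (nodeIndex G δ i * (deg G i : ℝ)))).toNNReal).real (Set.Iic (s - s₁)) -
          (16 / (lowNbrs G δ i).card + 34 * exp (-h / 8)))
      ((gaussianReal 0 (effCoupling G δ α i ^ 2 /
        (2 * (nodeIndex G δ i * (deg G i : ℝ)))).toNNReal).real (Set.Iic (s + s₁)) +
          (16 / (lowNbrs G δ i).card + 34 * exp (-h / 8))) := by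
  have hΔD : Δ < topDeg G := lt_topDeg_of_mem_hubs hi
  set σ := α / (topDeg G : ℝ) with hσdef
  set b := 17 / 6 * α * (1 - starIndex G Δ δ) with hb
  have hσ : 0 < σ := div_pos hα (hΔ.trans hΔD)
  have hvar : effCoupling G δ α i ^ 2 / (2 * (nodeIndex G δ i * (deg G i : ℝ))) =
      σ ^ 2 * (((lowNbrs G δ i).card / 2 : NNReal) : ℝ) := by
    have : (0 : ℝ) < (lowNbrs G δ i).card := by exact_mod_cast hJ.card_pos
    rw [effCoupling_eq, nodeIndex_mul_deg, ← hσdef]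
    push_cast
    field_simp
  have hshift : (17 / 3 * π * α * δ + h) * σ + b ≤ s₁ := by
    refine le_trans ?_ hs₁
    calc _ = α * h / topDeg G + 17 / 3 * π * α ^ 2 * δ / topDeg G + b := by rw [hσdef]; ring
      _ ≤ _ := by gcongr
  have hfluct (p : Noise N × (Fin N → UnitAddCircle)) :=
    abs_le.1 (abs_fluct_sub_lowSum_le hα.le hΔ.le δ p.1 p.2 hi t)
  rw [hvar, gaussianReal_sq_mul_real_Iic hσ, gaussianReal_sq_mul_real_Iic hσ]
  constructor
  · refine (sub_le_sub_right (measureReal_mono (Set.Iic_subset_Iic.2 ?_)) _).trans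
      ((le_dynProb_lowSum_le hα.le hδ hJ hh t ((s - b) / σ)).trans
        (measureReal_mono fun p hp => ?_))
    · rw [div_le_iff₀ hσ, sub_mul, div_mul_cancel₀ _ hσ.ne']
      linarith
    · have hp' := (le_div_iff₀' hσ).1 (Set.mem_ofPred.1 hp)
      exact Set.mem_ofPred.2 (by linarith [(hfluct p).2])
  · refine (measureReal_mono fun p hp => ?_).trans
      ((dynProb_lowSum_le hα.le hδ hJ hh t ((s + b) / σ)).trans
        (add_le_add_left (measureReal_mono (Set.Iic_subset_Iic.2 ?_)) _))
    · refine Set.mem_ofPred.2 ((le_div_iff₀' hσ).2 ?_)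
      linarith [(hfluct p).1, Set.mem_ofPred.1 hp]
    · rw [le_div_iff₀ hσ, add_mul, div_mul_cancel₀ _ hσ.ne']
      linarith

end NormalApproximation

/-! ### Large deviations with the mean computed to second order -/

section SecondOrder

variable {N : ℕ} (G : SimpleGraph (Fin N)) (α : ℝ)

/-- The conditional mean of `sin 2πx_j` one step ahead, to first order in the coupling. -/
def meanShift (y : Fin N → UnitAddCircle) (j : Fin N) : ℝ :=
  -(π * (α / topDeg G * deg G j / 3.6)) * drift (y j)

lemma sum_push_mul_cosC (y : Fin N → UnitAddCircle) (j : Fin N) :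
    ∑ k, 2 * π * push G α y j k * cosC (nodeMap 0 (y j) + quarter k) = 4 * meanShift G α y j := by
  simp only [cosC_add_quarter, Fin.sum_univ_four]
  rw [push_eq G α y j 1, push_eq G α y j 2, push_eq G α y j 3, meanShift, drift]
  simp only [Matrix.cons_val, Fin.val_one, Fin.val_two, Nat.cast_one, Nat.cast_ofNat,
    show ((3 : Fin 4) : ℕ) = 3 from rfl]
  ring

lemma abs_mean_sinC_push_sub_le (y : Fin N → UnitAddCircle) (j : Fin N) {ρ : ℝ}
    (hρ : ∀ k, |push G α y j k| ≤ ρ) :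
    |1 / 4 * ∑ k, sinC (nodeMap 0 (y j) + quarter k + (push G α y j k : UnitAddCircle)) -
      meanShift G α y j| ≤ 4 * π ^ 2 * ρ ^ 2 := by
  set z := nodeMap 0 (y j) with hz
  have hremainder : 1 / 4 * ∑ k, sinC (z + quarter k + (push G α y j k : UnitAddCircle)) -
      meanShift G α y j = 1 / 4 * ∑ k, (sinC (z + quarter k + (push G α y j k : UnitAddCircle)) -
        sinC (z + quarter k) - 2 * π * push G α y j k * cosC (z + quarter k)) := by
    rw [Finset.sum_sub_distrib, Finset.sum_sub_distrib, sum_sinC_add_quarter, hz,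
      sum_push_mul_cosC]
    ring
  rw [hremainder, abs_mul, abs_of_pos (by norm_num : (0 : ℝ) < 1 / 4)]
  calc _ ≤ 1 / 4 * ((Finset.univ : Finset (Fin 4)).card • (4 * π ^ 2 * ρ ^ 2)) := by
        gcongr
        refine (Finset.abs_sum_le_sum_abs _ _).trans (Finset.sum_le_card_nsmul _ _ _ fun k _ => ?_)
        refine (abs_sinC_add_coe_sub_sub_le _ _).trans ?_
        rw [← sq_abs (push G α y j k)]
        gcongr
        exact hρ k
    _ = 4 * π ^ 2 * ρ ^ 2 := by simp

lemma abs_mean_drift_add_quarter_le (z : UnitAddCircle) {e : Fin 4 → ℝ} {ρ : ℝ}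
    (he : ∀ k, |e k| ≤ ρ) :
    |1 / 4 * ∑ k, drift (z + quarter k + (e k : UnitAddCircle))| ≤ 2 * π * ρ := by
  rw [← sub_zero (∑ k, _), ← sum_drift_add_quarter z, ← Finset.sum_sub_distrib, abs_mul,
    abs_of_pos (by norm_num : (0 : ℝ) < 1 / 4)]
  calc _ ≤ 1 / 4 * ((Finset.univ : Finset (Fin 4)).card • (2 * π * ρ)) := by
        gcongr
        refine (Finset.abs_sum_le_sum_abs _ _).trans (Finset.sum_le_card_nsmul _ _ _ fun k _ => ?_)
        exact (abs_drift_add_coe_sub_le _ _).trans (by gcongr; exact he k)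
    _ = 2 * π * ρ := by simp

variable {G α} {δ ρ : ℝ}

lemma mul_deg_le_of_mem_lowNbrs (hα : 0 ≤ α) (hρ : 17 / 6 * (α / topDeg G * δ) ≤ ρ) {i j : Fin N}
    (hj : j ∈ lowNbrs G δ i) : 17 / 6 * (α / topDeg G * deg G j) ≤ ρ :=
  le_trans (by gcongr; exact (deg_lt_of_mem_lowNbrs hj).le) hρ

lemma mul_deg_div_le_of_mem_lowNbrs (hα : 0 ≤ α) (hρ : 17 / 6 * (α / topDeg G * δ) ≤ ρ)
    {i j : Fin N} (hj : j ∈ lowNbrs G δ i) : α / topDeg G * deg G j / 3.6 ≤ ρ := by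
  have : 0 ≤ α / topDeg G * deg G j := by positivity
  refine le_trans ?_ (mul_deg_le_of_mem_lowNbrs hα hρ hj)
  norm_num
  linarith

variable (G α δ) in
lemma dynProb_le_abs_lowSum_zero_le (i : Fin N) {s : ℝ} (hs : 0 < s) :
    (dynProb N).real {p | s ≤ |lowSum G δ i (traj G α p.1 p.2 0)|} ≤
      2 * exp (-s ^ 2 / (2 * topDeg G)) := by
  refine dynProb_le_of_shift (measurableSet_le measurable_const
    ((continuous_lowSum G δ i).abs.measurable.comp (measurable_traj G α 0))) fun ⟨_, x⟩ => ?_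
  have hdev := rowLaw_abs_sum_sub_ge_le (lowNbrs G δ i) (fun j k => sinC (x j + quarter k))
    (fun _ => 0) (c := 1) (r := 0) one_pos le_rfl (fun j _ k => abs_sinC_le_one _)
    (card_lowNbrs_le_topDeg G δ i) (fun j _ => by rw [sum_sinC_add_quarter]; simp) hs
  simp only [sub_zero, mul_zero, add_zero, one_pow, mul_one] at hdev
  exact hdev

lemma dynProb_le_abs_lowSum_sub_le (hα : 0 ≤ α) (hρ : 17 / 6 * (α / topDeg G * δ) ≤ ρ)
    (i : Fin N) (t : ℕ) {s : ℝ} (hs : 0 < s) :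
    (dynProb N).real {p | s + topDeg G * (4 * π ^ 2 * ρ ^ 2) ≤
      |lowSum G δ i (traj G α p.1 p.2 (t + 1)) -
        ∑ j ∈ lowNbrs G δ i, meanShift G α (traj G α p.1 p.2 t) j|} ≤
      2 * exp (-s ^ 2 / (2 * topDeg G)) := by
  have hcont : Continuous fun q : (Fin N → UnitAddCircle) × (Fin N → UnitAddCircle) =>
      |lowSum G δ i q.2 - ∑ j ∈ lowNbrs G δ i, meanShift G α q.1 j| := by
    have := continuous_drift
    have := continuous_lowSum G δ i
    unfold meanShift
    fun_prop
  refine dynProb_step_le G α t (E := {q | s + topDeg G * (4 * π ^ 2 * ρ ^ 2) ≤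
    |lowSum G δ i q.2 - ∑ j ∈ lowNbrs G δ i, meanShift G α q.1 j|})
    (measurableSet_le measurable_const hcont.measurable) fun y => ?_
  have hdev := rowLaw_abs_sum_sub_ge_le (lowNbrs G δ i)
    (fun j k => sinC (nodeMap 0 (y j) + quarter k + (push G α y j k : UnitAddCircle)))
    (meanShift G α y) (c := 1) (r := 4 * π ^ 2 * ρ ^ 2) one_pos (by positivity)
    (fun j _ k => abs_sinC_le_one _) (card_lowNbrs_le_topDeg G δ i)
    (fun j hj => abs_mean_sinC_push_sub_le G α y j fun k =>
      (abs_push_le G hα y j k).trans (mul_deg_le_of_mem_lowNbrs hα hρ hj)) hs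
  simp only [one_pow, mul_one, Finset.sum_sub_distrib] at hdev
  exact hdev

lemma dynProb_le_abs_sum_meanShift_le (hα : 0 ≤ α) (hρ0 : 0 < ρ)
    (hρ : 17 / 6 * (α / topDeg G * δ) ≤ ρ) (i : Fin N) (t : ℕ) {s : ℝ} (hs : 0 < s) :
    (dynProb N).real {p | s * (2 * π * ρ) + topDeg G * (2 * π ^ 2 * ρ ^ 2) ≤
      |∑ j ∈ lowNbrs G δ i, meanShift G α (traj G α p.1 p.2 t) j|} ≤
      2 * exp (-s ^ 2 / (2 * topDeg G)) := by
  have hcont : Continuous fun y => |∑ j ∈ lowNbrs G δ i, meanShift G α y j| := by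
    have := continuous_drift
    unfold meanShift
    fun_prop
  refine dynProb_traj_le G hα t (E := {y | s * (2 * π * ρ) + topDeg G * (2 * π ^ 2 * ρ ^ 2) ≤
    |∑ j ∈ lowNbrs G δ i, meanShift G α y j|})
    (measurableSet_le measurable_const hcont.measurable) fun z e he => ?_
  have hdev := rowLaw_abs_sum_sub_ge_le (lowNbrs G δ i) (fun j k =>
      -(π * (α / topDeg G * deg G j / 3.6)) * drift (z j + quarter k + (e j k : UnitAddCircle)))
    (fun _ => 0) (c := 2 * π * ρ) (r := 2 * π ^ 2 * ρ ^ 2) (by positivity) (by positivity)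
    (fun j hj k => ?_) (card_lowNbrs_le_topDeg G δ i) (fun j hj => ?_)
    (s := s * (2 * π * ρ)) (by positivity)
  · have hexp : -(s * (2 * π * ρ)) ^ 2 / (2 * (topDeg G * (2 * π * ρ) ^ 2)) =
        -s ^ 2 / (2 * topDeg G) := by
      field_simp
    simp only [sub_zero, hexp] at hdev
    exact hdev
  · rw [abs_mul, abs_neg, abs_of_nonneg (by positivity)]
    calc _ ≤ π * ρ * 2 := by
          gcongr
          exacts [mul_deg_div_le_of_mem_lowNbrs hα hρ hj, abs_drift_le _]
      _ = 2 * π * ρ := by ring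
  · rw [sub_zero, ← Finset.mul_sum, mul_left_comm, abs_mul, abs_neg, abs_of_nonneg (by positivity)]
    calc _ ≤ π * ρ * (2 * π * ρ) := by
          gcongr
          exacts [mul_deg_div_le_of_mem_lowNbrs hα hρ hj, abs_mean_drift_add_quarter_le (z j)
            fun k => (he j k).trans (mul_deg_le_of_mem_lowNbrs hα hρ hj)]
      _ = 2 * π ^ 2 * ρ ^ 2 := by ring

/-- The drift has mean zero over the quarter turns, so the first-order mean is itself small except
with small probability: the bias is of second order in the coupling. -/
lemma dynProb_le_abs_lowSum_le (hα : 0 ≤ α) (hρ0 : 0 < ρ) (hρ : 17 / 6 * (α / topDeg G * δ) ≤ ρ)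
    (i : Fin N) (t : ℕ) {s : ℝ} (hs : 0 < s) :
    (dynProb N).real {p | s * (1 + 2 * π * ρ) + topDeg G * (6 * π ^ 2 * ρ ^ 2) ≤
      |lowSum G δ i (traj G α p.1 p.2 t)|} ≤ 4 * exp (-s ^ 2 / (2 * topDeg G)) := by
  cases t with
  | zero =>
    refine le_trans ?_ ((dynProb_le_abs_lowSum_zero_le G α δ i hs).trans (by gcongr; norm_num))
    refine measureReal_mono fun p hp => le_trans ?_ (Set.mem_ofPred.1 hp)
    have : 0 ≤ s * (2 * π * ρ) := by positivity
    have : 0 ≤ topDeg G * (6 * π ^ 2 * ρ ^ 2) := by positivity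
    linarith
  | succ t =>
    calc _ ≤ 2 * exp (-s ^ 2 / (2 * topDeg G)) + 2 * exp (-s ^ 2 / (2 * topDeg G)) := by
          refine (measureReal_mono fun p hp => ?_).trans ((measureReal_union_le _ _).trans
            (add_le_add (dynProb_le_abs_lowSum_sub_le hα hρ i t hs)
              (dynProb_le_abs_sum_meanShift_le hα hρ0 hρ i t hs)))
          by_contra hnot
          simp only [Set.mem_union, Set.mem_ofPred_eq, not_or, not_le] at hnot
          linarith [Set.mem_ofPred.1 hp, hnot.1, hnot.2,
            abs_sub_abs_le_abs_sub (lowSum G δ i (traj G α p.1 p.2 (t + 1)))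
              (∑ j ∈ lowNbrs G δ i, meanShift G α (traj G α p.1 p.2 t) j)]
      _ = 4 * exp (-s ^ 2 / (2 * topDeg G)) := by ring

lemma dynProb_traj_mem_deviantStates_le {Δ K : ℝ} (hα : 0 < α) (hδ : 0 < δ) (hΔ : 0 < Δ)
    (hK : 0 < K) (hspread : 2 * π * (17 / 6 * (α * δ / Δ)) ≤ 1 / 20)
    (hbias : 6 * π ^ 2 * (17 / 6 * (α * δ / Δ)) ^ 2 ≤ K / 8) (t : ℕ) :
    (dynProb N).real {p | traj G α p.1 p.2 t ∈ deviantStates G Δ δ (23 / 8 * K)} ≤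
      (hubs G Δ).card * (4 * exp (-(25 / 8 * (Δ * K ^ 2)))) := by
  have hunion : {p : Noise N × (Fin N → UnitAddCircle) |
      traj G α p.1 p.2 t ∈ deviantStates G Δ δ (23 / 8 * K)} = ⋃ i ∈ hubs G Δ,
        {p | 23 / 8 * K * topDeg G ≤ |lowSum G δ i (traj G α p.1 p.2 t)|} := by
    ext p
    simp [deviantStates]
  rw [hunion, ← nsmul_eq_mul]
  refine (measureReal_biUnion_finset_le _ _).trans (Finset.sum_le_card_nsmul _ _ _ fun i hi => ?_)
  have hΔD : Δ < topDeg G := lt_topDeg_of_mem_hubs hi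
  have hD : (0 : ℝ) < topDeg G := hΔ.trans hΔD
  have hρ : 17 / 6 * (α / topDeg G * δ) ≤ 17 / 6 * (α * δ / Δ) := by
    rw [div_mul_eq_mul_div α]
    gcongr
  refine le_trans ?_ ((dynProb_le_abs_lowSum_le hα.le (by positivity) hρ i t
    (s := 5 / 2 * topDeg G * K) (by positivity)).trans ?_)
  · refine measureReal_mono fun p hp => le_trans ?_ (Set.mem_ofPred.1 hp)
    calc _ ≤ 5 / 2 * topDeg G * K * (1 + 1 / 20) + topDeg G * (K / 8) := by gcongr
      _ = 11 / 4 * K * topDeg G := by ring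
      _ ≤ _ := by linarith [mul_pos hK hD]
  · calc _ = 4 * exp (-(25 / 8 * (topDeg G * K ^ 2))) := by
          congr 2
          field_simp
          norm_num
      _ ≤ _ := by gcongr

theorem one_sub_exp_le_dynProb_window {Δ K : ℝ} (hα : 0 < α) (hδ : 0 < δ) (hΔ : 0 < Δ)
    (hK : 0 < K) (hspread : 2 * π * (17 / 6 * (α * δ / Δ)) ≤ 1 / 20)
    (hbias : 6 * π ^ 2 * (17 / 6 * (α * δ / Δ)) ^ 2 ≤ K / 8)
    (hstar : 17 / 6 * (1 - starIndex G Δ δ) ≤ K / 8) (hN : 8 * (N : ℝ) ≤ exp (Δ * K ^ 2))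
    (t₀ T : ℕ) (hT : T ≤ ⌈exp (Δ * K ^ 2)⌉₊) :
    1 - exp (-(Δ * K ^ 2)) ≤
      (dynProb N).real {p | ∀ i ∈ hubs G Δ, ∀ t : ℕ, t₀ ≤ t → t < t₀ + T →
        |fluct G δ α p.1 p.2 i t| ≤ 3 * α * K} := by
  set D := Δ * K ^ 2 with hD
  have : 0 < D := by positivity
  have hM : ((hubs G Δ).card : ℝ) ≤ N := by exact_mod_cast card_finset_fin_le (hubs G Δ)
  have hT2 : (T : ℝ) ≤ 2 * exp D := by
    linarith [(Nat.cast_le (α := ℝ)).2 hT, Nat.ceil_lt_add_one (exp_pos D).le,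
      one_le_exp (by positivity : 0 ≤ D)]
  set deviant : Set (Noise N × (Fin N → UnitAddCircle)) := ⋃ t ∈ Finset.Ico t₀ (t₀ + T),
    {p | traj G α p.1 p.2 t ∈ deviantStates G Δ δ (23 / 8 * K)} with hdeviant
  have hmeas : MeasurableSet deviant := Finset.measurableSet_biUnion _ fun t _ =>
    measurable_traj G α t (measurableSet_deviantStates _)
  have hprob : (dynProb N).real deviant ≤ exp (-D) :=
    calc _ ≤ (Finset.Ico t₀ (t₀ + T)).card • ((hubs G Δ).card * (4 * exp (-(25 / 8 * D)))) :=
          (measureReal_biUnion_finset_le _ _).trans (Finset.sum_le_card_nsmul _ _ _ fun t _ =>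
            dynProb_traj_mem_deviantStates_le hα hδ hΔ hK hspread hbias t)
      _ = T * ((hubs G Δ).card * (4 * exp (-(25 / 8 * D)))) := by
          rw [Nat.card_Ico, nsmul_eq_mul, Nat.add_sub_cancel_left]
      _ ≤ 2 * exp D * (N * (4 * exp (-(25 / 8 * D)))) := by gcongr
      _ = 8 * N * (exp D * exp (-(25 / 8 * D))) := by ring
      _ ≤ exp D * (exp D * exp (-(25 / 8 * D))) := by gcongr
      _ = exp (-(9 / 8 * D)) := by
          rw [← exp_add, ← exp_add]
          ring_nf
      _ ≤ exp (-D) := exp_le_exp.2 (by linarith)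
  calc 1 - exp (-D) ≤ (dynProb N).real deviantᶜ := by
        rw [probReal_compl_eq_one_sub hmeas]
        linarith
    _ ≤ _ := by
        refine measureReal_mono fun p hp => ?_
        rw [Set.mem_ofPred_eq]
        intro i hi t h0 hlt
        simp only [hdeviant, Set.compl_iUnion, Set.mem_iInter, Finset.mem_Ico] at hp
        linarith [abs_fluct_le_of_notMem_deviantStates hα.le hΔ.le (hp t ⟨h0, hlt⟩) hi,
          mul_le_mul_of_nonneg_left hstar hα.le]

end SecondOrder

/-! ### The Chung–Lu graph -/

section Chernoff

variable {ι : Type*} [Fintype ι] (p : ι → unitInterval)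

lemma mgf_card_filter_pi_bernoulliMeasure_le (E : Finset ι) :
    mgf (fun c => ((E.filter fun e => c e = true).card : ℝ))
      (Measure.pi fun e => bernoulliMeasure true false (p e)) 1 ≤
      exp (2 * ∑ e ∈ E, (p e : ℝ)) := by
  classical
  have hprod : ∀ c : ι → Bool, exp (1 * ((E.filter fun e => c e = true).card : ℝ)) =
      ∏ e, if e ∈ E then exp (if c e = true then (1 : ℝ) else 0) else 1 := fun c => by
    rw [Finset.prod_ite_mem, Finset.univ_inter, ← exp_sum, one_mul, Finset.sum_boole]
  simp only [mgf, hprod]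
  rw [integral_fintype_prod_eq_prod (fun e b =>
    if e ∈ E then exp (if b = true then (1 : ℝ) else 0) else 1), Finset.mul_sum, exp_sum,
    ← Finset.univ_inter E, ← Finset.prod_ite_mem, Finset.univ_inter]
  refine Finset.prod_le_prod (fun e _ => integral_nonneg fun b => ?_) fun e _ => ?_
  · rw [Pi.zero_apply]
    split_ifs <;> positivity
  · split_ifs with he
    · simp only [integral_bernoulliMeasure, if_true, Bool.false_eq_true, if_false, exp_zero,
        smul_eq_mul, mul_one]
      nlinarith [(p e).2.1, exp_one_lt_d9, add_one_le_exp (2 * (p e : ℝ))]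
    · simp

/-- Chernoff's bound for independent Bernoulli variables, with exponential parameter `1`. -/
lemma pi_bernoulliMeasure_le_card_filter_le (E : Finset ι) (s : ℝ) :
    (Measure.pi fun e => bernoulliMeasure true false (p e)).real
      {c | s ≤ ((E.filter fun e => c e = true).card : ℝ)} ≤
      exp (2 * ∑ e ∈ E, (p e : ℝ) - s) :=
  calc _ ≤ exp (-1 * s) * mgf (fun c => ((E.filter fun e => c e = true).card : ℝ))
        (Measure.pi fun e => bernoulliMeasure true false (p e)) 1 :=
      measure_ge_le_exp_mul_mgf s zero_le_one Integrable.of_finite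
    _ ≤ exp (-1 * s) * exp (2 * ∑ e ∈ E, (p e : ℝ)) := by
      gcongr
      exact mgf_card_filter_pi_bernoulliMeasure_le p E
    _ = exp (2 * ∑ e ∈ E, (p e : ℝ) - s) := by
      rw [← exp_add]
      ring_nf

end Chernoff

section Neighbourhoods

variable {N : ℕ}

/-- The probability that two nodes are linked in the Chung–Lu graph. -/
def linkProb (β w m : ℝ) (N : ℕ) (i j : Fin N) : unitInterval :=
  Set.projIcc (0 : ℝ) 1 zero_le_one
    (expDeg β w m N i * expDeg β w m N j / ∑ k : Fin N, expDeg β w m N k)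

lemma linkProb_comm (β w m : ℝ) (i j : Fin N) :
    linkProb β w m N i j = linkProb β w m N j i := by
  rw [linkProb, linkProb, mul_comm]

/-- The pairs that join `i` to a node of `S`: the possible edges from `i` into `S`. -/
def pairsTo (i : Fin N) (S : Finset (Fin N)) : Finset (NodePair N) :=
  Finset.univ.filter fun e => (e.1.1 = i ∧ e.1.2 ∈ S) ∨ (e.1.2 = i ∧ e.1.1 ∈ S)

/-- The end of the pair `e` other than `i`; it is meant for pairs that contain `i`. -/
def otherEnd (i : Fin N) (e : NodePair N) : Fin N := if e.1.1 = i then e.1.2 else e.1.1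

lemma otherEnd_mk_left {i j : Fin N} (h : i < j) : otherEnd i ⟨(i, j), h⟩ = j := if_pos rfl

lemma otherEnd_mk_right {i j : Fin N} (h : j < i) : otherEnd i ⟨(j, i), h⟩ = j := if_neg h.ne

lemma otherEnd_mem_of_mem_pairsTo {i : Fin N} {S : Finset (Fin N)} {e : NodePair N}
    (he : e ∈ pairsTo i S) :
    otherEnd i e ∈ S ∧ (e.1 = (i, otherEnd i e) ∨ e.1 = (otherEnd i e, i)) := by
  obtain ⟨⟨a, b⟩, h⟩ := e
  rw [pairsTo, Finset.mem_filter] at he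
  obtain ⟨-, ⟨rfl, hS⟩ | ⟨rfl, hS⟩⟩ := he
  · rw [otherEnd_mk_left h]
    exact ⟨hS, .inl rfl⟩
  · rw [otherEnd_mk_right h]
    exact ⟨hS, .inr rfl⟩

lemma injOn_otherEnd_pairsTo (i : Fin N) (S : Finset (Fin N)) :
    Set.InjOn (otherEnd i) (pairsTo i S) := by
  intro e he e' he' heq
  have hlt := e.2
  have hlt' := e'.2
  refine Subtype.ext ?_
  rcases (otherEnd_mem_of_mem_pairsTo he).2 with h | h <;>
    rcases (otherEnd_mem_of_mem_pairsTo he').2 with h' | h' <;>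
    rw [h] at hlt ⊢ <;> rw [h', ← heq] at hlt' ⊢
  exacts [absurd hlt hlt'.not_gt, absurd hlt hlt'.not_gt]

lemma card_nbrs_inter_le (c : NodePair N → Bool) (i : Fin N) (S : Finset (Fin N)) :
    (nbrs (graphOf c) i ∩ S).card ≤ ((pairsTo i S).filter fun e => c e = true).card := by
  refine (Finset.card_le_card ?_).trans (Finset.card_image_le (f := otherEnd i))
  intro j hj
  obtain ⟨hj, hS⟩ := Finset.mem_inter.1 hj
  have hadj : (graphOf c).Adj i j := by simpa only [nbrs, Finset.mem_filter_univ] using hj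
  rcases hadj with ⟨h, hc⟩ | ⟨h, hc⟩
  · exact Finset.mem_image.2 ⟨⟨(i, j), h⟩, by simp [pairsTo, hc, hS], otherEnd_mk_left h⟩
  · exact Finset.mem_image.2 ⟨⟨(j, i), h⟩, by simp [pairsTo, hc, hS], otherEnd_mk_right h⟩

lemma sum_pairsTo_linkProb_le (β w m : ℝ) (i : Fin N) (S : Finset (Fin N)) :
    ∑ e ∈ pairsTo i S, (linkProb β w m N e.1.1 e.1.2 : ℝ) ≤
      ∑ j ∈ S, (linkProb β w m N i j : ℝ) :=
  calc _ = ∑ e ∈ pairsTo i S, (linkProb β w m N i (otherEnd i e) : ℝ) := by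
        refine Finset.sum_congr rfl fun e he => ?_
        rcases (otherEnd_mem_of_mem_pairsTo he).2 with h | h <;> rw [h]
        rw [linkProb_comm]
    _ = ∑ j ∈ (pairsTo i S).image (otherEnd i), (linkProb β w m N i j : ℝ) :=
        (Finset.sum_image (f := fun j => (linkProb β w m N i j : ℝ))
          (injOn_otherEnd_pairsTo i S)).symm
    _ ≤ ∑ j ∈ S, (linkProb β w m N i j : ℝ) := by
        refine Finset.sum_le_sum_of_subset_of_nonneg (Finset.image_subset_iff.2 fun e he => ?_)
          fun j _ _ => (linkProb β w m N i j).2.1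
        exact (otherEnd_mem_of_mem_pairsTo he).1

instance (β w m : ℝ) : IsProbabilityMeasure (chungLu β w m N) := by
  unfold chungLu
  infer_instance

lemma chungLu_le_card_nbrs_inter_le (β w m : ℝ) (i : Fin N) (S : Finset (Fin N)) {μ : ℝ} (s : ℝ)
    (hμ : ∑ j ∈ S, (linkProb β w m N i j : ℝ) ≤ μ) :
    (chungLu β w m N).real {c | s ≤ ((nbrs (graphOf c) i ∩ S).card : ℝ)} ≤ exp (2 * μ - s) := by
  refine (measureReal_mono fun c hc => ?_).trans
    ((pi_bernoulliMeasure_le_card_filter_le (fun e : NodePair N => linkProb β w m N e.1.1 e.1.2)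
      (pairsTo i S) s).trans (exp_le_exp.2 ?_))
  · exact (Set.mem_ofPred.1 hc).trans (Nat.cast_le.2 (card_nbrs_inter_le c i S))
  · linarith [sum_pairsTo_linkProb_le β w m i S]

end Neighbourhoods

/-! ### Expected degrees and the star-like index of the Chung–Lu graph -/

section ExpectedDegrees

variable {N : ℕ} {β w m : ℝ}

lemma expDeg_pos (hβ : 2 < β) (hw : 0 < w) (hm : 0 < m) (i : Fin N) : 0 < expDeg β w m N i := by
  have hN : (0 : ℝ) < N := by exact_mod_cast i.pos
  have h1 : 0 < β - 1 := by linarith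
  have : 0 < β - 2 := by linarith
  rw [expDeg]
  positivity

lemma sum_expDeg_nonneg (hβ : 2 < β) (hw : 0 < w) (hm : 0 < m) :
    0 ≤ ∑ k : Fin N, expDeg β w m N k :=
  Finset.sum_nonneg fun k _ => (expDeg_pos hβ hw hm k).le

lemma expDeg_le (hβ : 2 < β) (hw : 0 < w) (hm : 0 < m) (i : Fin N) : expDeg β w m N i ≤ m := by
  have hN : (0 : ℝ) < N := by exact_mod_cast i.pos
  have h1 : 0 < β - 1 := by linarith
  have h2 : 0 < β - 2 := by linarith
  set q := w * (β - 2) / (m * (β - 1)) with hq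
  have hq0 : 0 < q := by positivity
  have hfirst : ((N : ℝ) * q ^ (β - 1)) ^ (-(1 / (β - 1))) =
      (N : ℝ) ^ (-(1 / (β - 1))) * q⁻¹ := by
    rw [mul_rpow hN.le (by positivity), ← rpow_mul hq0.le,
      show (β - 1) * -(1 / (β - 1)) = -1 by field_simp, rpow_neg_one]
  calc expDeg β w m N i
    _ ≤ (β - 2) / (β - 1) * w * (N : ℝ) ^ (1 / (β - 1)) *
        ((N : ℝ) * q ^ (β - 1)) ^ (-(1 / (β - 1))) := by
      rw [expDeg, ← hq]
      gcongr ?_ * ?_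
      refine rpow_le_rpow_of_nonpos (by positivity) (le_add_of_nonneg_right (by positivity)) ?_
      rw [neg_nonpos]
      positivity
    _ = (β - 2) / (β - 1) * w * ((N : ℝ) ^ (1 / (β - 1)) * (N : ℝ) ^ (-(1 / (β - 1)))) * q⁻¹ := by
      rw [hfirst]
      ring
    _ = m := by
      rw [← rpow_add hN, add_neg_cancel, rpow_zero, hq]
      field_simp

lemma le_expDeg (hβ : 2 < β) (hw : 0 < w) (hwm : w ≤ m) (i : Fin N) :
    (β - 2) / (β - 1) * 2 ^ (-(1 / (β - 1))) * w ≤ expDeg β w m N i := by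
  have hN : (0 : ℝ) < N := by exact_mod_cast i.pos
  have h1 : 0 < β - 1 := by linarith
  have : 0 < β - 2 := by linarith
  have hm : 0 < m := hw.trans_le hwm
  set q := w * (β - 2) / (m * (β - 1)) with hq
  have hq0 : 0 < q := by positivity
  have hq1 : q ^ (β - 1) ≤ 1 := by
    refine rpow_le_one hq0.le ?_ h1.le
    rw [hq, div_le_one (by positivity)]
    nlinarith
  have hi : (i.val : ℝ) ≤ N := by exact_mod_cast i.2.le
  calc (β - 2) / (β - 1) * 2 ^ (-(1 / (β - 1))) * w
    _ = (β - 2) / (β - 1) * w * ((N : ℝ) ^ (1 / (β - 1)) * (N : ℝ) ^ (-(1 / (β - 1)))) *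
        2 ^ (-(1 / (β - 1))) := by
      rw [← rpow_add hN, add_neg_cancel, rpow_zero]
      ring
    _ = (β - 2) / (β - 1) * w * (N : ℝ) ^ (1 / (β - 1)) * (2 * (N : ℝ)) ^ (-(1 / (β - 1))) := by
      rw [mul_rpow (by norm_num) hN.le]
      ring
    _ ≤ expDeg β w m N i := by
      rw [expDeg, ← hq]
      gcongr ?_ * ?_
      refine rpow_le_rpow_of_nonpos (by positivity) (by nlinarith) ?_
      rw [neg_nonpos]
      positivity

lemma expDeg_le_mul_rpow (hβ : 2 < β) (hw : 0 < w) (hm : 0 < m) (i : Fin N) (hi : 0 < i.val) :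
    expDeg β w m N i ≤ (β - 2) / (β - 1) * w * (N : ℝ) ^ (1 / (β - 1)) *
      (i.val : ℝ) ^ (-(1 / (β - 1))) := by
  have hN : (0 : ℝ) < N := by exact_mod_cast i.pos
  have h1 : 0 < β - 1 := by linarith
  have : 0 < β - 2 := by linarith
  rw [expDeg]
  gcongr ?_ * ?_
  refine rpow_le_rpow_of_nonpos (Nat.cast_pos.2 hi) (le_add_of_nonneg_left (by positivity)) ?_
  rw [neg_nonpos]
  positivity

lemma linkProb_le (hβ : 2 < β) (hw : 0 < w) (hm : 0 < m) (i j : Fin N) :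
    (linkProb β w m N i j : ℝ) ≤
      expDeg β w m N i * expDeg β w m N j / ∑ k : Fin N, expDeg β w m N k := by
  rw [linkProb, Set.coe_projIcc]
  exact max_le (div_nonneg (mul_nonneg (expDeg_pos hβ hw hm i).le (expDeg_pos hβ hw hm j).le)
    (sum_expDeg_nonneg hβ hw hm)) (min_le_right _ _)

lemma sum_linkProb_le (hβ : 2 < β) (hw : 0 < w) (hm : 0 < m) (i : Fin N) :
    ∑ j, (linkProb β w m N i j : ℝ) ≤ expDeg β w m N i :=
  calc _ ≤ ∑ j, expDeg β w m N i * expDeg β w m N j / ∑ k : Fin N, expDeg β w m N k :=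
        Finset.sum_le_sum fun j _ => linkProb_le hβ hw hm i j
    _ = expDeg β w m N i := by
        rw [← Finset.sum_div, ← Finset.mul_sum]
        exact mul_div_cancel_right₀ _
          (Finset.sum_pos (fun k _ => expDeg_pos hβ hw hm k) ⟨i, Finset.mem_univ i⟩).ne'

lemma mul_rpow_neg_le_sub {a : ℝ} (ha0 : 0 ≤ a) (ha1 : a ≤ 1) (n : ℕ) :
    (1 - a) * ((n + 1 : ℕ) : ℝ) ^ (-a) ≤ ((n + 1 : ℕ) : ℝ) ^ (1 - a) - (n : ℝ) ^ (1 - a) := by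
  push_cast
  have hn : (0 : ℝ) < (n : ℝ) + 1 := by positivity
  have hle : -1 ≤ -1 / ((n : ℝ) + 1) := by
    rw [le_div_iff₀ hn]
    linarith [(Nat.cast_nonneg n : (0 : ℝ) ≤ n)]
  have hbernoulli := rpow_one_add_le_one_add_mul_self hle (by linarith : 0 ≤ 1 - a) (by linarith)
  rw [show 1 + -1 / ((n : ℝ) + 1) = n / (n + 1) by field_simp; ring,
    div_rpow (by positivity) hn.le, div_le_iff₀ (by positivity)] at hbernoulli
  have hpow : ((n : ℝ) + 1) ^ (1 - a) = (n + 1) * ((n : ℝ) + 1) ^ (-a) := by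
    rw [sub_eq_add_neg, rpow_add hn, rpow_one]
  have hexpand : (1 + (1 - a) * (-1 / ((n : ℝ) + 1))) * ((n : ℝ) + 1) ^ (1 - a) =
      ((n : ℝ) + 1) ^ (1 - a) - (1 - a) * ((n : ℝ) + 1) ^ (-a) := by
    rw [hpow]
    field_simp
    ring
  linarith

lemma sum_Icc_rpow_neg_le {a : ℝ} (ha0 : 0 ≤ a) (ha1 : a < 1) (n : ℕ) :
    ∑ k ∈ Finset.Icc 1 n, (k : ℝ) ^ (-a) ≤ (n : ℝ) ^ (1 - a) / (1 - a) := by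
  rw [le_div_iff₀ (by linarith), mul_comm]
  induction n with
  | zero => simpa using rpow_nonneg le_rfl _
  | succ n ih =>
    rw [Finset.sum_Icc_succ_top (by omega), mul_add]
    linarith [mul_rpow_neg_le_sub ha0 ha1.le n]

lemma sum_val_rpow_neg_le {a X : ℝ} (ha0 : 0 ≤ a) (ha1 : a < 1) (hX : 0 ≤ X)
    {S : Finset (Fin N)} (hS : ∀ j ∈ S, 0 < j.val ∧ (j.val : ℝ) ≤ X) :
    ∑ j ∈ S, (j.val : ℝ) ^ (-a) ≤ X ^ (1 - a) / (1 - a) := by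
  have : 0 < 1 - a := by linarith
  calc ∑ j ∈ S, (j.val : ℝ) ^ (-a) = ∑ k ∈ S.map Fin.valEmbedding, (k : ℝ) ^ (-a) :=
        (Finset.sum_map S Fin.valEmbedding fun k : ℕ => (k : ℝ) ^ (-a)).symm
    _ ≤ ∑ k ∈ Finset.Icc 1 ⌊X⌋₊, (k : ℝ) ^ (-a) := by
        refine Finset.sum_le_sum_of_subset_of_nonneg (fun k hk => ?_) fun k _ _ => by positivity
        obtain ⟨j, hj, rfl⟩ := Finset.mem_map.1 hk
        exact Finset.mem_Icc.2 ⟨(hS j hj).1, Nat.le_floor (hS j hj).2⟩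
    _ ≤ (⌊X⌋₊ : ℝ) ^ (1 - a) / (1 - a) := sum_Icc_rpow_neg_le ha0 ha1 _
    _ ≤ X ^ (1 - a) / (1 - a) := by
        gcongr
        exact Nat.floor_le hX

lemma val_le_of_lt_expDeg (hβ : 2 < β) (hw : 0 < w) (hm : 0 < m) {θ : ℝ} (hθ : 0 < θ) {j : Fin N}
    (hj0 : 0 < j.val) (hj : θ < expDeg β w m N j) :
    (j.val : ℝ) ≤ ((β - 2) / (β - 1) * w * (N : ℝ) ^ (1 / (β - 1)) / θ) ^ (β - 1) := by
  have h1 : 0 < β - 1 := by linarith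
  have hj' : (0 : ℝ) < j.val := by exact_mod_cast hj0
  have hlt := hj.trans_le (expDeg_le_mul_rpow hβ hw hm j hj0)
  rw [rpow_neg hj'.le, ← div_eq_mul_inv, lt_div_iff₀ (by positivity), mul_comm,
    ← lt_div_iff₀ hθ] at hlt
  calc (j.val : ℝ) = ((j.val : ℝ) ^ (1 / (β - 1))) ^ (β - 1) := by
        rw [← rpow_mul hj'.le, one_div_mul_cancel h1.ne', rpow_one]
    _ ≤ _ := by gcongr

/-- The first node has to be left out: its weight alone may exceed the bound. -/
lemma sum_expDeg_le_of_lt_expDeg (hβ : 2 < β) (hw : 0 < w) (hm : 0 < m) {θ : ℝ} (hθ : 0 < θ)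
    {S : Finset (Fin N)} (hS : ∀ j ∈ S, 0 < j.val ∧ θ < expDeg β w m N j) :
    ∑ j ∈ S, expDeg β w m N j ≤
      ((β - 2) / (β - 1)) ^ (β - 2) * w * N * (w / θ) ^ (β - 2) := by
  have h1 : 0 < β - 1 := by linarith
  have h2 : 0 < β - 2 := by linarith
  set a := 1 / (β - 1) with ha
  set c := (β - 2) / (β - 1) with hc
  have ha1 : 1 - a = c := by
    rw [ha, hc]
    field_simp
    ring
  have hc0 : 0 < c := by positivity
  set A := c * w * (N : ℝ) ^ a with hA
  calc ∑ j ∈ S, expDeg β w m N j ≤ ∑ j ∈ S, A * (j.val : ℝ) ^ (-a) :=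
        Finset.sum_le_sum fun j hj => expDeg_le_mul_rpow hβ hw hm j (hS j hj).1
    _ = A * ∑ j ∈ S, (j.val : ℝ) ^ (-a) := (Finset.mul_sum _ _ _).symm
    _ ≤ A * (((A / θ) ^ (β - 1)) ^ (1 - a) / (1 - a)) := by
        gcongr
        exact sum_val_rpow_neg_le (by positivity) (by linarith) (by positivity) fun j hj =>
          ⟨(hS j hj).1, val_le_of_lt_expDeg hβ hw hm hθ (hS j hj).1 (hS j hj).2⟩
    _ = w * (N : ℝ) ^ a * (c * (w / θ) * (N : ℝ) ^ a) ^ (β - 2) := by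
        rw [ha1, ← rpow_mul (by positivity), show (β - 1) * c = β - 2 by rw [hc]; field_simp,
          show A / θ = c * (w / θ) * (N : ℝ) ^ a by rw [hA]; ring, hA]
        field_simp
    _ = c ^ (β - 2) * w * ((N : ℝ) ^ a * ((N : ℝ) ^ a) ^ (β - 2)) * (w / θ) ^ (β - 2) := by
        rw [mul_rpow (by positivity) (by positivity), mul_rpow hc0.le (by positivity)]
        ring
    _ = c ^ (β - 2) * w * N * (w / θ) ^ (β - 2) := by
        rw [← rpow_one_add' (by positivity) (by linarith), ← rpow_mul (by positivity),
          show a * (1 + (β - 2)) = 1 by rw [ha]; field_simp; ring, rpow_one]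

/-- The constant in `sum_linkProb_heavyNodes_le`, in terms of the power-law exponent. -/
def tailConst (β : ℝ) : ℝ :=
  ((β - 2) / (β - 1)) ^ (β - 2) / ((β - 2) / (β - 1) * 2 ^ (-(1 / (β - 1))))

lemma tailConst_pos (hβ : 2 < β) : 0 < tailConst β := by
  have h1 : 0 < β - 1 := by linarith
  have : 0 < β - 2 := by linarith
  rw [tailConst]
  positivity

/-- The nodes of expected degree above `θ`. -/
def heavyNodes (β w m : ℝ) (N : ℕ) (θ : ℝ) : Finset (Fin N) :=
  Finset.univ.filter fun j => θ < expDeg β w m N j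

lemma sum_linkProb_heavyNodes_le (hβ : 2 < β) (hw : 0 < w) (hwm : w ≤ m) {θ : ℝ} (hθ : 0 < θ)
    (i : Fin N) :
    ∑ j ∈ heavyNodes β w m N θ, (linkProb β w m N i j : ℝ) ≤
      1 + m * tailConst β * (w / θ) ^ (β - 2) := by
  have hN : (0 : ℝ) < N := by exact_mod_cast i.pos
  have h1 : 0 < β - 1 := by linarith
  have : 0 < β - 2 := by linarith
  have hm : 0 < m := hw.trans_le hwm
  set c₁ := (β - 2) / (β - 1) * 2 ^ (-(1 / (β - 1))) with hc₁
  set first : Fin N := ⟨0, i.pos⟩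
  set S := (heavyNodes β w m N θ).erase first
  have hmem : ∀ j ∈ S, 0 < j.val ∧ θ < expDeg β w m N j := fun j hj =>
    ⟨Nat.pos_of_ne_zero fun h0 => Finset.ne_of_mem_erase hj (Fin.ext h0),
      (Finset.mem_filter.1 (Finset.mem_of_mem_erase hj)).2⟩
  have htotal : c₁ * w * N ≤ ∑ k : Fin N, expDeg β w m N k := by
    have := Finset.card_nsmul_le_sum Finset.univ (fun k : Fin N => expDeg β w m N k) (c₁ * w)
      fun k _ => le_expDeg hβ hw hwm k
    rwa [Finset.card_univ, Fintype.card_fin, nsmul_eq_mul, mul_comm] at this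
  calc ∑ j ∈ heavyNodes β w m N θ, (linkProb β w m N i j : ℝ)
    _ ≤ linkProb β w m N i first + ∑ j ∈ S, (linkProb β w m N i j : ℝ) := by
      refine (Finset.sum_le_sum_of_subset_of_nonneg (Finset.insert_erase_subset first _)
        fun j _ _ => (linkProb β w m N i j).2.1).trans_eq ?_
      exact Finset.sum_insert (Finset.notMem_erase first _)
    _ ≤ 1 + ∑ j ∈ S, m * expDeg β w m N j / (c₁ * w * N) := by
      refine add_le_add (linkProb β w m N i first).2.2 (Finset.sum_le_sum fun j _ =>
        (linkProb_le hβ hw hm i j).trans ?_)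
      have := (expDeg_pos hβ hw hm j).le
      gcongr
      exact expDeg_le hβ hw hm i
    _ = 1 + m * (∑ j ∈ S, expDeg β w m N j) / (c₁ * w * N) := by
      rw [Finset.mul_sum, Finset.sum_div]
    _ ≤ 1 + m * (((β - 2) / (β - 1)) ^ (β - 2) * w * N * (w / θ) ^ (β - 2)) / (c₁ * w * N) := by
      gcongr
      exact sum_expDeg_le_of_lt_expDeg hβ hw hm hθ hmem
    _ = 1 + m * tailConst β * (w / θ) ^ (β - 2) := by
      rw [tailConst, ← hc₁]
      field_simp

end ExpectedDegrees

section StarIndex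

variable {N : ℕ} {β w m δ Δ : ℝ}

lemma one_sub_starIndex_le {G : SimpleGraph (Fin N)} {B : ℝ} (hΔ : 0 < Δ) (hB : 0 ≤ B)
    (hhigh : ∀ i ∈ hubs G Δ, ((highNbrs G δ i).card : ℝ) ≤ B) :
    1 - starIndex G Δ δ ≤ B / Δ := by
  rw [sub_le_comm, starIndex]
  split_ifs
  · refine Finset.le_inf' _ _ fun i hi => ?_
    have hdeg : Δ < deg G i := mem_hubs.1 hi
    have hdeg0 : (0 : ℝ) < deg G i := hΔ.trans hdeg
    rw [sub_le_comm, nodeIndex]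
    calc 1 - ((lowNbrs G δ i).card : ℝ) / deg G i = (highNbrs G δ i).card / deg G i := by
          field_simp
          linarith [card_lowNbrs_add_card_highNbrs G δ i]
      _ ≤ B / Δ := by
          gcongr
          exact hhigh i hi
  · linarith [div_nonneg hB hΔ.le]

lemma chungLu_exists_le_deg_le (hβ : 2 < β) (hw : 0 < w) (hm : 0 < m) :
    (chungLu β w m N).real {c | ∃ j ∉ heavyNodes β w m N (δ / 4), δ ≤ deg (graphOf c) j} ≤
      N * exp (-(δ / 2)) := by
  classical
  calc _ ≤ (chungLu β w m N).real (⋃ j ∈ (heavyNodes β w m N (δ / 4))ᶜ,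
          {c | δ ≤ ((nbrs (graphOf c) j ∩ Finset.univ).card : ℝ)}) := by
        refine measureReal_mono (fun c ⟨j, hj, hle⟩ => ?_) (measure_ne_top _ _)
        simp only [Set.mem_iUnion, Finset.mem_compl, Finset.inter_univ]
        exact ⟨j, hj, hle⟩
    _ ≤ (heavyNodes β w m N (δ / 4))ᶜ.card • exp (-(δ / 2)) := by
        refine (measureReal_biUnion_finset_le _ _).trans
          (Finset.sum_le_card_nsmul _ _ _ fun j hj => ?_)
        have hlight : expDeg β w m N j ≤ δ / 4 := by
          simpa [heavyNodes] using hj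
        refine (chungLu_le_card_nbrs_inter_le β w m j Finset.univ δ
          ((sum_linkProb_le hβ hw hm j).trans hlight)).trans_eq ?_
        ring_nf
    _ ≤ N * exp (-(δ / 2)) := by
        rw [nsmul_eq_mul]
        gcongr
        exact card_finset_fin_le _

lemma chungLu_exists_le_card_nbrs_inter_heavyNodes_le (hβ : 2 < β) (hw : 0 < w) (hwm : w ≤ m)
    {θ : ℝ} (hθ : 0 < θ) :
    (chungLu β w m N).real {c | ∃ i, 2 * (1 + m * tailConst β * (w / θ) ^ (β - 2)) +
      2 * log N ≤ ((nbrs (graphOf c) i ∩ heavyNodes β w m N θ).card : ℝ)} ≤ 1 / N := by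
  set μ := 1 + m * tailConst β * (w / θ) ^ (β - 2) with hμ
  calc _ ≤ ∑ i : Fin N, (chungLu β w m N).real
          {c | 2 * μ + 2 * log N ≤ ((nbrs (graphOf c) i ∩ heavyNodes β w m N θ).card : ℝ)} := by
        rw [Set.ofPred_exists]
        exact measureReal_iUnion_fintype_le _
    _ ≤ ∑ _i : Fin N, 1 / (N : ℝ) ^ 2 := by
        refine Finset.sum_le_sum fun i _ => (chungLu_le_card_nbrs_inter_le β w m i _ _
          (sum_linkProb_heavyNodes_le hβ hw hwm hθ i)).trans_eq ?_
        have hN : (0 : ℝ) < N := by exact_mod_cast i.pos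
        rw [← hμ, show 2 * μ - (2 * μ + 2 * log N) = -(log N * 2) by ring, exp_neg, exp_mul,
          exp_log hN, one_div]
        norm_num
    _ = 1 / N := by
        rw [Finset.sum_const, Finset.card_univ, Fintype.card_fin, nsmul_eq_mul]
        rcases eq_or_ne (N : ℝ) 0 with h0 | h0
        · simp [h0]
        · field_simp

/-- A neighbour of high degree is either heavy, and a hub has few heavy neighbours, or it is light
and its degree is far above its expectation. -/
lemma le_chungLu_one_sub_starIndex_le (hβ : 2 < β) (hw : 0 < w) (hwm : w ≤ m) (hδ : 0 < δ)
    (hΔ : 0 < Δ) :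
    1 - (N * exp (-(δ / 2)) + 1 / N) ≤ (chungLu β w m N).real
      {c | 1 - starIndex (graphOf c) Δ δ ≤
        (2 * (1 + m * tailConst β * (w / (δ / 4)) ^ (β - 2)) + 2 * log N) / Δ} := by
  have hm : 0 < m := hw.trans_le hwm
  set B := 2 * (1 + m * tailConst β * (w / (δ / 4)) ^ (β - 2)) + 2 * log N with hB
  have hB0 : 0 ≤ B := by
    have := tailConst_pos hβ
    have := log_natCast_nonneg N
    positivity
  have hbad := measureReal_union_le (μ := chungLu β w m N) _ _ |>.trans
    (add_le_add (chungLu_exists_le_deg_le (δ := δ) hβ hw hm)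
      (chungLu_exists_le_card_nbrs_inter_heavyNodes_le hβ hw hwm (by positivity : 0 < δ / 4)))
  refine (sub_le_sub_left hbad 1).trans ?_
  rw [← probReal_compl_eq_one_sub .of_discrete]
  refine measureReal_mono fun c hc => ?_
  rw [Set.mem_compl_iff, Set.mem_union, not_or] at hc
  simp only [Set.mem_ofPred_eq, not_exists, not_and, not_le, ← hB] at hc
  refine one_sub_starIndex_le hΔ hB0 fun i _ => le_trans (Nat.cast_le.2 ?_) (hc.2 i).le
  refine Finset.card_le_card fun j hj => ?_
  obtain ⟨hj, hhigh⟩ := Finset.mem_filter.1 hj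
  refine Finset.mem_inter.2 ⟨hj, by_contra fun hheavy => ?_⟩
  exact (hc.1 j hheavy).not_ge hhigh

end StarIndex

/-! ### Asymptotics of the parameters -/

section PowerAsymptotics

variable {f g : ℕ → ℝ}

lemma exists_eventually_le_of_isBigO (h : f =O[atTop] g) (hg : ∀ N, 0 ≤ g N) :
    ∃ C > 0, ∀ᶠ N in atTop, f N ≤ C * g N := by
  obtain ⟨C, hC, hO⟩ := h.exists_pos
  refine ⟨C, hC, hO.bound.mono fun N hN => ?_⟩
  rw [norm_of_nonneg (hg N)] at hN
  exact (le_abs_self _).trans hN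

lemma eventually_le_of_isLittleO (h : f =o[atTop] g) (hg : ∀ N, 0 ≤ g N) {ε : ℝ} (hε : 0 < ε) :
    ∀ᶠ N in atTop, f N ≤ ε * g N := by
  filter_upwards [h.bound hε] with N hN
  rw [norm_of_nonneg (hg N)] at hN
  exact (le_abs_self _).trans hN

lemma natCast_rpow_isBigO {p q : ℝ} (hpq : p ≤ q) :
    (fun N : ℕ => (N : ℝ) ^ p) =O[atTop] fun N : ℕ => (N : ℝ) ^ q := by
  refine IsBigO.of_bound' ?_
  filter_upwards [eventually_ge_atTop 1] with N hN
  rw [norm_of_nonneg (by positivity), norm_of_nonneg (by positivity)]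
  exact rpow_le_rpow_of_exponent_le (by exact_mod_cast hN) hpq

lemma log_natCast_isLittleO_rpow {r : ℝ} (hr : 0 < r) :
    (fun N : ℕ => log N) =o[atTop] fun N : ℕ => (N : ℝ) ^ r :=
  (isLittleO_log_rpow_atTop hr).comp_tendsto tendsto_natCast_atTop_atTop

lemma natCast_rpow_mul_rpow_eventuallyEq (p q : ℝ) :
    (fun N : ℕ => (N : ℝ) ^ p * (N : ℝ) ^ q) =ᶠ[atTop] fun N : ℕ => (N : ℝ) ^ (p + q) := by
  filter_upwards [eventually_gt_atTop 0] with N hN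
  rw [rpow_add (by exact_mod_cast hN)]

lemma eventually_exp_neg_le_rpow {a c : ℝ} (ha : 0 < a) (hc : 0 < c) (hf : ∀ N, 0 ≤ f N)
    (h : (fun N : ℕ => (N : ℝ) ^ a) =O[atTop] f) (k : ℝ) :
    ∀ᶠ N : ℕ in atTop, exp (-(c * f N)) ≤ (N : ℝ) ^ (-k) := by
  obtain ⟨C, hC, hle⟩ := exists_eventually_le_of_isBigO h hf
  have hexp := eventually_le_of_isLittleO (((isLittleO_exp_neg_mul_rpow_atTop (div_pos hc hC)
    (-k / a)).comp_tendsto ((tendsto_rpow_atTop ha).comp (tendsto_natCast_atTop_atTop (R := ℝ)))))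
    (fun N => by simp only [Function.comp_apply]; positivity) one_pos
  filter_upwards [hle, hexp] with N h₁ h₂
  simp only [Function.comp_apply, one_mul, ← rpow_mul (Nat.cast_nonneg (α := ℝ) N),
    mul_div_cancel₀ _ ha.ne'] at h₂
  refine (exp_le_exp.2 ?_).trans h₂
  rw [neg_mul, neg_le_neg_iff, div_mul_eq_mul_div, div_le_iff₀ hC]
  nlinarith

end PowerAsymptotics

/-- The order of magnitude of the proportion of neighbours of a hub that are not of low degree. -/
def highScale (β lam w : ℝ) (N : ℕ) : ℝ :=
  (N : ℝ) ^ (-(lam * ((β - 2) / (β - 1)))) * w ^ (β - 2) + (N : ℝ) ^ (-(1 / (β - 1))) * log N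

/-- The growth of the maximum expected degree `m`, the mean expected degree `w`, the low degree
bound `δ` and the hub degree bound `Δ` (of the order of `m`) with the number of nodes. -/
structure ScalingRegime (β lam : ℝ) (m w δ Δ : ℕ → ℝ) : Prop where
  two_lt : 2 < β
  lam_pos : 0 < lam
  lam_lt_one : lam < 1
  m_pos : ∀ N, 0 < m N
  w_pos : ∀ N, 0 < w N
  δ_pos : ∀ N, 0 < δ N
  Δ_pos : ∀ N, 0 < Δ N
  isTheta_m : m =Θ[atTop] fun N : ℕ => (N : ℝ) ^ (1 / (β - 1))
  isLittleO_w : w =o[atTop] fun N : ℕ => (N : ℝ) ^ (lam / (β - 1))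
  isTheta_Δ : Δ =Θ[atTop] m
  isTheta_δ : δ =Θ[atTop] fun N => Δ N ^ lam

namespace ScalingRegime

variable {β lam : ℝ} {m w δ Δ : ℕ → ℝ}

lemma isTheta_Δ_natCast (h : ScalingRegime β lam m w δ Δ) :
    Δ =Θ[atTop] fun N : ℕ => (N : ℝ) ^ (1 / (β - 1)) :=
  h.isTheta_Δ.trans h.isTheta_m

lemma isTheta_Δ_rpow (h : ScalingRegime β lam m w δ Δ) (r : ℝ) :
    (fun N => Δ N ^ r) =Θ[atTop] fun N : ℕ => (N : ℝ) ^ (r / (β - 1)) := by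
  have hrpow := h.isTheta_Δ_natCast.rpow (r := r)
    (.of_forall fun N => (h.Δ_pos N).le) (.of_forall fun N => by positivity)
  refine hrpow.trans_eventuallyEq (.of_forall fun N => ?_)
  simp only [← rpow_mul (Nat.cast_nonneg (α := ℝ) N), one_div_mul_eq_div]

lemma isTheta_δ_natCast (h : ScalingRegime β lam m w δ Δ) :
    δ =Θ[atTop] fun N : ℕ => (N : ℝ) ^ (lam / (β - 1)) :=
  h.isTheta_δ.trans (h.isTheta_Δ_rpow lam)

lemma isBigO_inv_Δ (h : ScalingRegime β lam m w δ Δ) :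
    (fun N => (Δ N)⁻¹) =O[atTop] fun N : ℕ => (N : ℝ) ^ (-(1 / (β - 1))) := by
  simpa only [rpow_neg_one, neg_div] using (h.isTheta_Δ_rpow (-1)).isBigO

lemma eventually_w_le_m (h : ScalingRegime β lam m w δ Δ) : ∀ᶠ N in atTop, w N ≤ m N := by
  have hβ := h.two_lt
  have hle : lam / (β - 1) ≤ 1 / (β - 1) :=
    div_le_div_of_nonneg_right h.lam_lt_one.le (by linarith)
  have ho := (h.isLittleO_w.trans_isBigO (natCast_rpow_isBigO hle)).trans_isTheta h.isTheta_m.symm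
  simpa only [one_mul] using eventually_le_of_isLittleO ho (fun N => (h.m_pos N).le) one_pos

lemma eventually_one_le_Δ (h : ScalingRegime β lam m w δ Δ) : ∀ᶠ N in atTop, 1 ≤ Δ N := by
  have hβ := h.two_lt
  obtain ⟨C, hC, hle⟩ := exists_eventually_le_of_isBigO h.isTheta_Δ_natCast.symm.isBigO
    fun N => (h.Δ_pos N).le
  have hlim := (tendsto_rpow_atTop (one_div_pos.2 (by linarith : 0 < β - 1))).comp
    (tendsto_natCast_atTop_atTop (R := ℝ))
  filter_upwards [hle, hlim.eventually_ge_atTop C] with N h₁ h₂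
  exact le_of_mul_le_mul_left (by simpa using h₂.trans h₁) hC

lemma highScale_nonneg (h : ScalingRegime β lam m w δ Δ) (N : ℕ) : 0 ≤ highScale β lam (w N) N := by
  have := h.w_pos N
  have := log_natCast_nonneg N
  rw [highScale]
  positivity

lemma isBigO_rpow_low_ratio (h : ScalingRegime β lam m w δ Δ) :
    (fun N => (w N / (δ N / 4)) ^ (β - 2)) =O[atTop]
      fun N : ℕ => (N : ℝ) ^ (-(lam * ((β - 2) / (β - 1)))) * w N ^ (β - 2) := by
  have hβ := h.two_lt
  have hratio : (fun N => w N / (δ N / 4)) =O[atTop]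
      fun N : ℕ => w N * (N : ℝ) ^ (-(lam / (β - 1))) := by
    refine (((isTheta_refl w atTop).div
      h.isTheta_δ_natCast).const_mul_left four_ne_zero).isBigO.congr
      (fun N => by ring) fun N => ?_
    rw [rpow_neg (Nat.cast_nonneg N), div_eq_mul_inv]
  refine (hratio.rpow (r := β - 2) (by linarith) (.of_forall fun N => ?_)).congr_right fun N => ?_
  · have := h.w_pos N
    simp only [Pi.zero_apply]
    positivity
  · rw [mul_rpow (h.w_pos N).le (by positivity), ← rpow_mul (Nat.cast_nonneg N), mul_comm]
    congr 2
    ring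

lemma isBigO_highScale (h : ScalingRegime β lam m w δ Δ) :
    (fun N : ℕ => (2 * (1 + m N * tailConst β * (w N / (δ N / 4)) ^ (β - 2)) + 2 * log N) / Δ N)
      =O[atTop] fun N => highScale β lam (w N) N := by
  have hlow : (fun N : ℕ => m N * (Δ N)⁻¹ * (2 * tailConst β * (w N / (δ N / 4)) ^ (β - 2)))
      =O[atTop] fun N : ℕ => (N : ℝ) ^ (-(lam * ((β - 2) / (β - 1)))) * w N ^ (β - 2) := by
    have hm : (fun N => m N * (Δ N)⁻¹) =O[atTop] fun _ => (1 : ℝ) :=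
      (h.isTheta_Δ.symm.isBigO.mul (isBigO_refl (fun N => (Δ N)⁻¹) _)).congr_right fun N =>
        mul_inv_cancel₀ (h.Δ_pos N).ne'
    simpa only [one_mul] using hm.mul (h.isBigO_rpow_low_ratio.const_mul_left (2 * tailConst β))
  have hlog : (fun N : ℕ => (Δ N)⁻¹ * (2 + 2 * log N)) =O[atTop]
      fun N : ℕ => (N : ℝ) ^ (-(1 / (β - 1))) * log N := by
    have htwo : (fun _ : ℕ => (2 : ℝ)) =O[atTop] fun N : ℕ => log N :=
      ((isLittleO_const_left (c := (2 : ℝ))).2 (.inr (tendsto_norm_atTop_atTop.comp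
        (tendsto_log_atTop.comp tendsto_natCast_atTop_atTop)))).isBigO
    exact h.isBigO_inv_Δ.mul (htwo.add ((isBigO_refl _ _).const_mul_left 2))
  refine (hlow.add_add hlog).congr (fun N => ?_) fun N => ?_
  · ring
  · have := h.w_pos N
    have := log_natCast_nonneg N
    rw [norm_of_nonneg (by positivity), norm_of_nonneg (by positivity), highScale]

end ScalingRegime

namespace ScalingRegime

variable {β lam : ℝ} {m w δ Δ : ℕ → ℝ}

lemma highScale_isLittleO_one (h : ScalingRegime β lam m w δ Δ) :
    (fun N => highScale β lam (w N) N) =o[atTop] fun _ => (1 : ℝ) := by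
  have hβ := h.two_lt
  have hcancel (p : ℝ) :
      (fun N : ℕ => (N : ℝ) ^ (-p) * (N : ℝ) ^ p) =ᶠ[atTop] fun _ => (1 : ℝ) := by
    simpa only [neg_add_cancel, rpow_zero] using natCast_rpow_mul_rpow_eventuallyEq (-p) p
  refine IsLittleO.add ?_ ?_
  · have hw := h.isLittleO_w.rpow (r := β - 2) (by linarith) (.of_forall fun N => by positivity)
    simp only [← rpow_mul (Nat.cast_nonneg _), div_mul_eq_mul_div, mul_div_assoc] at hw
    exact ((isBigO_refl _ _).mul_isLittleO hw).trans_eventuallyEq (hcancel _)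
  · exact ((isBigO_refl _ _).mul_isLittleO
      (log_natCast_isLittleO_rpow (one_div_pos.2 (by linarith)))).trans_eventuallyEq (hcancel _)

lemma eventually_failure_le (h : ScalingRegime β lam m w δ Δ) :
    ∀ᶠ N : ℕ in atTop, N * exp (-(δ N / 2)) + 1 / N ≤ 2 * (N : ℝ) ^ (-(1 / 5) : ℝ) := by
  have hβ := h.two_lt
  have hexp := eventually_exp_neg_le_rpow (div_pos h.lam_pos (by linarith)) one_half_pos
    (fun N => (h.δ_pos N).le) h.isTheta_δ_natCast.symm.isBigO 2
  filter_upwards [hexp, eventually_ge_atTop 1] with N hN h1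
  have hN1 : (1 : ℝ) ≤ N := by exact_mod_cast h1
  have hinv : (N : ℝ)⁻¹ ≤ (N : ℝ) ^ (-(1 / 5) : ℝ) := by
    rw [← rpow_neg_one]
    exact rpow_le_rpow_of_exponent_le hN1 (by norm_num)
  calc N * exp (-(δ N / 2)) + 1 / N
    _ = N * exp (-(1 / 2 * δ N)) + 1 / N := by ring_nf
    _ ≤ N * (N : ℝ) ^ (-2 : ℝ) + 1 / N := by gcongr
    _ = 2 * (N : ℝ)⁻¹ := by
      rw [rpow_neg (by positivity), rpow_ofNat]
      field_simp
      norm_num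
    _ ≤ 2 * (N : ℝ) ^ (-(1 / 5) : ℝ) := by gcongr

end ScalingRegime

section GoodGraphs

variable {β lam : ℝ} {m w δ Δ : ℕ → ℝ}

/-- The graphs in which, up to the constant `C`, the proportion of neighbours of a hub that are not
of low degree is of its typical order of magnitude. -/
def goodGraphs (C β lam w δ Δ : ℝ) (N : ℕ) : Set (SimpleGraph (Fin N)) :=
  {G | 1 - starIndex G Δ δ ≤ C * highScale β lam w N}

theorem exists_eventually_le_chungLu_goodGraphs (h : ScalingRegime β lam m w δ Δ) :
    ∃ C > 0, ∀ᶠ N : ℕ in atTop, 1 - 2 * (N : ℝ) ^ (-(1 / 5) : ℝ) ≤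
      (chungLu β (w N) (m N) N).real
        {c | graphOf c ∈ goodGraphs C β lam (w N) (δ N) (Δ N) N} := by
  obtain ⟨C, hC, hle⟩ := exists_eventually_le_of_isBigO h.isBigO_highScale h.highScale_nonneg
  refine ⟨C, hC, ?_⟩
  filter_upwards [hle, h.eventually_w_le_m, h.eventually_failure_le] with N hN hwm hfail
  calc 1 - 2 * (N : ℝ) ^ (-(1 / 5) : ℝ)
    _ ≤ 1 - (N * exp (-(δ N / 2)) + 1 / N) := by linarith
    _ ≤ _ := le_chungLu_one_sub_starIndex_le h.two_lt (h.w_pos N) hwm (h.δ_pos N) (h.Δ_pos N)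
    _ ≤ _ := measureReal_mono fun c hc => le_trans hc hN

lemma eventually_half_le_card_lowNbrs (h : ScalingRegime β lam m w δ Δ) {C : ℝ} (hC : 0 < C) :
    ∀ᶠ N in atTop, ∀ G ∈ goodGraphs C β lam (w N) (δ N) (Δ N) N, ∀ i ∈ hubs G (Δ N),
      Δ N / 2 ≤ (lowNbrs G (δ N) i).card := by
  filter_upwards [eventually_le_of_isLittleO h.highScale_isLittleO_one (fun _ => zero_le_one)
    (ε := 1 / (2 * C)) (by positivity)] with N hN G hG i hi
  have hhalf : 1 - starIndex G (Δ N) (δ N) ≤ 1 / 2 := by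
    calc 1 - starIndex G (Δ N) (δ N) ≤ C * highScale β lam (w N) N := hG
      _ ≤ C * (1 / (2 * C) * 1) := by gcongr
      _ = 1 / 2 := by field_simp
  calc Δ N / 2 ≤ starIndex G (Δ N) (δ N) * Δ N := by nlinarith [h.Δ_pos N]
    _ ≤ _ := starIndex_mul_le_card_lowNbrs (h.Δ_pos N).le (δ N) hi

end GoodGraphs

/-! ### The normal approximation in the scaling regime -/

section NormalApproximation

variable {β lam : ℝ} {m w δ Δ : ℕ → ℝ}

namespace ScalingRegime

lemma isBigO_δ_div_Δ (h : ScalingRegime β lam m w δ Δ) :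
    (fun N => δ N / Δ N) =O[atTop] fun N : ℕ => (N : ℝ) ^ (-((1 - lam) / (β - 1))) := by
  refine ((h.isTheta_δ_natCast.isBigO.mul h.isBigO_inv_Δ).congr_left fun N => by
    rw [div_eq_mul_inv]).trans_eventuallyEq ?_
  convert natCast_rpow_mul_rpow_eventuallyEq (lam / (β - 1)) (-(1 / (β - 1))) using 4
  ring

lemma isBigO_rpow_neg_mul_log (h : ScalingRegime β lam m w δ Δ) :
    (fun N : ℕ => (N : ℝ) ^ (-(1 / (β - 1))) * log N) =O[atTop]
      fun N : ℕ => (N : ℝ) ^ (-((1 - lam) / (β - 1))) := by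
  have hβ := h.two_lt
  refine ((isBigO_refl _ _).mul (log_natCast_isLittleO_rpow
    (div_pos h.lam_pos (by linarith : 0 < β - 1))).isBigO).trans_eventuallyEq ?_
  convert natCast_rpow_mul_rpow_eventuallyEq (-(1 / (β - 1))) (lam / (β - 1)) using 4
  ring

lemma exists_eventually_smoothing_scale_le (h : ScalingRegime β lam m w δ Δ) {Cg : ℝ}
    (hCg : 0 < Cg) :
    ∃ C > 0, ∀ᶠ N : ℕ in atTop, ∀ α > 0, ∀ ν, 1 - ν ≤ Cg * highScale β lam (w N) N →
      α * Δ N ^ lam / Δ N + 17 / 3 * π * α ^ 2 * δ N / Δ N + 17 / 6 * α * (1 - ν) ≤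
        C * α * ((1 + α) * (N : ℝ) ^ (-((1 - lam) / (β - 1))) +
          (N : ℝ) ^ (-(lam * ((β - 2) / (β - 1)))) * w N ^ (β - 2)) := by
  obtain ⟨A, hA, hpow⟩ := exists_eventually_le_of_isBigO (h.isTheta_Δ_rpow (lam - 1)).isBigO
    fun N => by positivity
  obtain ⟨B, hB, hδ⟩ := exists_eventually_le_of_isBigO h.isBigO_δ_div_Δ fun N => by positivity
  obtain ⟨D, hD, hlog⟩ := exists_eventually_le_of_isBigO h.isBigO_rpow_neg_mul_log
    fun N => by positivity
  refine ⟨A + 17 / 3 * π * B + 17 / 6 * Cg * (1 + D), by positivity, ?_⟩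
  filter_upwards [hpow, hδ, hlog] with N hA' hB' hD' α hα ν hν
  have := h.w_pos N
  rw [show (lam - 1) / (β - 1) = -((1 - lam) / (β - 1)) by ring] at hA'
  rw [highScale] at hν
  set X := (N : ℝ) ^ (-((1 - lam) / (β - 1)))
  set Y := (N : ℝ) ^ (-(lam * ((β - 2) / (β - 1)))) * w N ^ (β - 2)
  have hY : 0 ≤ Y := by positivity
  have hX : 0 ≤ X := by positivity
  set S := (1 + α) * X + Y
  have hαX : 0 ≤ α * X := by positivity
  calc α * Δ N ^ lam / Δ N + 17 / 3 * π * α ^ 2 * δ N / Δ N + 17 / 6 * α * (1 - ν)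
    _ = α * (Δ N ^ (lam - 1) + 17 / 3 * π * (α * (δ N / Δ N)) + 17 / 6 * (1 - ν)) := by
      rw [rpow_sub_one (h.Δ_pos N).ne']
      ring
    _ ≤ α * (A * X + 17 / 3 * π * (α * (B * X)) + 17 / 6 * (Cg * (Y + D * X))) := by
      gcongr
      exact hν.trans (by gcongr)
    _ ≤ α * (A * S + 17 / 3 * π * (B * S) + 17 / 6 * (Cg * (S + D * S))) := by
      have hXS : X ≤ S := by simp only [S]; linarith
      have hαXS : α * (B * X) ≤ B * S := by simp only [S]; nlinarith
      have hYS : Y ≤ S := by simp only [S]; linarith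
      gcongr
    _ = _ := by ring

lemma exists_eventually_normal_error_le (h : ScalingRegime β lam m w δ Δ) :
    ∃ C > 0, ∀ᶠ N : ℕ in atTop, 32 / Δ N + 34 * exp (-(Δ N ^ lam) / 8) ≤
      C * (N : ℝ) ^ (-(1 / (2 * β - 2))) := by
  have hβ := h.two_lt
  have hle : -(1 / (β - 1)) ≤ -(1 / (2 * β - 2)) :=
    neg_le_neg (one_div_le_one_div_of_le (by linarith) (by linarith))
  obtain ⟨A, hA, hinv⟩ := exists_eventually_le_of_isBigO
    (h.isBigO_inv_Δ.trans (natCast_rpow_isBigO hle)) fun N => by positivity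
  have hexp := eventually_exp_neg_le_rpow (c := 1 / 8) (div_pos h.lam_pos (by linarith))
    (by norm_num) (fun N => rpow_nonneg (h.Δ_pos N).le lam) (h.isTheta_Δ_rpow lam).symm.isBigO
    (1 / (2 * β - 2))
  refine ⟨32 * A + 34, by positivity, ?_⟩
  filter_upwards [hinv, hexp] with N hinvN hexpN
  rw [show -(Δ N ^ lam) / 8 = -(1 / 8 * Δ N ^ lam) by ring, div_eq_mul_inv]
  linarith

end ScalingRegime

theorem eventually_dynProb_fluct_le_mem_Icc (h : ScalingRegime β lam m w δ Δ) {Cg : ℝ}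
    (hCg : 0 < Cg) :
    ∀ᶠ C : ℝ in atTop, ∀ᶠ N : ℕ in atTop,
      ∀ G ∈ goodGraphs Cg β lam (w N) (δ N) (Δ N) N, ∀ α > 0, ∀ i ∈ hubs G (Δ N), ∀ t s,
      let F : ℝ → ℝ := fun u => cdf (gaussianReal 0 (effCoupling G (δ N) α i ^ 2 /
        (2 * (nodeIndex G (δ N) i * (deg G i : ℝ)))).toNNReal) u
      let s₁ : ℝ := C * α * ((1 + α) * (N : ℝ) ^ (-((1 - lam) / (β - 1))) +
        (N : ℝ) ^ (-(lam * ((β - 2) / (β - 1)))) * w N ^ (β - 2))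
      let s₂ : ℝ := C * (N : ℝ) ^ (-(1 / (2 * β - 2)))
      (dynProb N).real {p | fluct G (δ N) α p.1 p.2 i t ≤ s} ∈
        Set.Icc (F (s - s₁) - s₂) (F (s + s₁) + s₂) := by
  obtain ⟨A, -, hscale⟩ := h.exists_eventually_smoothing_scale_le hCg
  obtain ⟨B, -, herror⟩ := h.exists_eventually_normal_error_le
  filter_upwards [eventually_ge_atTop A, eventually_ge_atTop B] with C hAC hBC
  filter_upwards [hscale, herror, eventually_half_le_card_lowNbrs h hCg, h.eventually_one_le_Δ]
    with N hscaleN herrorN hcard hΔ1 G hG α hα i hi t s F s₁ s₂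
  have hΔ := h.Δ_pos N
  have := h.w_pos N
  have hJ0 : (0 : ℝ) < (lowNbrs G (δ N) i).card := (half_pos hΔ).trans_le (hcard G hG i hi)
  have hs₁ := (hscaleN α hα _ hG).trans (show _ ≤ s₁ by simp only [s₁]; gcongr)
  have hs₂ : 16 / (lowNbrs G (δ N) i).card + 34 * exp (-(Δ N ^ lam) / 8) ≤ s₂ := by
    calc 16 / ((lowNbrs G (δ N) i).card : ℝ) + 34 * exp (-(Δ N ^ lam) / 8)
      _ ≤ 16 / (Δ N / 2) + 34 * exp (-(Δ N ^ lam) / 8) := by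
        gcongr
        exact hcard G hG i hi
      _ = 32 / Δ N + 34 * exp (-(Δ N ^ lam) / 8) := by ring
      _ ≤ B * (N : ℝ) ^ (-(1 / (2 * β - 2))) := herrorN
      _ ≤ s₂ := by simp only [s₂]; gcongr
  have hmain := dynProb_fluct_le_mem_Icc hα (h.δ_pos N).le hΔ
    (one_le_rpow hΔ1 h.lam_pos.le) hi (Finset.card_pos.1 (by exact_mod_cast hJ0)) hs₁ t s
  simp only [F, cdf_eq_real]
  exact ⟨by linarith [hmain.1], by linarith [hmain.2]⟩

end NormalApproximation

/-! ### The time window in the scaling regime -/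

section Window

variable {β lam κ : ℝ} {m w δ Δ α : ℕ → ℝ}

namespace ScalingRegime

lemma mul_δ_div_Δ_isLittleO (h : ScalingRegime β lam m w δ Δ)
    (hα : α =o[atTop] fun N : ℕ => (N : ℝ) ^ ((1 - lam) / (2 * β - 2))) :
    (fun N => α N * (δ N / Δ N)) =o[atTop] fun N : ℕ => (N : ℝ) ^ (-((1 - lam) / (2 * β - 2))) := by
  have hβ : 0 < β - 1 := by linarith [h.two_lt]
  refine (hα.mul_isBigO h.isBigO_δ_div_Δ).trans_eventuallyEq ?_
  convert natCast_rpow_mul_rpow_eventuallyEq ((1 - lam) / (2 * β - 2)) (-((1 - lam) / (β - 1)))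
    using 4
  rw [show 2 * β - 2 = 2 * (β - 1) by ring]
  field_simp
  ring

lemma mul_δ_div_Δ_isLittleO_one (h : ScalingRegime β lam m w δ Δ)
    (hα : α =o[atTop] fun N : ℕ => (N : ℝ) ^ ((1 - lam) / (2 * β - 2))) :
    (fun N => α N * (δ N / Δ N)) =o[atTop] fun _ => (1 : ℝ) := by
  have hp : 0 ≤ (1 - lam) / (2 * β - 2) :=
    div_nonneg (by linarith [h.lam_lt_one]) (by linarith [h.two_lt])
  simpa only [rpow_zero] using
    (h.mul_δ_div_Δ_isLittleO hα).trans_isBigO (natCast_rpow_isBigO (neg_nonpos.2 hp))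

lemma mul_δ_div_Δ_sq_isLittleO (h : ScalingRegime β lam m w δ Δ) (hκ : κ ≤ 1 - lam)
    (hα : α =o[atTop] fun N : ℕ => (N : ℝ) ^ ((1 - lam) / (2 * β - 2))) :
    (fun N => (α N * (δ N / Δ N)) ^ 2) =o[atTop] fun N => Δ N ^ (-κ) := by
  have hβ : 0 < β - 1 := by linarith [h.two_lt]
  have hsq : (fun N => (α N * (δ N / Δ N)) ^ 2) =o[atTop]
      fun N : ℕ => (N : ℝ) ^ (-((1 - lam) / (β - 1))) := by
    refine ((h.mul_δ_div_Δ_isLittleO hα).pow two_pos).congr_right fun N => ?_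
    rw [← rpow_mul_natCast (Nat.cast_nonneg N), show 2 * β - 2 = 2 * (β - 1) by ring]
    congr 1
    field_simp
    norm_num
  refine (hsq.trans_isBigO (natCast_rpow_isBigO ?_)).trans_isTheta (h.isTheta_Δ_rpow (-κ)).symm
  rw [← neg_div]
  exact div_le_div_of_nonneg_right (by linarith) hβ.le

lemma highScale_isLittleO (h : ScalingRegime β lam m w δ Δ) (hκ : κ < 1)
    (hw : (fun N : ℕ => (N : ℝ) ^ (-(lam * ((β - 2) / (β - 1)))) * w N ^ (β - 2))
      =o[atTop] fun N => Δ N ^ (-κ)) :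
    (fun N => highScale β lam (w N) N) =o[atTop] fun N => Δ N ^ (-κ) := by
  have hβ : 0 < β - 1 := by linarith [h.two_lt]
  refine hw.add (IsLittleO.trans_isTheta ?_ (h.isTheta_Δ_rpow (-κ)).symm)
  refine ((isBigO_refl _ _).mul_isLittleO
    (log_natCast_isLittleO_rpow (div_pos (sub_pos.2 hκ) hβ))).trans_eventuallyEq ?_
  convert natCast_rpow_mul_rpow_eventuallyEq (-(1 / (β - 1))) ((1 - κ) / (β - 1)) using 4
  ring

lemma eventually_eight_mul_le_exp (h : ScalingRegime β lam m w δ Δ) {r : ℝ} (hr : 0 < r) :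
    ∀ᶠ N : ℕ in atTop, 8 * (N : ℝ) ≤ exp (Δ N ^ r) := by
  filter_upwards [eventually_exp_neg_le_rpow (div_pos hr (by linarith [h.two_lt])) one_pos
    (fun N => rpow_nonneg (h.Δ_pos N).le r) (h.isTheta_Δ_rpow r).symm.isBigO 2,
    eventually_ge_atTop 8] with N hN h8
  have hN8 : (8 : ℝ) ≤ N := by exact_mod_cast h8
  rw [one_mul, exp_neg, rpow_neg (by positivity), rpow_ofNat,
    inv_le_inv₀ (exp_pos _) (by positivity)] at hN
  nlinarith

end ScalingRegime

lemma mul_rpow_neg_sq {x : ℝ} (hx : 0 < x) (κ : ℝ) : x * (x ^ (-κ)) ^ 2 = x ^ (1 - 2 * κ) := by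
  rw [← rpow_mul_natCast hx.le]
  nth_rewrite 1 [← rpow_one x]
  rw [← rpow_add hx]
  congr 1
  push_cast
  ring

theorem eventually_le_dynProb_window (h : ScalingRegime β lam m w δ Δ) {C : ℝ} (hC : 0 < C)
    (hα0 : ∀ N, 0 < α N) (hα : α =o[atTop] fun N : ℕ => (N : ℝ) ^ ((1 - lam) / (2 * β - 2)))
    (hκ : κ < 1 / 2) (hκlam : κ ≤ 1 - lam)
    (hw : (fun N : ℕ => (N : ℝ) ^ (-(lam * ((β - 2) / (β - 1)))) * w N ^ (β - 2))
      =o[atTop] fun N => Δ N ^ (-κ)) :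
    ∀ᶠ N in atTop, ∀ G ∈ goodGraphs C β lam (w N) (δ N) (Δ N) N, ∀ t₀ T : ℕ,
      T ≤ ⌈exp (Δ N ^ (1 - 2 * κ))⌉₊ → 1 - exp (-(Δ N ^ (1 - 2 * κ))) ≤
        (dynProb N).real {p | ∀ i ∈ hubs G (Δ N), ∀ t : ℕ, t₀ ≤ t → t < t₀ + T →
          |fluct G (δ N) (α N) p.1 p.2 i t| ≤ 3 * α N * Δ N ^ (-κ)} := by
  have hK0 (N : ℕ) : 0 < Δ N ^ (-κ) := rpow_pos_of_pos (h.Δ_pos N) _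
  filter_upwards [eventually_le_of_isLittleO (h.mul_δ_div_Δ_isLittleO_one hα)
      (fun _ => zero_le_one) (ε := 3 / (340 * π)) (by positivity),
    eventually_le_of_isLittleO (h.mul_δ_div_Δ_sq_isLittleO hκlam hα) (fun N => (hK0 N).le)
      (ε := 1 / (400 * π ^ 2)) (by positivity),
    eventually_le_of_isLittleO (h.highScale_isLittleO (by linarith) hw) (fun N => (hK0 N).le)
      (ε := 1 / (24 * C)) (by positivity),
    h.eventually_eight_mul_le_exp (r := 1 - 2 * κ) (by linarith)]
    with N hspread hbias hhigh hexp G hG t₀ T hT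
  rw [← mul_rpow_neg_sq (h.Δ_pos N)] at hexp hT ⊢
  refine one_sub_exp_le_dynProb_window (hα0 N) (h.δ_pos N) (h.Δ_pos N) (hK0 N) ?_ ?_ ?_ hexp t₀ T hT
  · calc 2 * π * (17 / 6 * (α N * δ N / Δ N)) = 2 * π * (17 / 6 * (α N * (δ N / Δ N))) := by ring
      _ ≤ 2 * π * (17 / 6 * (3 / (340 * π) * 1)) := by gcongr
      _ = 1 / 20 := by field_simp; norm_num
  · calc 6 * π ^ 2 * (17 / 6 * (α N * δ N / Δ N)) ^ 2
      _ = 6 * π ^ 2 * (17 / 6) ^ 2 * (α N * (δ N / Δ N)) ^ 2 := by ring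
      _ ≤ 6 * π ^ 2 * (17 / 6) ^ 2 * (1 / (400 * π ^ 2) * Δ N ^ (-κ)) := by gcongr
      _ = 6 * (17 / 6) ^ 2 / 400 * Δ N ^ (-κ) := by field_simp
      _ ≤ Δ N ^ (-κ) / 8 := by linarith [hK0 N]
  · calc 17 / 6 * (1 - starIndex G (Δ N) (δ N)) ≤ 17 / 6 * (C * highScale β lam (w N) N) := by
          gcongr
          exact hG
      _ ≤ 17 / 6 * (C * (1 / (24 * C) * Δ N ^ (-κ))) := by gcongr
      _ = 17 / 6 / 24 * Δ N ^ (-κ) := by field_simp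
      _ ≤ Δ N ^ (-κ) / 8 := by linarith [hK0 N]

end Window

end HubDynamics

end

open HubDynamics in
theorem theoremC_general {β lam : ℝ} {m w δ Δ α : ℕ → ℝ} (h : ScalingRegime β lam m w δ Δ)
    (hα0 : ∀ N, 0 < α N)
    (hα : α =o[atTop] fun N : ℕ => (N : ℝ) ^ ((1 - lam) / (2 * β - 2))) :
    ∃ C : ℝ, 0 < C ∧ ∃ N₀ : ℕ, ∃ good : ∀ N : ℕ, Set (SimpleGraph (Fin N)),
      (∀ N ≥ N₀, 1 - C * (N : ℝ) ^ (-(1 / 5) : ℝ) ≤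
        (chungLu β (w N) (m N) N).real {c | graphOf c ∈ good N}) ∧
      (∀ N ≥ N₀, ∀ G ∈ good N,
        (∀ i ∈ hubs G (Δ N), ∀ (ω : Noise N) (x : Fin N → UnitAddCircle) (t : ℕ),
          traj G (α N) ω x (t + 1) i =
            reducedMap (effCoupling G (δ N) (α N) i) (ω (t, i)) (traj G (α N) ω x t i) +
              ((fluct G (δ N) (α N) ω x i t : ℝ) : UnitAddCircle)) ∧
        1 - starIndex G (Δ N) (δ N) ≤
          C * ((N : ℝ) ^ (-(lam * ((β - 2) / (β - 1)))) * w N ^ (β - 2) +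
            (N : ℝ) ^ (-(1 / (β - 1))) * Real.log N) ∧
        (∀ ε : ℝ,
          17 / 2 * α N * (1 - starIndex G (Δ N) (δ N)) ≤ ε →
          34 * Real.pi * α N ^ 2 * δ N / Δ N ≤ ε →
          C * α N * √(Real.log ((hubs G (Δ N)).card + 1) / Δ N) ≤ ε →
          ∀ᵐ p ∂(dynProb N),
            1 - Real.exp (-(starIndex G (Δ N) (δ N) * Δ N * ε ^ 2 / (19 * α N ^ 2))) ≤
              liminf (fun T : ℕ => (1 / (T : ℝ)) * ∑ t ∈ Finset.range T,
                Set.indicator {s : ℕ | ∀ i ∈ hubs G (Δ N), |fluct G (δ N) (α N) p.1 p.2 i s| ≤ ε}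
                  (fun _ => (1 : ℝ)) t) atTop) ∧
        (∀ i ∈ hubs G (Δ N), ∀ (t : ℕ) (s : ℝ),
          let F : ℝ → ℝ := fun u => cdf (gaussianReal 0
            (effCoupling G (δ N) (α N) i ^ 2 /
              (2 * (nodeIndex G (δ N) i * (deg G i : ℝ)))).toNNReal) u
          let s₁ : ℝ := C * α N * ((1 + α N) * (N : ℝ) ^ (-((1 - lam) / (β - 1))) +
            (N : ℝ) ^ (-(lam * ((β - 2) / (β - 1)))) * w N ^ (β - 2))
          let s₂ : ℝ := C * (N : ℝ) ^ (-(1 / (2 * β - 2)))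
          (dynProb N).real {p | fluct G (δ N) (α N) p.1 p.2 i t ≤ s} ∈
            Set.Icc (F (s - s₁) - s₂) (F (s + s₁) + s₂))) ∧
      (∀ κ : ℝ, κ < 1 / 2 → κ ≤ 1 - lam →
        ((fun N : ℕ => (N : ℝ) ^ (-(lam * ((β - 2) / (β - 1)))) * w N ^ (β - 2))
          =o[atTop] fun N : ℕ => Δ N ^ (-κ)) →
        ∃ N₁ : ℕ, ∀ N ≥ N₁, ∀ G ∈ good N, ∀ t₀ T : ℕ,
          T ≤ ⌈Real.exp (Δ N ^ (1 - 2 * κ))⌉₊ →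
          1 - Real.exp (-(Δ N ^ (1 - 2 * κ))) ≤
            (dynProb N).real {p | ∀ i ∈ hubs G (Δ N), ∀ t : ℕ, t₀ ≤ t → t < t₀ + T →
              |fluct G (δ N) (α N) p.1 p.2 i t| ≤ 3 * α N * Δ N ^ (-κ)}) := by
  obtain ⟨Cg, hCg, hprob⟩ := exists_eventually_le_chungLu_goodGraphs h
  obtain ⟨C, hC6, hCgC, hnormal⟩ := ((eventually_ge_atTop (6 : ℝ)).and
    ((eventually_ge_atTop Cg).and (eventually_dynProb_fluct_le_mem_Icc h hCg))).exists
  obtain ⟨N₀, hN₀⟩ := eventually_atTop.1 (hprob.and hnormal)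
  refine ⟨C, by linarith, N₀, fun N => goodGraphs Cg β lam (w N) (δ N) (Δ N) N,
    fun N hN => ?_, fun N hN G hG => ⟨fun i _ ω x t => ?_, ?_, fun ε => ?_, ?_⟩,
    fun κ hκ hκlam hwκ => ?_⟩
  · refine le_trans ?_ (hN₀ N hN).1
    gcongr
    linarith
  · exact traj_succ_eq_reducedMap G (δ N) (α N) ω x i t
  · exact le_trans hG (mul_le_mul_of_nonneg_right hCgC (h.highScale_nonneg N))
  · exact ae_le_liminf_frequency (hα0 N) (h.δ_pos N) (h.Δ_pos N) hC6
  · exact (hN₀ N hN).2 G hG (α N) (hα0 N)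
  · exact eventually_atTop.1 (eventually_le_dynProb_window h hCg hα0 hα hκ hκlam hwκ)

open HubDynamics in
theorem theoremC
    (β cHub lam : ℝ) (hβ : 2 < β) (hcHub : cHub ∈ Set.Ioo (0 : ℝ) 1) (hlam : lam ∈ Set.Ioo (0 : ℝ) 1)
    -- the parameters `m, w, δ, α` as functions of the number `N` of nodes
    (m w δ α : ℕ → ℝ)
    (hm0 : ∀ N, 0 < m N) (hw0 : ∀ N, 0 < w N) (hδ0 : ∀ N, 0 < δ N) (hα0 : ∀ N, 0 < α N)
    (hm : m =Θ[atTop] fun N : ℕ => (N : ℝ) ^ (1 / (β - 1)))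
    (hw : w =o[atTop] fun N : ℕ => (N : ℝ) ^ (lam / (β - 1)))
    -- the hub scale is `Δ = cHub * m`
    (Δ : ℕ → ℝ) (hΔ : ∀ N, Δ N = cHub * m N)
    (hδ : δ =Θ[atTop] fun N : ℕ => Δ N ^ lam)
    (hα : α =o[atTop] fun N : ℕ =>
      min ((N : ℝ) ^ (lam * ((β - 2) / (β - 1)))) ((N : ℝ) ^ ((1 - lam) / (2 * β - 2)))) :
    ∃ C : ℝ, 0 < C ∧ ∃ N₀ : ℕ, ∃ good : ∀ N : ℕ, Set (SimpleGraph (Fin N)),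
      -- the Chung–Lu network is good with probability `1 - O(N^{-1/5})`
      (∀ N ≥ N₀, 1 - C * (N : ℝ) ^ (-(1 / 5) : ℝ) ≤
        (chungLu β (w N) (m N) N).real {c | graphOf c ∈ good N}) ∧
      (∀ N ≥ N₀, ∀ G ∈ good N,
        -- hubs follow the reduced map at effective coupling `α_i`, up to the fluctuation `ξ_i^t`
        (∀ i ∈ hubs G (Δ N), ∀ (ω : Noise N) (x : Fin N → UnitAddCircle) (t : ℕ),
          traj G (α N) ω x (t + 1) i =
            reducedMap (effCoupling G (δ N) (α N) i) (ω (t, i)) (traj G (α N) ω x t i) +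
              ((fluct G (δ N) (α N) ω x i t : ℝ) : UnitAddCircle)) ∧
        1 - starIndex G (Δ N) (δ N) ≤
          C * ((N : ℝ) ^ (-(lam * ((β - 2) / (β - 1)))) * w N ^ (β - 2) +
            (N : ℝ) ^ (-(1 / (β - 1))) * Real.log N) ∧
        -- (i)
        (∀ ε : ℝ,
          17 / 2 * α N * (1 - starIndex G (Δ N) (δ N)) ≤ ε →
          34 * Real.pi * α N ^ 2 * δ N / Δ N ≤ ε →
          C * α N * √(Real.log ((hubs G (Δ N)).card + 1) / Δ N) ≤ ε →
          ∀ᵐ p ∂(dynProb N),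
            1 - Real.exp (-(starIndex G (Δ N) (δ N) * Δ N * ε ^ 2 / (19 * α N ^ 2))) ≤
              liminf (fun T : ℕ => (1 / (T : ℝ)) * ∑ t ∈ Finset.range T,
                Set.indicator {s : ℕ | ∀ i ∈ hubs G (Δ N), |fluct G (δ N) (α N) p.1 p.2 i s| ≤ ε}
                  (fun _ => (1 : ℝ)) t) atTop) ∧
        -- (iii)
        (∀ i ∈ hubs G (Δ N), ∀ (t : ℕ) (s : ℝ),
          let F : ℝ → ℝ := fun u => cdf (gaussianReal 0
            (effCoupling G (δ N) (α N) i ^ 2 /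
              (2 * (nodeIndex G (δ N) i * (deg G i : ℝ)))).toNNReal) u
          let s₁ : ℝ := C * α N * ((1 + α N) * (N : ℝ) ^ (-((1 - lam) / (β - 1))) +
            (N : ℝ) ^ (-(lam * ((β - 2) / (β - 1)))) * w N ^ (β - 2))
          let s₂ : ℝ := C * (N : ℝ) ^ (-(1 / (2 * β - 2)))
          (dynProb N).real {p | fluct G (δ N) (α N) p.1 p.2 i t ≤ s} ∈
            Set.Icc (F (s - s₁) - s₂) (F (s + s₁) + s₂))) ∧
      -- (ii)
      (∀ κ : ℝ, 0 < κ → κ < min (1 / 2) (min (1 - lam) (lam * ((β - 2) / (β - 1)))) →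
        ((fun N : ℕ => (N : ℝ) ^ (-(lam * ((β - 2) / (β - 1)))) * w N ^ (β - 2))
          =o[atTop] fun N : ℕ => Δ N ^ (-κ)) →
        ((fun N : ℕ => α N * w N / Δ N) =o[atTop] fun N : ℕ => Δ N ^ (-κ)) →
        ∃ N₁ : ℕ, ∀ N ≥ N₁, ∀ G ∈ good N, ∀ t₀ T : ℕ,
          T ≤ ⌈Real.exp (Δ N ^ (1 - 2 * κ))⌉₊ →
          1 - Real.exp (-(Δ N ^ (1 - 2 * κ))) ≤
            (dynProb N).real {p | ∀ i ∈ hubs G (Δ N), ∀ t : ℕ, t₀ ≤ t → t < t₀ + T →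
              |fluct G (δ N) (α N) p.1 p.2 i t| ≤ 3 * α N * Δ N ^ (-κ)}) := by
  have hΔm : Δ =Θ[atTop] m :=
    (funext hΔ : Δ = _) ▸ (isTheta_refl m atTop).const_mul_left hcHub.1.ne'
  have hα' : α =o[atTop] fun N : ℕ => (N : ℝ) ^ ((1 - lam) / (2 * β - 2)) :=
    hα.trans_le fun N => by
      rw [Real.norm_of_nonneg (by positivity), Real.norm_of_nonneg (by positivity)]
      exact min_le_right _ _
  obtain ⟨C, hC, N₀, good, hgood, hdyn, hwindow⟩ := theoremC_general
    ⟨hβ, hlam.1, hlam.2, hm0, hw0, hδ0, fun N => hΔ N ▸ mul_pos hcHub.1 (hm0 N), hm, hw, hΔm, hδ⟩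
    hα0 hα'
  exact ⟨C, hC, N₀, good, hgood, hdyn, fun κ _ hκ hwκ _ =>
    hwindow κ (lt_min_iff.1 hκ).1 (lt_min_iff.1 (lt_min_iff.1 hκ).2).1.le hwκ⟩
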